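/- **Setting.** Let $K$ be a field of characteristic zero, complete with respect to a discrete valuation, with valuation ring $R$ and algebraically closed residue field of characteristic $p>0$; write $\mathrm{val}$ for the additive valuation normalized by $\mathrm{val}(p)=1$. Let $\mathsf Y=(\mathrm{Spf}\,R[[z]])\otimes K$ be the rigid open unit disk over $K$ and let $G\subset\mathrm{Aut}_K(\mathsf Y)$ be a finite group, acting on analytic functions on $\mathsf Y$. For a nonzero bounded analytic function $f=\sum_i a_iz^i$ on $\mathsf Y$ put $\mathrm{val}_{\mathsf Y}(f)=\min_i\mathrm{val}(a_i)$ (Gauss valuation), and let $\#_{\mathsf Y}f$ be the order in $z$ of the reduction of $f/c$, where $c\in K$ and $\mathrm{val}(c)=\mathrm{val}_{\mathsf Y}(f)$. Define functions $\delta_{\mathsf Y}^G$ (depth character) and $a_{\mathsf Y}^G$ (Artin character) on $G$ by $$\delta_{\mathsf Y}^G(\sigma)=-|G|\cdot\mathrm{val}_{\mathsf Y}(\sigma(z)-z),\qquad a_{\mathsf Y}^G(\sigma)=-\#_{\mathsf Y}(\sigma(z)-z)\qquad(\sigma\neq1),$$ and by requiring that the sum of all values of each function be $0$. **Characters.** Let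 $R^+(G)$ be the set of characters of finite-dimensional complex representations of $G$, let $R(G,\mathbb Q)$ be their $\mathbb Q$-span, and let $R^+(G,\mathbb Q)$ be the set of $\chi\in R(G,\mathbb Q)$ with $\langle\psi,\chi\rangle\ge0$ for all $\psi\in R^+(G)$. Let $u_H$ be the regular minus the trivial character of a group $H$; for $H\subset G$ let $\chi^*$ denote the induction of $\chi$ from $H$ to $G$. For a cyclic group $P=\langle\sigma\rangle$ of order $p^m$ let $\delta_P^{\rm mult}(\sigma^a)=-p^{\mathrm{ord}_p(a)+1}/(p-1)$ for $p^m\nmid a$ and $\delta_P^{\rm mult}(1)=-\sum_{\tau\ne1}\delta_P^{\rm mult}(\tau)=mp^m$. **Hurwitz trees.** A *Hurwitz tree* $\mathcal T$ of type $(G,p)$ consists of: a finite tree with a root $v_0$ which lies on exactly one edge $e_0$, all edges $e$ being oriented away from the root, from $s(e)$ to $t(e)$ (write $v\to v'$ if there is an edge from $v$ to $v'$, and call $v'$ a successor of $v$; a leaf is a vertex without successor); a number $\epsilon_e\in\mathbb Q_{\ge0}$ for each edge $e$, with $\epsilon_e=0$ if and only if $t(e)$ is a leaf; for each vertex $v$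 a subgroup $G_v\subset G$, given up to conjugation, and $\delta_v\in R^+(G,\mathbb Q)$; and $a_e\in R^+(G)$ for each edge $e$; such that 1. up to conjugation $G_{v'}\subset G_v$ whenever $v\to v'$; $\sum_{v\to v'}[G_v:G_{v'}]>1$ for every vertex $v$ that is neither the root nor a leaf; and $G_{v_0}=G_{v'}=G$ for the unique successor $v'$ of $v_0$; 2. $G_b$ is nontrivial and cyclic for every leaf $b$; 3. $a_e=\sum_{s(e')=t(e)}a_{e'}$ if $t(e)$ is not a leaf, and $a_e=u_{G_b}^*$ if $b=t(e)$ is a leaf; 4. $\delta_{t(e)}=\delta_{s(e)}+\epsilon_e\,(a_e-u_{G_{t(e)}}^*)$ for every edge $e$; 5. $\delta_b=(\delta_{P_b}^{\rm mult})^*$ for every leaf $b$, where $P_b$ is the Sylow $p$-subgroup of $G_b$ and $^*$ is induction from $P_b$ to $G$. Its depth is $\delta_{\mathcal T}=\delta_{v_0}$ and its Artin character is $a_{\mathcal T}=a_{e_0}$. **Theorem.** Suppose that the set $\Delta\subset\mathsf Y(\bar K)$ of geometric points that are fixed by some $\sigma\in G\setminus\{1\}$ is nonempty. Then there exists a Hurwitz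 tree $\mathcal T$ of type $(G,p)$ with $$\delta_{\mathcal T}=\delta_{\mathsf Y}^G,\qquad a_{\mathcal T}=a_{\mathsf Y}^G.$$ -/

import Mathlib

noncomputable section

namespace HurwitzDisk

/-! ### Characters of finite groups -/

section Characters

variable {G : Type*} [Group G]

/-- `R⁺(G)`: the true characters of `G`, i.e. the characters of the finite-dimensional complex
representations of `G`, viewed as functions `G → ℂ`. -/
def trueCharacters (G : Type*) [Group G] : Set (G → ℂ) :=
  {χ | ∃ (n : ℕ) (ρ : Representation ℂ G (Fin n → ℂ)), χ = ρ.character}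

/-- The scalar product `⟨χ₁, χ₂⟩ = |G|⁻¹ ∑_σ conj (χ₁ σ) χ₂ σ`. -/
def scalarProduct (χ₁ χ₂ : G → ℂ) : ℂ :=
  (Nat.card G : ℂ)⁻¹ * ∑ᶠ σ : G, (starRingEnd ℂ) (χ₁ σ) * χ₂ σ

/-- `R(G, ℚ) = R(G) ⊗ ℚ`, viewed inside the functions `G → ℂ`: the `ℚ`-span of the characters. -/
def rationalVirtualCharacters (G : Type*) [Group G] : Submodule ℚ (G → ℂ) :=
  Submodule.span ℚ (trueCharacters G)

/-- `R⁺(G, ℚ)`: those `χ ∈ R(G, ℚ)` for which `⟨ψ, χ⟩` is a nonnegative rational number for every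
true character `ψ`. -/
def nonnegRationalCharacters (G : Type*) [Group G] : Set (G → ℂ) :=
  {χ | χ ∈ rationalVirtualCharacters G ∧
    ∀ ψ ∈ trueCharacters G, ∃ q : ℚ, 0 ≤ q ∧ scalarProduct ψ χ = (q : ℂ)}

open Classical in
/-- The augmentation character `u_G = r_G - 1_G`. -/
def augmentation (G : Type*) [Group G] : G → ℂ :=
  fun σ => (if σ = 1 then (Nat.card G : ℂ) else 0) - 1

open Classical in
/-- Induction of (virtual) characters from a subgroup `H` to `G`, on class functions:
`χ^*(σ) = |H|⁻¹ ∑_{τ ∈ G, τ⁻¹ σ τ ∈ H} χ (τ⁻¹ σ τ)`. -/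
def induced (H : Subgroup G) (χ : H → ℂ) : G → ℂ :=
  fun σ => (Nat.card H : ℂ)⁻¹ *
    ∑ᶠ τ : G, if h : τ⁻¹ * σ * τ ∈ H then χ ⟨τ⁻¹ * σ * τ, h⟩ else 0

/-- The induced character `u_H^*` on `G`. -/
def inducedAugmentation (H : Subgroup G) : G → ℂ :=
  induced H (augmentation H)

open Classical in
/-- The function on `G` that agrees with `f` away from `1` and whose value at `1` is
`-∑_{σ ≠ 1} f σ`. -/
def balanced (f : G → ℂ) : G → ℂ :=
  fun σ => if σ = 1 then -∑ᶠ τ : {τ : G // τ ≠ 1}, f τ else f σ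

/-- The character `δ_P^mult` of a cyclic group `P` of order `p ^ m`. If `σ` generates `P` and
`p ^ m ∤ a`, its value at `σ ^ a` is `-p ^ (i + 1) / (p - 1)` with `i = ord_p a`; here
`p ^ i = |P| / ord (σ ^ a)`, see `deltaMult_pow`. Its value at `1` is minus the sum of the other
values. -/
def deltaMult (p : ℕ) (P : Type*) [Group P] : P → ℂ :=
  balanced fun σ => -((p : ℂ) ^ (padicValNat p (Nat.card P / orderOf σ) + 1) / ((p : ℂ) - 1))

theorem deltaMult_pow {p m a : ℕ} [hp : Fact p.Prime] {P : Type*} [Group P] (σ : P)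
    (hσ : ∀ τ : P, τ ∈ Subgroup.zpowers σ) (hcard : Nat.card P = p ^ m) (ha : ¬ p ^ m ∣ a) :
    deltaMult p P (σ ^ a) = -((p : ℂ) ^ (padicValNat p a + 1) / ((p : ℂ) - 1)) := by
  have ho : orderOf σ = p ^ m := by rw [← hcard]; exact orderOf_eq_card_of_forall_mem_zpowers hσ
  have hne : σ ^ a ≠ 1 := fun h => ha (ho ▸ orderOf_dvd_of_pow_eq_one h)
  have ha0 : a ≠ 0 := fun h => ha (h ▸ dvd_zero _)
  have hpos : 0 < p ^ m := pow_pos hp.out.pos m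
  have hfin : IsOfFinOrder σ := orderOf_pos_iff.mp (ho ▸ hpos)
  have hle : padicValNat p a < m := by
    by_contra h
    exact ha ((padicValNat_dvd_iff_le ha0).mpr (not_lt.mp h))
  have hg : Nat.gcd (p ^ m) a = p ^ padicValNat p a := by
    obtain ⟨j, hj, h⟩ := (Nat.dvd_prime_pow hp.out).mp (Nat.gcd_dvd_left (p ^ m) a)
    rw [h]
    refine Nat.dvd_antisymm (pow_dvd_pow p ?_) ?_
    · exact (padicValNat_dvd_iff_le ha0).mp (h ▸ Nat.gcd_dvd_right (p ^ m) a)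
    · rw [← h]
      exact Nat.dvd_gcd (pow_dvd_pow p hle.le) pow_padicValNat_dvd
  have hq : Nat.card P / orderOf (σ ^ a) = p ^ padicValNat p a := by
    rw [hfin.orderOf_pow, ho, hg, hcard, Nat.pow_div hle.le hp.out.pos,
      Nat.pow_div (Nat.sub_le _ _) hp.out.pos, Nat.sub_sub_self hle.le]
  simp only [deltaMult, balanced, if_neg hne, hq, padicValNat.prime_pow]

end Characters

/-! ### Metric trees and Hurwitz trees -/

/-- A (finite) rooted tree, in the sense required here: a tree with a distinguished vertex, the root, which is adjacent to
exactly one vertex (equivalently, connected to exactly one edge). -/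
structure TrunkTree where
  V : Type
  finite_V : Finite V
  graph : SimpleGraph V
  isTree : graph.IsTree
  root : V
  existsUnique_adj_root : ∃! w, graph.Adj root w

namespace TrunkTree

variable (T : TrunkTree)

/-- `T.Succ v w` (written `v → w`): `v` and `w` are joined by an edge `e`, and `v` lies in the
connected component of the root after removal of `e`, so that `v` is the source and `w` the target
of `e`. -/
def Succ (v w : T.V) : Prop :=
  T.graph.Adj v w ∧ (T.graph.deleteEdges {s(v, w)}).Reachable T.root v

/-- The edges of `T`, with their natural orientation. -/
structure Edge where
  src : T.V
  tgt : T.V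
  succ : T.Succ src tgt

/-- The leaves, i.e. the maximal vertices: those without successor. -/
def IsLeaf (v : T.V) : Prop := ∀ w, ¬ T.Succ v w

/-- The trunk: the unique edge at the root. -/
def trunk : T.Edge where
  src := T.root
  tgt := T.existsUnique_adj_root.choose
  succ := ⟨T.existsUnique_adj_root.choose_spec.1, SimpleGraph.Reachable.refl _⟩

end TrunkTree

/-- A metric tree: the thickness of an edge vanishes exactly when its target is a leaf. -/
structure MetricTree extends TrunkTree where
  thickness : toTrunkTree.Edge → ℚ
  thickness_nonneg : ∀ e, 0 ≤ thickness e
  thickness_eq_zero_iff : ∀ e, thickness e = 0 ↔ toTrunkTree.IsLeaf e.tgt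

/-- A Hurwitz tree of type `(G, p)`. The conjugacy class `[G_v]` is given by a representative
`monodromy v`; all conditions depend on its conjugacy class only. -/
structure HurwitzTree (G : Type*) [Group G] (p : ℕ) extends MetricTree where
  monodromy : V → Subgroup G
  artinChar : toTrunkTree.Edge → G → ℂ
  artinChar_mem : ∀ e, artinChar e ∈ trueCharacters G
  depthChar : V → G → ℂ
  depthChar_mem : ∀ v, depthChar v ∈ nonnegRationalCharacters G
  /-- Up to conjugation, `G_w ⊆ G_v` for every successor `w` of `v`. -/
  monodromy_succ : ∀ v w, toTrunkTree.Succ v w →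
    ∃ g : G, (monodromy w).map (MulAut.conj g).toMonoidHom ≤ monodromy v
  /-- `∑_{v → w} [G_v : G_w] > 1`, for `v` neither the root nor a leaf. -/
  one_lt_sum_index : ∀ v, v ≠ root → ¬ toTrunkTree.IsLeaf v →
    1 < ∑ᶠ w : {w : V // toTrunkTree.Succ v w},
      (Nat.card (monodromy v) : ℚ) / Nat.card (monodromy w)
  /-- At the root and at its unique successor `w`, `G_v = G_w = G`. -/
  monodromy_root : monodromy root = ⊤
  monodromy_root_succ : ∀ w, toTrunkTree.Succ root w → monodromy w = ⊤
  /-- `G_b` is nontrivial and cyclic for every leaf `b`. -/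
  monodromy_leaf : ∀ b, toTrunkTree.IsLeaf b → monodromy b ≠ ⊥ ∧ IsCyclic (monodromy b)
  /-- `a_e` is the sum of the `a_{e'}` over the edges `e'` with `s(e') = t(e)`, if `t(e)` is no leaf. -/
  artinChar_eq_sum : ∀ e, ¬ toTrunkTree.IsLeaf e.tgt →
    artinChar e = ∑ᶠ e' : {e' : toTrunkTree.Edge // e'.src = e.tgt}, artinChar e'
  /-- `a_e = u_{G_b}^*` if `b = t(e)` is a leaf. -/
  artinChar_leaf : ∀ e, toTrunkTree.IsLeaf e.tgt →
    artinChar e = inducedAugmentation (monodromy e.tgt)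
  /-- `δ_{t(e)} = δ_{s(e)} + ε_e s_e`, where `s_e = a_e - u_{G_{t(e)}}^*`. -/
  depthChar_tgt : ∀ e, depthChar e.tgt = depthChar e.src +
    (thickness e : ℂ) • (artinChar e - inducedAugmentation (monodromy e.tgt))
  /-- `δ_b = (δ_{P_b}^mult)^*` for every leaf `b`, with `P_b` the Sylow `p`-subgroup of `G_b`. -/
  depthChar_leaf : ∀ b, toTrunkTree.IsLeaf b → ∀ P : Sylow p (monodromy b),
    depthChar b = induced ((P : Subgroup (monodromy b)).map (monodromy b).subtype)
      (deltaMult p ((P : Subgroup (monodromy b)).map (monodromy b).subtype))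

namespace HurwitzTree

variable {G : Type*} [Group G] {p : ℕ} (T : HurwitzTree G p)

/-- The depth `δ_T = δ_{v₀}` of a Hurwitz tree. -/
def depth : G → ℂ := T.depthChar T.root

/-- The Artin character `a_T = a_{e₀}` of a Hurwitz tree. -/
def artin : G → ℂ := T.artinChar T.trunk

end HurwitzTree

/-! ### The open disk -/

section Disk

variable (K : Type*) [NontriviallyNormedField K] [IsUltrametricDist K]

/-- The valuation ring `R` of `K`. -/
abbrev integerRing : ValuationSubring K := (NormedField.valuation (K := K)).valuationSubring

/-- The `K`-algebra `𝒪(Y)` of analytic functions on the open unit disk `Y` over `K`: the power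
series over `K` that converge on every closed disk of radius `c < 1`. -/
def diskFunctions : Subalgebra K (PowerSeries K) where
  carrier := {f | ∀ c : ℝ, 0 < c → c < 1 → PowerSeries.IsRestricted c f}
  mul_mem' hf hg c h0 h1 := PowerSeries.isRestricted.mul c (hf c h0 h1) (hg c h0 h1)
  add_mem' hf hg c h0 h1 := PowerSeries.isRestricted.add c (hf c h0 h1) (hg c h0 h1)
  algebraMap_mem' a c _ _ := PowerSeries.isRestricted_C c a

/-- The group `Aut_K(Y)`, acting on functions. The disk is a Stein space, so its automorphisms
over `K` are those of the `K`-algebra `𝒪(Y)` (continuity is automatic: a `K`-algebra automorphism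
`σ` is `f ↦ f (σ z)`); an automorphism `s` of `Y` acts by `f ↦ f ∘ s⁻¹`. -/
abbrev DiskAut := diskFunctions K ≃ₐ[K] diskFunctions K

/-- The set `Y(K̄)` of geometric points of `Y`. A `K`-algebra homomorphism `𝒪(Y) → K̄` is the
evaluation at a point `y` of `K̄` with `|y| < 1`. -/
abbrev GeometricPoint := diskFunctions K →ₐ[K] AlgebraicClosure K

variable {K}

/-- The coordinate `z` on the disk. -/
def coordinate : diskFunctions K :=
  ⟨PowerSeries.X, fun c _ _ => by
    rw [PowerSeries.X_eq]; exact PowerSeries.isRestricted_monomial c 1 1⟩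

/-- The set `Δ_σ` of geometric fixed points of `σ`. -/
def fixedPoints (σ : DiskAut K) : Set (GeometricPoint K) :=
  {y | y.comp (σ : diskFunctions K →ₐ[K] diskFunctions K) = y}

/-- The set `Δ` of geometric points of `Y` with nontrivial stabilizer in `G`. -/
def allFixedPoints (G : Subgroup (DiskAut K)) : Set (GeometricPoint K) :=
  ⋃ σ ∈ {σ : DiskAut K | σ ∈ G ∧ σ ≠ 1}, fixedPoints σ

/-- The additive valuation on `K`, normalized by `val p = 1` (for nonzero arguments). -/
def val (p : ℕ) (x : K) : ℝ := Real.log ‖x‖ / Real.log ‖(p : K)‖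

/-- The Gauss valuation `val_Y (∑ aᵢ zⁱ) = minᵢ val aᵢ`, the minimum over the nonzero
coefficients. -/
def gaussVal (p : ℕ) (f : PowerSeries K) : ℝ :=
  sInf {r | ∃ i, PowerSeries.coeff i f ≠ 0 ∧ r = val p (PowerSeries.coeff i f)}

/-- `#_Y f`: the order in `z` of the reduction of `f / c`, where `val c = val_Y f`; that is, the
least index at which the minimum in the Gauss valuation is attained. -/
def zeroCount (p : ℕ) (f : PowerSeries K) : ℕ :=
  sInf {i | PowerSeries.coeff i f ≠ 0 ∧ val p (PowerSeries.coeff i f) = gaussVal p f}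

/-- The function `σ(z) - z`. -/
def displacement (σ : DiskAut K) : PowerSeries K :=
  ((σ coordinate - coordinate : diskFunctions K) : PowerSeries K)

/-- The depth character `δ_Y^G`. -/
def depthCharacter (p : ℕ) (G : Subgroup (DiskAut K)) : G → ℂ :=
  balanced fun σ => -((Nat.card G : ℂ) * (gaussVal p (displacement (σ : DiskAut K)) : ℂ))

/-- The Artin character `a_Y^G`. -/
def artinCharacter (p : ℕ) (G : Subgroup (DiskAut K)) : G → ℂ :=
  balanced fun σ => -(zeroCount p (displacement (σ : DiskAut K)) : ℂ)

end Disk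

end HurwitzDisk

end

noncomputable section

set_option linter.unusedSectionVars false

namespace HurwitzDisk

/-! ### Induced characters -/

section InducedCharacters

variable {G : Type*} [Group G]

/-! Analytic input. Every `σ` in `G` preserves the functions with integral coefficients. For `σ ≠
1`, Weierstrass preparation therefore gives `σ(z) - z = c P u`, with `c` constant, `P` distinguished
and `u` of absolute value 1 at every point. At a point `x` of the disk this reads `|σx - x| = |c| ∏
|x - r|`, over the roots `r` of `P`. These roots are the fixed points of `σ`. They are simple,
because the derivative `ζ` of `σ` at a fixed point is not 1: otherwise finite order and
characteristic zero would force all nearby points to be fixed. Hence `val c` is the Gauss valuation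
`v(σ)`, and `deg P` is the number of fixed points. Over a finite extension `L` that splits all the
`P`, the set `Δ` becomes a finite ultrametric space on which `G` acts by isometries.
`FixedPointDatum` collects the valuations `v(σ)` and `w(y, y')` with the relations between them; the
rest is combinatorics.

The tree. Besides the root, the vertices are the `G`-orbits of balls `B` of `Δ`, ordered by
inclusion. `G_B` is the stabilizer of `B`. The Artin character of the edge to `B` counts, with a
minus sign, the fixed points lying in the orbit of `B`. For `ρ` in `G_B` and `r` the radius of `B`
(on the valuation scale, so that smaller balls have larger `r`), the excess of `ρ` is the valuation
of `ρ(z) - z` on `B` minus `r`, that is `v(ρ) + ∑ min(r, w(y, y')) - r`, summed over the fixed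
points `y'` of `ρ`, for any `y` in `B`. The depth at `σ ≠ 1` is minus the sum of the excess over all
conjugates `τ⁻¹στ` in `G_B`. The root corresponds to `r = 0`, where the excess is `v` itself.

Why it is a Hurwitz tree. Depth relation (`ite_excess_eq`): as `r` grows from the parent of `B` to
`B`, the terms `min(r, w)` of the fixed points inside `B` grow and the others stay, so the excess
changes by the growth of `r` times (fixed points in `B`, minus 1). An element that fixes the parent
but moves `B` has excess 0 on the parent. Summing over conjugates makes `|G_B|` times the change of
radius the thickness. Positivity (`classSum_mem_nonnegRationalCharacters`): the sets where the
excess is at least a constant are subgroups, as for ramification filtrations, so the depth is a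
nonnegative combination of characters `u_S^*`. Leaves (`ballDepth_of_isPoint`): at a single point
`y` the excess of `σ` is `val(ζ - 1)`. The multiplier embeds the stabilizer of `y` in `Lˣ`, so the
stabilizer is cyclic and `ζ` has the order of `σ`; valuations of `1` minus a root of unity give
`δ^mult`. -/

theorem mem_trueCharacters_of_representation {V : Type*} [AddCommGroup V] [Module ℂ V]
    [FiniteDimensional ℂ V] (ρ : Representation ℂ G V) : ρ.character ∈ trueCharacters G := by
  let e : V ≃ₗ[ℂ] (Fin (Module.finrank ℂ V) → ℂ) := (Module.finBasis ℂ V).equivFun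
  refine ⟨Module.finrank ℂ V, (LinearEquiv.conjRingEquiv e : _ →* _).comp ρ, ?_⟩
  ext g
  exact (LinearMap.trace_conj' (ρ g) e).symm

theorem zero_mem_trueCharacters : (0 : G → ℂ) ∈ trueCharacters G := by
  refine ⟨0, 1, ?_⟩
  ext g
  simp [Representation.character]

theorem add_mem_trueCharacters {χ ψ : G → ℂ} (hχ : χ ∈ trueCharacters G)
    (hψ : ψ ∈ trueCharacters G) : χ + ψ ∈ trueCharacters G := by
  obtain ⟨n, ρ, rfl⟩ := hχ
  obtain ⟨m, ρ', rfl⟩ := hψ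
  have := mem_trueCharacters_of_representation (ρ.prod ρ')
  convert this using 1
  ext g
  simp only [Representation.character, Pi.add_apply]
  exact (LinearMap.trace_prodMap' (ρ g) (ρ' g)).symm

theorem sum_mem_trueCharacters {ι : Type*} (s : Finset ι) (f : ι → G → ℂ)
    (h : ∀ i ∈ s, f i ∈ trueCharacters G) : ∑ i ∈ s, f i ∈ trueCharacters G :=
  Finset.sum_induction _ (· ∈ trueCharacters G) (fun _ _ => add_mem_trueCharacters)
    zero_mem_trueCharacters h

open Classical in
theorem induced_apply [Fintype G] (H : Subgroup G) (χ : H → ℂ) (σ : G) :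
    induced H χ σ = (Nat.card H : ℂ)⁻¹ *
      ∑ τ : G, if h : τ⁻¹ * σ * τ ∈ H then χ ⟨τ⁻¹ * σ * τ, h⟩ else 0 := by
  rw [induced, finsum_eq_sum_of_fintype]

theorem sum_mul_induced [Fintype G] (H : Subgroup G) [Fintype H] (χ : H → ℂ) (F : G → ℂ) :
    ∑ σ, F σ * induced H χ σ =
      (Nat.card H : ℂ)⁻¹ * ∑ τ : G, ∑ h : H, F (τ * h * τ⁻¹) * χ h := by
  classical
  -- Substitute `σ ↦ τστ⁻¹`; only the terms with `σ ∈ H` survive.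
  have key : ∀ τ : G, ∑ h : H, F (τ * h * τ⁻¹) * χ h =
      ∑ σ : G, F σ * if h : τ⁻¹ * σ * τ ∈ H then χ ⟨τ⁻¹ * σ * τ, h⟩ else 0 := by
    intro τ
    rw [← Equiv.sum_comp (MulAut.conj τ).toEquiv]
    simp only [MulEquiv.toEquiv_eq_coe, MulEquiv.coe_toEquiv, MulAut.conj_apply]
    have : ∀ σ : G, τ⁻¹ * (τ * σ * τ⁻¹) * τ = σ := fun σ => by group
    simp only [this, mul_dite, mul_zero]
    rw [← Finset.sum_subset (Finset.subset_univ (Finset.univ.filter (· ∈ H)))]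
    · refine Finset.sum_bij (fun h _ => (h : G)) ?_ ?_ ?_ ?_
      · intro h _; simp
      · intro a _ b _ h; exact Subtype.ext h
      · intro b hb; exact ⟨⟨b, by simpa using hb⟩, by simp, rfl⟩
      · intro h _; rw [dif_pos h.2]
    · intro x _ hx
      rw [dif_neg (by simpa using hx)]
  simp only [key, induced_apply]
  rw [Finset.sum_comm, Finset.mul_sum]
  refine Finset.sum_congr rfl fun σ _ => ?_
  rw [← Finset.mul_sum]
  ring

theorem sum_induced [Fintype G] (H : Subgroup G) [Fintype H] (χ : H → ℂ) (h : ∑ x, χ x = 0) :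
    ∑ σ, induced H χ σ = 0 := by
  have := sum_mul_induced H χ (fun _ => 1)
  simpa [h] using this

theorem sum_augmentation [Fintype G] : ∑ σ : G, augmentation G σ = 0 := by
  classical
  simp [augmentation, Finset.sum_sub_distrib]

theorem sum_inducedAugmentation [Fintype G] (H : Subgroup G) :
    ∑ σ : G, inducedAugmentation H σ = 0 := by
  have := Fintype.ofFinite H
  exact sum_induced H _ sum_augmentation

open Classical in
theorem inducedAugmentation_apply [Fintype G] (H : Subgroup G) {σ : G} (hσ : σ ≠ 1) :
    inducedAugmentation H σ =
      -((Nat.card H : ℂ)⁻¹ * ((Finset.univ.filter fun τ : G => τ⁻¹ * σ * τ ∈ H).card : ℂ)) := by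
  rw [inducedAugmentation, induced_apply, ← mul_neg, Finset.card_filter]
  congr 1
  push_cast
  rw [← Finset.sum_neg_distrib]
  refine Finset.sum_congr rfl fun τ _ => ?_
  have h1 : τ⁻¹ * σ * τ ≠ 1 := by
    intro h
    apply hσ
    have : σ = τ * (τ⁻¹ * σ * τ) * τ⁻¹ := by group
    rw [this, h]; group
  split_ifs with h
  · have : (⟨τ⁻¹ * σ * τ, h⟩ : H) ≠ 1 := fun h' => h1 (congrArg Subtype.val h')
    simp [augmentation, this]
  · simp

theorem sum_balanced [Fintype G] (f : G → ℂ) : ∑ σ, balanced f σ = 0 := by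
  classical
  rw [← Finset.add_sum_erase _ _ (Finset.mem_univ (1 : G))]
  have h1 : balanced f 1 = -∑ σ ∈ Finset.univ.erase (1 : G), f σ := by
    rw [balanced, if_pos rfl, finsum_eq_sum_of_fintype]
    congr 1
    refine (Finset.sum_subtype _ (fun x => ?_) f).symm
    simp
  rw [h1, neg_add_eq_zero]
  refine Finset.sum_congr rfl fun σ hσ => ?_
  rw [balanced, if_neg (Finset.ne_of_mem_erase hσ)]

/-- All characters in play except the values of `classSum` coefficients sum to zero over `G`, so the
value at `1` never has to be computed. -/
theorem ext_of_sum_eq_zero [Fintype G] {f g : G → ℂ} (hf : ∑ σ, f σ = 0) (hg : ∑ σ, g σ = 0)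
    (h : ∀ σ ≠ 1, f σ = g σ) : f = g := by
  classical
  ext σ
  by_cases hσ : σ = 1
  · subst hσ
    rw [← Finset.add_sum_erase _ _ (Finset.mem_univ (1 : G))] at hf hg
    rw [Finset.sum_congr rfl fun σ hσ => h σ (Finset.ne_of_mem_erase hσ)] at hf
    exact add_right_cancel (hf.trans hg.symm)
  · exact h σ hσ

theorem balanced_apply (f : G → ℂ) {σ : G} (h : σ ≠ 1) : balanced f σ = f σ := by
  rw [balanced, if_neg h]

/-- The projection of the space of functions on `G` that averages over right translations by `H`. -/
def rightAverage [Fintype G] (H : Subgroup G) [Fintype H] : (G → ℂ) →ₗ[ℂ] (G → ℂ) where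
  toFun f := fun g => (Nat.card H : ℂ)⁻¹ * ∑ h : H, f (g * h)
  map_add' f g := by ext x; simp [Finset.sum_add_distrib, mul_add]
  map_smul' c f := by ext x; simp only [Pi.smul_apply, smul_eq_mul, RingHom.id_apply, ← Finset.mul_sum]; ring

/-- The left regular representation on functions. -/
def leftTranslation (G : Type*) [Group G] : Representation ℂ G (G → ℂ) where
  toFun g := LinearMap.funLeft ℂ ℂ (fun x => g⁻¹ * x)
  map_one' := by ext; simp [LinearMap.funLeft]
  map_mul' a b := by ext; simp [LinearMap.funLeft, mul_assoc]

open Classical in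
theorem trace_pi_eq {ι : Type*} [Fintype ι] (A : (ι → ℂ) →ₗ[ℂ] (ι → ℂ)) :
    LinearMap.trace ℂ _ A = ∑ i, A (Pi.single i 1) i := by
  rw [LinearMap.trace_eq_matrix_trace ℂ (Pi.basisFun ℂ ι)]
  simp [Matrix.trace]

/-- Since `r_H` induces to `r_G`, one has `u_H^* = r_G - 1_H^*`. It is realized on the kernel of
averaging over right translations by `H`, a projection of the functions on `G` that commutes with
left translation and whose image is the functions on `G/H`. -/
theorem inducedAugmentation_mem_trueCharacters [Finite G] (H : Subgroup G) :
    inducedAugmentation H ∈ trueCharacters G := by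
  classical
  have := Fintype.ofFinite G
  have := Fintype.ofFinite H
  set e := rightAverage H
  set ρ := leftTranslation G
  have he : ∀ f, e (e f) = e f := by
    intro f
    ext g
    simp only [e, rightAverage, LinearMap.coe_mk, AddHom.coe_mk, ← Finset.mul_sum]
    have : ∀ h : H, ∑ h' : H, f (g * h * h') = ∑ h' : H, f (g * h') := by
      intro h
      rw [← Equiv.sum_comp (Equiv.mulLeft h) fun h' : H => f (g * h')]
      simp [mul_assoc]
    simp only [this, Finset.sum_const, Finset.card_univ, nsmul_eq_mul, Nat.card_eq_fintype_card]
    field_simp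
  have hcomm : ∀ g f, ρ g (e f) = e (ρ g f) := by
    intro g f
    ext x
    simp [ρ, e, leftTranslation, rightAverage, LinearMap.funLeft, mul_assoc]
  let W : Submodule ℂ (G → ℂ) := LinearMap.ker e
  have hW : ∀ g, ∀ f ∈ W, ρ g f ∈ W := by
    intro g f hf
    rw [LinearMap.mem_ker] at hf ⊢
    rw [← hcomm, hf, map_zero]
  let ρW : Representation ℂ G W :=
    { toFun := fun g => (ρ g).restrict (hW g)
      map_one' := by ext; simp
      map_mul' := fun a b => by ext; simp [LinearMap.restrict_apply] }
  have hπ : ∀ f, (LinearMap.id - e : (G → ℂ) →ₗ[ℂ] (G → ℂ)) f ∈ W := by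
    intro f
    simp [W, he]
  let π : (G → ℂ) →ₗ[ℂ] W := (LinearMap.id - e).codRestrict W hπ
  have hmem := mem_trueCharacters_of_representation ρW
  -- The trace on the kernel is computed on all functions on `G` as the trace of `ρ g` times the
  -- complementary projection, hence from a diagonal in the basis of point masses.
  have htr : ∀ g, ρW.character g = LinearMap.trace ℂ _ ((ρ g) ∘ₗ (LinearMap.id - e)) := by
    intro g
    have h1 : ρW g = π ∘ₗ (ρ g ∘ₗ W.subtype) := by
      ext1 f
      apply Subtype.ext
      have : e (ρ g f) = 0 := hW g f f.2
      simp [ρW, π, this]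
    have h2 : (ρ g) ∘ₗ (LinearMap.id - e) = (ρ g ∘ₗ W.subtype) ∘ₗ π := rfl
    rw [Representation.character, h1, h2, LinearMap.trace_comp_comm']
  convert hmem
  ext σ
  rw [htr, trace_pi_eq, inducedAugmentation, induced_apply, Finset.mul_sum]
  refine Finset.sum_congr rfl fun τ _ => ?_
  have hH : (Nat.card H : ℂ) ≠ 0 := by simp
  have h1 : (ρ σ ∘ₗ (LinearMap.id - e)) (Pi.single τ 1) τ =
      (if σ = 1 then 1 else 0) - (Nat.card H : ℂ)⁻¹ * if τ⁻¹ * σ * τ ∈ H then 1 else 0 := by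
    have hs : ∀ h : H, (σ⁻¹ * τ * h = τ) ↔ (h : G) = τ⁻¹ * σ * τ := by
      intro h
      rw [← eq_inv_mul_iff_mul_eq]
      simp [mul_assoc]
    simp only [ρ, e, leftTranslation, rightAverage, LinearMap.funLeft, LinearMap.coe_comp,
      Function.comp_apply, LinearMap.sub_apply, LinearMap.id_apply, LinearMap.coe_mk,
      AddHom.coe_mk, MonoidHom.coe_mk, OneHom.coe_mk, Pi.sub_apply, Pi.single_apply, hs]
    congr 2
    · simp
    · split_ifs with h
      · rw [Finset.sum_eq_single ⟨_, h⟩]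
        · simp
        · intro b _ hb
          rw [if_neg fun h' => hb (Subtype.ext h')]
        · simp
      · exact Finset.sum_eq_zero fun b _ => if_neg fun h' : (b : G) = τ⁻¹ * σ * τ => h (h' ▸ b.2)
  rw [h1]
  have h2 : τ⁻¹ * σ * τ = 1 ↔ σ = 1 := by
    rw [mul_assoc, inv_mul_eq_one, eq_comm, mul_eq_right]
  by_cases h : τ⁻¹ * σ * τ ∈ H
  · simp only [h, dite_true, if_true, augmentation, Subgroup.mk_eq_one, h2]
    split_ifs <;> simp [mul_sub]
  · have : σ ≠ 1 := fun h' => h (by rw [h2.mpr h']; exact H.one_mem)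
    simp [h, this]

/-- The scalar product of a true character `ψ` with `u_H^*` is `dim V - dim V^H`, where `V` is a
representation with character `ψ`. -/
theorem scalarProduct_inducedAugmentation [Finite G] (H : Subgroup G) {ψ : G → ℂ}
    (hψ : ψ ∈ trueCharacters G) :
    ∃ n : ℕ, scalarProduct ψ (inducedAugmentation H) = (n : ℂ) := by
  classical
  have := Fintype.ofFinite G
  have := Fintype.ofFinite H
  obtain ⟨n, ρ, rfl⟩ := hψ
  let ρH : Representation ℂ H (Fin n → ℂ) := ρ.comp H.subtype
  have hG : (Nat.card G : ℂ) ≠ 0 := by simp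
  have hH : (Nat.card H : ℂ) ≠ 0 := by simp
  have : Invertible (Nat.card H : ℂ) := invertibleOfNonzero hH
  have hdim := ρH.card_inv_mul_sum_char_eq_finrank
  refine ⟨n - Module.finrank ℂ ρH.invariants, ?_⟩
  have hle : Module.finrank ℂ ρH.invariants ≤ n := by
    simpa using Submodule.finrank_le ρH.invariants
  rw [scalarProduct, finsum_eq_sum_of_fintype, inducedAugmentation, sum_mul_induced]
  have hsum : ∑ h : H, (starRingEnd ℂ) (ρ.character h) * augmentation H h =
      (Nat.card H : ℂ) * (n - Module.finrank ℂ ρH.invariants) := by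
    simp only [augmentation, mul_sub, mul_one, Finset.sum_sub_distrib]
    congr 1
    · simp [mul_comm]
    · rw [← map_sum]
      have : ∑ h : H, ρ.character h = (Nat.card H : ℂ) * Module.finrank ℂ ρH.invariants := by
        rw [← hdim, mul_inv_cancel_left₀ hH]; rfl
      rw [this]; simp
  simp only [Representation.char_conj, hsum, Finset.sum_const, Finset.card_univ, nsmul_eq_mul,
    ← Nat.card_eq_fintype_card]
  rw [Nat.cast_sub hle]
  field_simp

theorem inducedAugmentation_mem_nonnegRationalCharacters [Finite G] (H : Subgroup G) :
    inducedAugmentation H ∈ nonnegRationalCharacters G := by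
  refine ⟨Submodule.subset_span (inducedAugmentation_mem_trueCharacters H), fun ψ hψ => ?_⟩
  obtain ⟨n, hn⟩ := scalarProduct_inducedAugmentation H hψ
  exact ⟨n, by positivity, by simpa using hn⟩

theorem sum_smul_mem_nonnegRationalCharacters [Finite G] {ι : Type*} (s : Finset ι) (c : ι → ℚ)
    (f : ι → G → ℂ) (hc : ∀ i ∈ s, 0 ≤ c i) (hf : ∀ i ∈ s, f i ∈ nonnegRationalCharacters G) :
    (∑ i ∈ s, c i • f i) ∈ nonnegRationalCharacters G := by
  have := Fintype.ofFinite G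
  refine Finset.sum_induction _ (· ∈ nonnegRationalCharacters G) ?_ ?_ ?_
  · rintro a b ⟨ha, ha'⟩ ⟨hb, hb'⟩
    refine ⟨add_mem ha hb, fun ψ hψ => ?_⟩
    obtain ⟨q, hq, hq'⟩ := ha' ψ hψ
    obtain ⟨r, hr, hr'⟩ := hb' ψ hψ
    refine ⟨q + r, add_nonneg hq hr, ?_⟩
    rw [Rat.cast_add, ← hq', ← hr']
    simp only [scalarProduct, finsum_eq_sum_of_fintype, Pi.add_apply, mul_add,
      Finset.sum_add_distrib]
  · exact ⟨zero_mem _, fun ψ _ => ⟨0, le_rfl, by simp [scalarProduct]⟩⟩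
  · intro i hi
    obtain ⟨h, h'⟩ := hf i hi
    refine ⟨Submodule.smul_mem _ _ h, fun ψ hψ => ?_⟩
    obtain ⟨q, hq, hq'⟩ := h' ψ hψ
    refine ⟨c i * q, mul_nonneg (hc i hi) hq, ?_⟩
    rw [Rat.cast_mul, ← hq']
    simp only [scalarProduct, finsum_eq_sum_of_fintype, Pi.smul_apply, Finset.mul_sum, Rat.smul_def]
    exact Finset.sum_congr rfl fun _ _ => by ring

end InducedCharacters

/-! ### Rooted trees given by a parent function -/

/-- A finite rooted tree presented by a parent function; the root has exactly one child. -/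
structure ParentTree where
  V : Type
  finite_V : Finite V
  root : V
  par : V → V
  par_root : par root = root
  height : V → ℕ
  height_par_lt : ∀ v, v ≠ root → height (par v) < height v
  existsUnique_child : ∃! v, v ≠ root ∧ par v = root

namespace ParentTree

variable (T : ParentTree)

/-- The graph whose edges join the vertices other than the root to their parents. -/
def graph : SimpleGraph T.V := SimpleGraph.fromRel fun v w => w ≠ T.root ∧ T.par w = v

variable {T}

theorem par_ne {v : T.V} (hv : v ≠ T.root) : T.par v ≠ v := fun h =>
  (T.height_par_lt v hv).ne (by rw [h])

theorem adj_iff {v w : T.V} :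
    T.graph.Adj v w ↔ (w ≠ T.root ∧ T.par w = v) ∨ (v ≠ T.root ∧ T.par v = w) := by
  rw [graph, SimpleGraph.fromRel_adj, and_iff_right_of_imp]
  rintro (⟨h, rfl⟩ | ⟨h, rfl⟩)
  · exact par_ne h
  · exact (par_ne h).symm

theorem adj_par {v : T.V} (hv : v ≠ T.root) : T.graph.Adj (T.par v) v :=
  adj_iff.mpr (Or.inl ⟨hv, rfl⟩)

/-- Climb from `x` through parents: heights decrease, so `v` is never met and the deleted edge is
never used. -/
theorem reachable_root_of_height_lt {v x : T.V} (hx : T.height x < T.height v) :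
    (T.graph.deleteEdges {s(T.par v, v)}).Reachable T.root x := by
  induction hn : T.height x using Nat.strong_induction_on generalizing x with
  | _ n ih =>
    by_cases h : x = T.root
    · rw [h]
    · have hlt := T.height_par_lt x h
      refine (ih _ (hn ▸ hlt) (hlt.trans hx) rfl).trans (SimpleGraph.Adj.reachable ?_)
      rw [SimpleGraph.deleteEdges_adj]
      refine ⟨adj_par h, ?_⟩
      rw [Set.mem_singleton_iff, Sym2.eq_iff]
      rintro (⟨-, rfl⟩ | ⟨h1, -⟩)
      · exact hx.ne rfl
      · rw [h1] at hlt
        exact hlt.not_gt hx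

theorem not_reachable_root {v : T.V} (hv : v ≠ T.root) :
    ¬ (T.graph.deleteEdges {s(T.par v, v)}).Reachable T.root v := by
  -- Being a descendant of `v` is invariant along every edge other than the one from `v` to its
  -- parent; `v` has this property and the root does not.
  have step : ∀ x y : T.V, y ≠ v → T.par y = x →
      ((∃ n, T.par^[n] x = v) ↔ ∃ n, T.par^[n] y = v) := by
    rintro x y hy rfl
    refine ⟨fun ⟨n, hn⟩ => ⟨n + 1, hn⟩, fun ⟨n, hn⟩ => ?_⟩
    cases n with
    | zero => exact absurd hn hy
    | succ n => exact ⟨n, hn⟩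
  have key : ∀ x y : T.V, (T.graph.deleteEdges {s(T.par v, v)}).Reachable x y →
      ((∃ n, T.par^[n] x = v) ↔ ∃ n, T.par^[n] y = v) := by
    rintro x y ⟨p⟩
    induction p with
    | nil => rfl
    | @cons a b c hab _ ih =>
      refine Iff.trans ?_ ih
      rw [SimpleGraph.deleteEdges_adj, Set.mem_singleton_iff, adj_iff] at hab
      obtain ⟨⟨-, h⟩ | ⟨-, h⟩, hne⟩ := hab
      · refine step a b (fun hb => hne ?_) h
        rw [← h, hb]
      · refine (step b a (fun ha => hne ?_) h).symm
        rw [← h, ha, Sym2.eq_swap]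
  intro h
  obtain ⟨n, hn⟩ := (key _ _ h).mpr ⟨0, rfl⟩
  exact hv (hn.symm.trans (Function.iterate_fixed T.par_root n))

theorem graph_isTree : T.graph.IsTree := by
  have : Nonempty T.V := ⟨T.root⟩
  refine ⟨⟨?_⟩, ?_⟩
  · have : ∀ v, T.graph.Reachable T.root v := by
      intro v
      by_cases hv : v = T.root
      · rw [hv]
      · exact ((reachable_root_of_height_lt (T.height_par_lt v hv)).mono
          (SimpleGraph.deleteEdges_le _)).trans (adj_par hv).reachable
    exact fun v w => (this v).symm.trans (this w)
  · have key : ∀ v : T.V, v ≠ T.root → T.graph.IsBridge s(T.par v, v) := by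
      intro v hv
      rw [SimpleGraph.isBridge_iff]
      exact fun h => not_reachable_root hv
        ((reachable_root_of_height_lt (T.height_par_lt v hv)).trans h)
    rw [SimpleGraph.isAcyclic_iff_forall_adj_isBridge]
    intro v w h
    rcases adj_iff.mp h with ⟨hw, rfl⟩ | ⟨hv, rfl⟩
    · exact key w hw
    · rw [Sym2.eq_swap]; exact key v hv

variable (T) in
/-- The trunk tree underlying a tree given by a parent function. -/
def toTrunkTree : TrunkTree where
  V := T.V
  finite_V := T.finite_V
  graph := T.graph
  isTree := graph_isTree
  root := T.root
  existsUnique_adj_root := by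
    obtain ⟨v, hv, hu⟩ := T.existsUnique_child
    refine ⟨v, adj_iff.mpr (Or.inl hv), fun w hw => hu w ?_⟩
    rcases adj_iff.mp hw with h | h
    · exact h
    · exact absurd rfl h.1

theorem adj_and_reachable_iff {v w : T.V} :
    T.graph.Adj v w ∧ (T.graph.deleteEdges {s(v, w)}).Reachable T.root v ↔
      w ≠ T.root ∧ T.par w = v := by
  constructor
  · rintro ⟨h, hr⟩
    rcases adj_iff.mp h with h | ⟨hv, rfl⟩
    · exact h
    · rw [Sym2.eq_swap] at hr
      exact absurd hr (not_reachable_root hv)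
  · rintro ⟨hw, rfl⟩
    exact ⟨adj_par hw, reachable_root_of_height_lt (T.height_par_lt w hw)⟩

theorem succ_iff {v w : T.V} : T.toTrunkTree.Succ v w ↔ w ≠ T.root ∧ T.par w = v :=
  adj_and_reachable_iff

end ParentTree

/-! ### Depth characters attached to filtrations -/

section ClassSum

theorem conj_ne_one {G : Type*} [Group G] {σ : G} (hσ : σ ≠ 1) (τ : G) : τ⁻¹ * σ * τ ≠ 1 := by
  rwa [Ne, mul_assoc, inv_mul_eq_one, eq_comm, mul_eq_right]

variable {G : Type*} [Group G] [Fintype G]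

open Classical in
/-- The sum over all `τ` of the values of `-f` at the conjugates `τ⁻¹ σ τ ∈ H`, normalized at `1` so
that the sum of all values vanishes. -/
def classSum (H : Subgroup G) (f : G → ℚ) : G → ℂ :=
  balanced fun σ => -((∑ τ : G, if τ⁻¹ * σ * τ ∈ H then f (τ⁻¹ * σ * τ) else 0 : ℚ) : ℂ)

open Classical in
theorem card_mul_inducedAugmentation (H : Subgroup G) {σ : G} (hσ : σ ≠ 1) :
    (Nat.card H : ℂ) * inducedAugmentation H σ =
      -∑ τ : G, (if τ⁻¹ * σ * τ ∈ H then (1 : ℂ) else 0) := by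
  have hH : (Nat.card H : ℂ) ≠ 0 := by simp
  rw [inducedAugmentation_apply H hσ, mul_neg, mul_inv_cancel_left₀ hH]
  simp

open Classical in
/-- The elements of `H` at which `f` is at least `c`, together with `1`. -/
def superlevel (H : Subgroup G) (f : G → ℚ)
    (hf : ∀ σ ∈ H, ∀ τ ∈ H, σ ≠ 1 → τ ≠ 1 → σ * τ ≠ 1 → min (f σ) (f τ) ≤ f (σ * τ)) (c : ℚ) :
    Subgroup G :=
  let M : Submonoid G :=
    { carrier := {σ | σ ∈ H ∧ (σ ≠ 1 → c ≤ f σ)}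
      one_mem' := ⟨H.one_mem, fun h => absurd rfl h⟩
      mul_mem' := by
        rintro σ τ ⟨hσ, hσ'⟩ ⟨hτ, hτ'⟩
        refine ⟨H.mul_mem hσ hτ, fun h => ?_⟩
        by_cases h1 : σ = 1
        · subst h1; simpa using hτ' (by simpa using h)
        by_cases h2 : τ = 1
        · subst h2; simpa using hσ' (by simpa using h)
        exact (le_min (hσ' h1) (hτ' h2)).trans (hf σ hσ τ hτ h1 h2 h) }
  { M with
    inv_mem' := by
      intro σ hσ
      -- In a finite group inverses are powers, so closure under products suffices.
      have : σ⁻¹ = σ ^ (orderOf σ - 1) := by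
        rw [inv_eq_iff_mul_eq_one, ← pow_succ', Nat.sub_add_cancel (orderOf_pos σ),
          pow_orderOf_eq_one]
      rw [this]
      exact M.pow_mem hσ _ }

/-- With a common denominator `N`, the function `f` is `1/N` times the sum of the indicators of its
superlevel sets `f ≥ (k + 1)/N`. Each of them, together with `1`, is a subgroup `S k`, so the class
sum is `∑ (|S k| / N) u_{S k}^*`. -/
theorem classSum_mem_nonnegRationalCharacters (H : Subgroup G) (f : G → ℚ)
    (hf : ∀ σ ∈ H, ∀ τ ∈ H, σ ≠ 1 → τ ≠ 1 → σ * τ ≠ 1 → min (f σ) (f τ) ≤ f (σ * τ))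
    (h0 : ∀ σ ∈ H, σ ≠ 1 → 0 ≤ f σ) : classSum H f ∈ nonnegRationalCharacters G := by
  classical
  let N : ℕ := ∏ σ : G, (f σ).den
  have hN : N ≠ 0 := Finset.prod_ne_zero_iff.mpr fun σ _ => (f σ).den_nz
  have hNQ : (N : ℚ) ≠ 0 := by exact_mod_cast hN
  have hnum : ∀ σ ∈ H, σ ≠ 1 → ∃ n : ℕ, (N : ℚ) * f σ = n := by
    intro σ hσ h1
    obtain ⟨d, hd⟩ := Finset.dvd_prod_of_mem (fun σ : G => (f σ).den) (Finset.mem_univ σ)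
    refine ⟨d * (f σ).num.toNat, ?_⟩
    have hn : (((f σ).num.toNat : ℤ) : ℚ) = (f σ).num := by
      rw [Int.toNat_of_nonneg (Rat.num_nonneg.mpr (h0 σ hσ h1))]
    have hNd : (N : ℚ) = (f σ).den * d := by exact_mod_cast hd
    push_cast at hn ⊢
    rw [hn, hNd, mul_comm ((f σ).den : ℚ), mul_assoc, Rat.den_mul_eq_num]
  choose! n hn using hnum
  obtain ⟨M, hM⟩ : ∃ M : ℕ, ∀ σ, n σ ≤ M :=
    ⟨∑ σ, n σ, fun σ => Finset.single_le_sum (fun _ _ => Nat.zero_le _) (Finset.mem_univ σ)⟩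
  let S : ℕ → Subgroup G := fun k => superlevel H f hf ((k + 1) / N)
  have hS : ∀ k, ∀ σ ≠ 1, σ ∈ S k ↔ σ ∈ H ∧ k < n σ := by
    intro k σ h1
    have : σ ∈ S k ↔ σ ∈ H ∧ (σ ≠ 1 → ((k + 1) / N : ℚ) ≤ f σ) := Iff.rfl
    rw [this]
    refine and_congr_right fun hσ => ?_
    have hpos : (0 : ℚ) < N := by positivity
    rw [imp_iff_right h1, div_le_iff₀' hpos, hn σ hσ h1]
    norm_cast
  have key : classSum H f =
      ∑ k ∈ Finset.range M, ((Nat.card (S k) : ℚ) / N) • inducedAugmentation (S k) := by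
    refine ext_of_sum_eq_zero (sum_balanced _) ?_ ?_
    · simp only [Finset.sum_apply]
      rw [Finset.sum_comm]
      refine Finset.sum_eq_zero fun k _ => ?_
      simp only [Pi.smul_apply]
      rw [← Finset.smul_sum, sum_inducedAugmentation, smul_zero]
    · intro σ hσ
      rw [classSum, balanced_apply _ hσ, Finset.sum_apply]
      have h1 : ∀ k, (((Nat.card (S k) : ℚ) / N) • inducedAugmentation (S k)) σ =
          -((∑ τ : G, if τ⁻¹ * σ * τ ∈ S k then (1 / N : ℚ) else 0 : ℚ) : ℂ) := by
        intro k
        rw [Pi.smul_apply, Rat.smul_def]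
        push_cast
        rw [div_mul_eq_mul_div, card_mul_inducedAugmentation _ hσ, neg_div, Finset.sum_div]
        congr 1
        refine Finset.sum_congr rfl fun τ _ => ?_
        split_ifs <;> simp
      simp only [h1]
      rw [Finset.sum_neg_distrib, ← Rat.cast_sum, Finset.sum_comm]
      congr 2
      refine Finset.sum_congr rfl fun τ _ => ?_
      have h2 := conj_ne_one hσ τ
      simp only [hS _ _ h2]
      by_cases h3 : τ⁻¹ * σ * τ ∈ H
      · simp only [h3, true_and, if_true]
        rw [← Finset.sum_filter, Finset.sum_const]
        have : (Finset.range M).filter (fun k => k < n (τ⁻¹ * σ * τ)) =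
            Finset.range (n (τ⁻¹ * σ * τ)) := by
          ext k
          have := hM (τ⁻¹ * σ * τ)
          simp only [Finset.mem_filter, Finset.mem_range]
          omega
        rw [this, Finset.card_range, nsmul_eq_mul, ← hn _ h3 h2]
        field_simp
      · simp [h3]
  rw [key]
  exact sum_smul_mem_nonnegRationalCharacters _ _ _ (fun k _ => by positivity)
    fun k _ => inducedAugmentation_mem_nonnegRationalCharacters _

open Classical in
-- The depth relation along an edge, once a pointwise relation on `G` is known: sum it over all
-- conjugates of `σ`. In the application `n` counts fixed points in a ball and `A` counts those in
-- its orbit; the factor `Nat.card H` turns a difference of radii into a thickness.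
theorem classSum_eq_add {H H' : Subgroup G} {f f' : G → ℚ} (c : ℚ) (n A : G → ℕ)
    (h : ∀ σ ≠ 1, (if σ ∈ H then f σ else 0) =
      (if σ ∈ H' then f' σ else 0) + c * (n σ - if σ ∈ H then 1 else 0))
    (hA : ∀ σ ≠ 1, ∑ τ : G, n (τ⁻¹ * σ * τ) = Nat.card H * A σ) :
    classSum H f = classSum H' f' +
      (((c * Nat.card H : ℚ)) : ℂ) • (balanced (fun σ => -(A σ : ℂ)) - inducedAugmentation H) := by
  refine ext_of_sum_eq_zero (sum_balanced _) ?_ ?_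
  · simp only [Pi.add_apply, Pi.smul_apply, Pi.sub_apply, Finset.sum_add_distrib, ← Finset.smul_sum,
      Finset.sum_sub_distrib, classSum, sum_balanced, sum_inducedAugmentation]
    simp
  · intro σ hσ
    rw [Pi.add_apply, Pi.smul_apply, Pi.sub_apply, classSum, classSum, balanced_apply _ hσ,
      balanced_apply _ hσ, balanced_apply _ hσ]
    have hsum := hA σ hσ
    have h1 : ∑ τ : G, (if τ⁻¹ * σ * τ ∈ H then f (τ⁻¹ * σ * τ) else 0) =
        ∑ τ : G, (if τ⁻¹ * σ * τ ∈ H' then f' (τ⁻¹ * σ * τ) else 0) +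
          c * (Nat.card H * A σ - ∑ τ : G, if τ⁻¹ * σ * τ ∈ H then (1 : ℚ) else 0) := by
      have : (Nat.card H * A σ : ℚ) = ∑ τ : G, (n (τ⁻¹ * σ * τ) : ℚ) := by exact_mod_cast hsum.symm
      rw [this, ← Finset.sum_sub_distrib, Finset.mul_sum, ← Finset.sum_add_distrib]
      exact Finset.sum_congr rfl fun τ _ => h _ (conj_ne_one hσ τ)
    rw [h1]
    have h2 := card_mul_inducedAugmentation H hσ
    have h3 : ((∑ τ : G, if τ⁻¹ * σ * τ ∈ H then (1 : ℚ) else 0 : ℚ) : ℂ) =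
        -((Nat.card H : ℂ) * inducedAugmentation H σ) := by
      rw [h2, neg_neg]; push_cast
      exact Finset.sum_congr rfl fun τ _ => by split_ifs <;> simp
    simp only [Rat.cast_add, Rat.cast_mul, Rat.cast_sub, Rat.cast_natCast, h3, smul_eq_mul]
    ring

end ClassSum

/-! ### Finite ultrametric spaces with a group action -/

section UltrametricAction

open scoped Pointwise

/-- The valuation of differences on a finite set `Δ`, invariant under a group: `w x y`
is the valuation of `x - y` for `x ≠ y`, and `w x x` is a number `wTop` larger than those. -/
structure UltrametricAction (G : Type*) [Group G] (Δ : Type) [MulAction G Δ] where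
  w : Δ → Δ → ℚ
  wTop : ℚ
  w_self : ∀ x, w x x = wTop
  w_lt : ∀ x y, x ≠ y → w x y < wTop
  w_pos : ∀ x y, 0 < w x y
  w_comm : ∀ x y, w x y = w y x
  min_w_le : ∀ x y z, min (w x y) (w y z) ≤ w x z
  w_smul : ∀ (g : G) x y, w (g • x) (g • y) = w x y

namespace UltrametricAction

variable {G : Type*} [Group G] {Δ : Type} [MulAction G Δ] (D : UltrametricAction G Δ)

theorem le_w {x y z : Δ} {r : ℚ} (h : r ≤ D.w x y) (h' : r ≤ D.w y z) : r ≤ D.w x z :=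
  (le_min h h').trans (D.min_w_le x y z)

theorem w_le_wTop (x y : Δ) : D.w x y ≤ D.wTop := by
  by_cases h : x = y
  · rw [h, D.w_self]
  · exact (D.w_lt x y h).le

/-- `B` is a ball, and `r` is the smallest value of `w` on `B`. -/
def HasRadius (B : Set Δ) (r : ℚ) : Prop :=
  (∀ x ∈ B, ∀ z, z ∈ B ↔ r ≤ D.w x z) ∧ ∃ x ∈ B, ∃ z ∈ B, D.w x z = r

theorem hasRadius_ball (y y' : Δ) : D.HasRadius {x | D.w y y' ≤ D.w y x} (D.w y y') := by
  refine ⟨fun x hx z => ⟨fun hz => ?_, fun hz => D.le_w hx hz⟩, y, ?_, y', le_refl (D.w y y'), rfl⟩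
  · exact D.le_w (y := y) (by rw [D.w_comm x]; exact hx) hz
  · rw [Set.mem_ofPred_eq, D.w_self]; exact D.w_le_wTop y y'

variable {D}

/-- If `x`, `z` realize the smallest value, then by the isosceles property at least one of them is
equally far from `y`. -/
theorem HasRadius.exists_w_eq {B : Set Δ} {r : ℚ} (h : D.HasRadius B r) {y : Δ} (hy : y ∈ B) :
    ∃ z ∈ B, D.w y z = r := by
  obtain ⟨h1, x, hx, z, hz, hxz⟩ := h
  have h2 := D.min_w_le x y z
  rw [hxz, min_le_iff, D.w_comm x y] at h2
  rcases h2 with h2 | h2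
  · exact ⟨x, hx, h2.antisymm ((h1 y hy x).mp hx)⟩
  · exact ⟨z, hz, h2.antisymm ((h1 y hy z).mp hz)⟩

theorem HasRadius.unique {B : Set Δ} {r s : ℚ} (h : D.HasRadius B r) (h' : D.HasRadius B s) :
    r = s := by
  have key : ∀ {r s : ℚ}, D.HasRadius B r → D.HasRadius B s → r ≤ s := by
    rintro r s ⟨h1, -⟩ ⟨-, x, hx, z, hz, rfl⟩
    exact (h1 x hx z).mp hz
  exact (key h h').antisymm (key h' h)

theorem HasRadius.smul {B : Set Δ} {r : ℚ} (h : D.HasRadius B r) (g : G) :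
    D.HasRadius (g • B) r := by
  obtain ⟨h1, x, hx, z, hz, hxz⟩ := h
  refine ⟨fun a ha b => ?_, g • x, Set.smul_mem_smul_set hx, g • z, Set.smul_mem_smul_set hz, ?_⟩
  · rw [Set.mem_smul_set_iff_inv_smul_mem] at ha ⊢
    rw [h1 _ ha, D.w_smul]
  · rw [D.w_smul, hxz]

variable (D) in
/-- The balls of an ultrametric space, as sets of points. -/
def Ball : Type := {B : Set Δ // ∃ r, D.HasRadius B r}

namespace Ball

instance : SetLike D.Ball Δ where
  coe B := B.1
  coe_injective _ _ h := Subtype.ext h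

instance : PartialOrder D.Ball := .ofSetLike D.Ball Δ

instance : SMul G D.Ball where
  smul g B := ⟨g • (B : Set Δ), B.2.imp fun _ h => h.smul g⟩

@[simp]
theorem coe_smul (g : G) (B : D.Ball) : ((g • B : D.Ball) : Set Δ) = g • (B : Set Δ) := rfl

instance : MulAction G D.Ball where
  one_smul B := SetLike.coe_injective (one_smul G (B : Set Δ))
  mul_smul g h B := SetLike.coe_injective (mul_smul g h (B : Set Δ))

theorem mem_smul_iff {g : G} {B : D.Ball} {y : Δ} : y ∈ g • B ↔ g⁻¹ • y ∈ B :=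
  Set.mem_smul_set_iff_inv_smul_mem

theorem smul_mem_smul {g : G} {B : D.Ball} {y : Δ} (hy : y ∈ B) : g • y ∈ g • B :=
  Set.smul_mem_smul_set hy

theorem smul_le_smul {g : G} {B C : D.Ball} (h : B ≤ C) : g • B ≤ g • C :=
  Set.smul_set_mono (s := (B : Set Δ)) (t := C) h

theorem smul_lt_smul {g : G} {B C : D.Ball} (h : B < C) : g • B < g • C :=
  (smul_le_smul h.le).lt_of_ne fun h' => h.ne (smul_left_cancel g h')

/-- The smallest value of `w` on a ball. -/
def radius (B : D.Ball) : ℚ := B.2.choose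

theorem hasRadius (B : D.Ball) : D.HasRadius (B : Set Δ) B.radius := B.2.choose_spec

theorem nonempty (B : D.Ball) : ∃ y, y ∈ B := by
  obtain ⟨-, x, hx, -⟩ := B.hasRadius
  exact ⟨x, hx⟩

theorem mem_iff {B : D.Ball} {x : Δ} (hx : x ∈ B) {z : Δ} : z ∈ B ↔ B.radius ≤ D.w x z :=
  B.hasRadius.1 x hx z

theorem radius_eq {B : D.Ball} {r : ℚ} (h : D.HasRadius (B : Set Δ) r) : B.radius = r :=
  B.hasRadius.unique h

@[simp]
theorem radius_smul (g : G) (B : D.Ball) : (g • B).radius = B.radius :=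
  radius_eq (B.hasRadius.smul g)

theorem radius_pos (B : D.Ball) : 0 < B.radius := by
  obtain ⟨-, x, hx, z, hz, h⟩ := B.hasRadius
  rw [← h]; exact D.w_pos x z

variable (D) in
/-- The smallest ball containing two points. -/
def span (y y' : Δ) : D.Ball := ⟨_, _, D.hasRadius_ball y y'⟩

theorem mem_span {y y' x : Δ} : x ∈ span D y y' ↔ D.w y y' ≤ D.w y x := Iff.rfl

theorem left_mem_span (y y' : Δ) : y ∈ span D y y' := by
  rw [mem_span, D.w_self]; exact D.w_le_wTop y y'

theorem right_mem_span (y y' : Δ) : y' ∈ span D y y' := mem_span.mpr le_rfl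

@[simp]
theorem radius_span (y y' : Δ) : (span D y y').radius = D.w y y' :=
  radius_eq (D.hasRadius_ball y y')

theorem le_of_radius_le {B C : D.Ball} {y : Δ} (hB : y ∈ B) (hC : y ∈ C)
    (h : C.radius ≤ B.radius) : B ≤ C :=
  fun _ hz => (mem_iff hC).mpr (h.trans ((mem_iff hB).mp hz))

theorem eq_of_radius_eq {B C : D.Ball} {y : Δ} (hB : y ∈ B) (hC : y ∈ C)
    (h : B.radius = C.radius) : B = C :=
  (le_of_radius_le hB hC h.ge).antisymm (le_of_radius_le hC hB h.le)

theorem le_total_of_mem {B C : D.Ball} {y : Δ} (hB : y ∈ B) (hC : y ∈ C) : B ≤ C ∨ C ≤ B :=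
  (le_total C.radius B.radius).imp (le_of_radius_le hB hC) (le_of_radius_le hC hB)

theorem radius_le_of_le {B C : D.Ball} (h : B ≤ C) : C.radius ≤ B.radius := by
  obtain ⟨-, x, hx, z, hz, hxz⟩ := B.hasRadius
  rw [← hxz]
  exact (mem_iff (h hx)).mp (h hz)

theorem radius_lt_of_lt {B C : D.Ball} (h : B < C) : C.radius < B.radius := by
  refine (radius_le_of_le h.le).lt_of_ne fun h' => h.ne ?_
  obtain ⟨y, hy⟩ := B.nonempty
  exact eq_of_radius_eq hy (h.le hy) h'.symm

/-- `B` and its translate have the same radius, and balls of equal radius that meet are equal. -/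
theorem smul_eq_of_mem {B : D.Ball} {g : G} {y : Δ} (hy : y ∈ B) (hg : g • y ∈ B) : g • B = B :=
  eq_of_radius_eq (smul_mem_smul hy) hg (radius_smul g B)

theorem smul_eq_iff_of_mem {B : D.Ball} {g : G} {y : Δ} (hy : y ∈ B) :
    g • B = B ↔ g • y ∈ B :=
  ⟨fun h => h ▸ smul_mem_smul hy, smul_eq_of_mem hy⟩

/-- Balls consisting of a single point. -/
def IsPoint (B : D.Ball) : Prop := ∃ y, (B : Set Δ) = {y}

theorem radius_eq_of_isPoint {B : D.Ball} (h : B.IsPoint) : B.radius = D.wTop := by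
  obtain ⟨y, hy⟩ := h
  obtain ⟨-, x, hx, z, hz, hxz⟩ := B.hasRadius
  rw [hy, Set.mem_singleton_iff] at hx hz
  rw [← hxz, hx, hz, D.w_self]

theorem isPoint_span_self (y : Δ) : (span D y y).IsPoint := by
  refine ⟨y, ?_⟩
  ext x
  rw [SetLike.mem_coe, mem_span, D.w_self, Set.mem_singleton_iff]
  refine ⟨fun h => ?_, fun h => by rw [h, D.w_self]⟩
  by_contra hne
  exact h.not_gt (D.w_lt y x (Ne.symm hne))

theorem not_lt_of_isPoint {B C : D.Ball} (h : C.IsPoint) : ¬ B < C := by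
  obtain ⟨y, hy⟩ := h
  intro hlt
  refine hlt.not_ge fun z hz => ?_
  obtain ⟨x, hx⟩ := B.nonempty
  have h1 : x ∈ (C : Set Δ) := hlt.le hx
  have h2 : z ∈ (C : Set Δ) := hz
  rw [hy, Set.mem_singleton_iff] at h1 h2
  rwa [h2, ← h1]

section Finite

variable [Finite Δ]

instance : Finite D.Ball := Finite.of_injective _ (SetLike.coe_injective (A := D.Ball))

theorem exists_eq_univ [Nonempty Δ] (D : UltrametricAction G Δ) : ∃ B : D.Ball, ∀ y, y ∈ B := by
  let y : Δ := Classical.arbitrary Δ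
  obtain ⟨y', hy'⟩ := Finite.exists_min (D.w y)
  exact ⟨span D y y', hy'⟩

instance [Nonempty Δ] : OrderTop D.Ball where
  top := (exists_eq_univ D).choose
  le_top _ _ _ := (exists_eq_univ D).choose_spec _

theorem mem_top [Nonempty Δ] (y : Δ) : y ∈ (⊤ : D.Ball) := (exists_eq_univ D).choose_spec y

theorem smul_top [Nonempty Δ] (g : G) : g • (⊤ : D.Ball) = ⊤ :=
  top_le_iff.mp fun _ _ => mem_smul_iff.mpr (mem_top _)

theorem exists_least_gt [Nonempty Δ] (B : D.Ball) (hB : B ≠ ⊤) :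
    ∃ C, B < C ∧ ∀ C', B < C' → C ≤ C' := by
  obtain ⟨C, (hC : B < C), hmin⟩ := (Set.toFinite {C : D.Ball | B < C}).exists_minimal
    ⟨⊤, lt_top_iff_ne_top.mpr hB⟩
  refine ⟨C, hC, fun C' hC' => ?_⟩
  obtain ⟨y, hy⟩ := B.nonempty
  exact (le_total_of_mem (hC.le hy) (hC'.le hy)).elim id fun h => hmin hC' h

open Classical in
/-- The smallest ball containing `B` properly (or the whole space). -/
def parent [Nonempty Δ] (B : D.Ball) : D.Ball :=
  if h : B = ⊤ then ⊤ else (exists_least_gt B h).choose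

variable [Nonempty Δ]

theorem lt_parent {B : D.Ball} (hB : B ≠ ⊤) : B < B.parent := by
  rw [parent, dif_neg hB]; exact (exists_least_gt B hB).choose_spec.1

theorem parent_le {B C : D.Ball} (h : B < C) : B.parent ≤ C := by
  have hB : B ≠ ⊤ := (h.trans_le le_top).ne
  rw [parent, dif_neg hB]; exact (exists_least_gt B hB).choose_spec.2 C h

theorem smul_ne_top {B : D.Ball} (hB : B ≠ ⊤) (g : G) : g • B ≠ ⊤ := fun h =>
  hB (smul_left_cancel g (h.trans (smul_top g).symm))

theorem parent_smul (g : G) {B : D.Ball} (hB : B ≠ ⊤) : (g • B).parent = g • B.parent := by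
  refine (parent_le (smul_lt_smul (lt_parent hB))).antisymm ?_
  have h : B < g⁻¹ • (g • B).parent := by
    have := smul_lt_smul (g := g⁻¹) (lt_parent (smul_ne_top hB g))
    rwa [inv_smul_smul] at this
  have := smul_le_smul (g := g) (parent_le h)
  rwa [smul_inv_smul] at this

/-- Points outside `B` are at least as far from `B` as the parent of `B` is wide. -/
theorem w_le_radius_parent {B : D.Ball} {y z : Δ} (hy : y ∈ B) (hz : z ∉ B) :
    D.w y z ≤ B.parent.radius := by
  have hlt : B < span D y z := by
    refine lt_of_le_of_ne (le_of_radius_le hy (left_mem_span y z) ?_) fun h => hz ?_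
    · rw [radius_span]
      by_contra h
      exact hz ((mem_iff hy).mpr (not_le.mp h).le)
    · rw [h]; exact right_mem_span y z
  simpa using radius_le_of_le (parent_le hlt)

/-- Take a maximal ball among those that contain `y` and are strictly smaller than `B`; the
singleton `{y}` is one of them. It follows that the children of `B` cover `B`. -/
theorem exists_parent_eq {B : D.Ball} (hB : ¬ B.IsPoint) {y : Δ} (hy : y ∈ B) :
    ∃ C : D.Ball, y ∈ C ∧ C ≠ ⊤ ∧ C.parent = B := by
  have h0 : span D y y < B := by
    refine lt_of_le_of_ne (le_of_radius_le (left_mem_span y y) hy ?_) fun h =>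
      hB (h ▸ isPoint_span_self y)
    obtain ⟨-, x, -, z, -, h⟩ := B.hasRadius
    rw [radius_span, D.w_self, ← h]
    exact D.w_le_wTop x z
  obtain ⟨C, ⟨hyC, hC⟩, hmax⟩ := (Set.toFinite {C : D.Ball | y ∈ C ∧ C < B}).exists_maximal
    ⟨_, left_mem_span y y, h0⟩
  have hne : C ≠ ⊤ := (hC.trans_le le_top).ne
  refine ⟨C, hyC, hne, (parent_le hC).eq_of_not_lt fun h => ?_⟩
  have h1 := lt_parent hne
  exact h1.not_ge (hmax ⟨h1.le hyC, h⟩ h1.le)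

/-- Two balls with a common point whose parents have the same radius coincide. -/
theorem eq_of_radius_parent_eq {B C : D.Ball} {y : Δ} (hB : y ∈ B) (hC : y ∈ C) (hB' : B ≠ ⊤)
    (hC' : C ≠ ⊤) (h : B.parent.radius = C.parent.radius) : B = C := by
  have key : ∀ {B C : D.Ball}, B ≠ ⊤ → C ≠ ⊤ → B.parent.radius = C.parent.radius → B ≤ C →
      B = C := by
    intro B C _ hC' h hle
    refine hle.eq_of_not_lt fun hlt => ?_
    have h1 := radius_le_of_le (parent_le hlt)
    have h2 := radius_lt_of_lt (lt_parent hC')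
    rw [← h] at h2
    exact h1.not_gt h2
  rcases le_total_of_mem hB hC with h1 | h1
  · exact key hB' hC' h h1
  · exact (key hC' hB' h.symm h1).symm

end Finite

end Ball

end UltrametricAction
end UltrametricAction

/-! ### The tree of orbits of balls -/

section OrbitTree

open scoped Pointwise

/-- Reindexing by `τ ↦ τg⁻¹` shows that depths depend only on the orbit of a ball and not on the
chosen representative. -/
theorem classSum_congr_conj {G : Type*} [Group G] [Fintype G] {H H' : Subgroup G} {f f' : G → ℚ}
    (g : G) (hH : ∀ ρ, g * ρ * g⁻¹ ∈ H' ↔ ρ ∈ H) (hf : ∀ ρ ∈ H, f' (g * ρ * g⁻¹) = f ρ) :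
    classSum H' f' = classSum H f := by
  classical
  rw [classSum, classSum]
  congr 1
  ext σ
  congr 2
  rw [← Equiv.sum_comp (Equiv.mulRight g⁻¹)]
  refine Finset.sum_congr rfl fun τ _ => ?_
  have : (τ * g⁻¹)⁻¹ * σ * (τ * g⁻¹) = g * (τ⁻¹ * σ * τ) * g⁻¹ := by group
  simp only [Equiv.coe_mulRight, this, hH]
  split_ifs with h
  · exact hf _ h
  · rfl

/-- The fixed points of `σ` in a finite set with an action. -/
def fix {G Δ : Type*} [SMul G Δ] [Fintype Δ] (σ : G) : Finset Δ :=
  open Classical in Finset.univ.filter fun y => σ • y = y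

theorem mem_fix {G Δ : Type*} [SMul G Δ] [Fintype Δ] {σ : G} {y : Δ} : y ∈ fix σ ↔ σ • y = y := by
  simp [fix]

namespace UltrametricAction

variable {G : Type*} [Group G] {Δ : Type} [MulAction G Δ]

/-- The orbits of balls. -/
abbrev Orbit (D : UltrametricAction G Δ) : Type := MulAction.orbitRel.Quotient G D.Ball

variable {D : UltrametricAction G Δ}

/-- The orbit of a ball. -/
def Ball.orbit (B : D.Ball) : D.Orbit := Quotient.mk _ B

theorem orbit_eq_iff {B C : D.Ball} : B.orbit = C.orbit ↔ ∃ g : G, g • C = B :=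
  Quotient.eq (r := MulAction.orbitRel G D.Ball)

theorem orbit_out (q : D.Orbit) : Ball.orbit (Quotient.out q) = q := Quotient.out_eq q

theorem exists_out_eq (B : D.Ball) : ∃ g : G, Quotient.out B.orbit = g • B := by
  obtain ⟨g, hg⟩ := orbit_eq_iff.mp (orbit_out B.orbit)
  exact ⟨g, hg.symm⟩

/-- The union of the balls in an orbit. -/
def Orbit.cover (q : D.Orbit) : Set Δ := {y | ∃ B : D.Ball, B.orbit = q ∧ y ∈ B}

theorem mem_cover_iff {q : D.Orbit} {y : Δ} :
    y ∈ q.cover ↔ ∃ B : D.Ball, B.orbit = q ∧ y ∈ B := Iff.rfl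

theorem mem_cover_orbit {B : D.Ball} {y : Δ} : y ∈ B.orbit.cover ↔ ∃ g : G, y ∈ g • B := by
  rw [mem_cover_iff]
  constructor
  · rintro ⟨C, hC, hy⟩
    obtain ⟨g, rfl⟩ := orbit_eq_iff.mp hC
    exact ⟨g, hy⟩
  · rintro ⟨g, hy⟩
    exact ⟨g • B, orbit_eq_iff.mpr ⟨g, rfl⟩, hy⟩

theorem card_stabilizer_smul (g : G) (B : D.Ball) :
    Nat.card (MulAction.stabilizer G (g • B)) = Nat.card (MulAction.stabilizer G B) := by
  rw [MulAction.stabilizer_smul_eq_stabilizer_map_conj]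
  exact Nat.card_congr (Subgroup.equivMapOfInjective _ _ (MulAut.conj g).injective).symm.toEquiv

theorem mem_stabilizer_of_mem_fix [Fintype Δ] {B : D.Ball} {ρ : G} {y : Δ} (hy : y ∈ fix ρ)
    (hB : y ∈ B) : ρ ∈ MulAction.stabilizer G B :=
  Ball.smul_eq_of_mem hB ((mem_fix.mp hy).symm ▸ hB)

open Classical in
-- The fixed points of `τ⁻¹στ` in `B` are carried by `τ` to those of `σ` in `τ • B`. A point of the
-- orbit of `B` lies in `τ • B` exactly for `τ` in one left coset of the stabilizer, which accounts
-- for the factor.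
theorem sum_card_fix_conj [Fintype G] [Fintype Δ] (B : D.Ball) (σ : G) :
    ∑ τ : G, ((fix (τ⁻¹ * σ * τ) : Finset Δ).filter (· ∈ B)).card =
      Nat.card (MulAction.stabilizer G B) *
        ((fix σ : Finset Δ).filter (· ∈ B.orbit.cover)).card := by
  have h1 : ∀ τ : G, ((fix (τ⁻¹ * σ * τ) : Finset Δ).filter (· ∈ B)).card =
      ∑ z ∈ (fix σ : Finset Δ), if z ∈ τ • B then 1 else 0 := by
    intro τ
    rw [← Finset.card_filter]
    refine Finset.card_bij (fun y _ => τ • y) ?_ ?_ ?_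
    · intro y hy
      rw [Finset.mem_filter, mem_fix, mul_smul, mul_smul, inv_smul_eq_iff] at hy
      rw [Finset.mem_filter, mem_fix]
      exact ⟨hy.1, Ball.smul_mem_smul hy.2⟩
    · intro a _ b _ h
      exact smul_left_cancel τ h
    · intro z hz
      rw [Finset.mem_filter, mem_fix] at hz
      refine ⟨τ⁻¹ • z, ?_, smul_inv_smul τ z⟩
      rw [Finset.mem_filter, mem_fix, mul_smul, mul_smul, smul_inv_smul, hz.1]
      exact ⟨rfl, Ball.mem_smul_iff.mp hz.2⟩
  simp only [h1]
  rw [Finset.sum_comm, Finset.card_filter, Finset.mul_sum]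
  refine Finset.sum_congr rfl fun z _ => ?_
  rw [← Finset.card_filter, mem_cover_orbit]
  split_ifs with h
  · obtain ⟨g, hg⟩ := h
    rw [mul_one, Nat.card_eq_fintype_card, ← Finset.card_univ]
    symm
    refine Finset.card_bij (fun s _ => g * s) ?_ ?_ ?_
    · rintro ⟨s, hs⟩ -
      rw [Finset.mem_filter, mul_smul, MulAction.mem_stabilizer_iff.mp hs]
      exact ⟨Finset.mem_univ _, hg⟩
    · rintro a - b - h
      exact Subtype.ext (mul_left_cancel h)
    · intro τ hτ
      have hτ := (Finset.mem_filter.mp hτ).2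
      have : τ • B = g • B := Ball.eq_of_radius_eq hτ hg (by simp)
      refine ⟨⟨g⁻¹ * τ, ?_⟩, Finset.mem_univ _, mul_inv_cancel_left g τ⟩
      rw [MulAction.mem_stabilizer_iff, mul_smul, this, inv_smul_smul]
  · rw [mul_zero, Finset.card_eq_zero, Finset.filter_eq_empty_iff]
    exact fun τ _ hτ => h ⟨τ, hτ⟩

theorem ncard_smul (g : G) (B : D.Ball) : (g • B : Set Δ).ncard = (B : Set Δ).ncard :=
  Set.ncard_image_of_injective _ (MulAction.injective g)

theorem ncard_out (B : D.Ball) : ((Quotient.out B.orbit : D.Ball) : Set Δ).ncard =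
    (B : Set Δ).ncard := by
  obtain ⟨g, hg⟩ := exists_out_eq B
  rw [hg, Ball.coe_smul, ncard_smul]

variable [Finite Δ] [Nonempty Δ]

open Classical in
variable (D) in
/-- The parent function of the tree of orbits of balls, with an additional root. -/
def par : Option D.Orbit → Option D.Orbit
  | none => none
  | some q => if q = (⊤ : D.Ball).orbit then none
      else some (Ball.orbit (Quotient.out q : D.Ball).parent)

theorem orbit_eq_orbit_top_iff {B : D.Ball} : B.orbit = (⊤ : D.Ball).orbit ↔ B = ⊤ := by
  refine ⟨fun h => ?_, fun h => by rw [h]⟩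
  obtain ⟨g, hg⟩ := orbit_eq_iff.mp h
  rw [← hg, Ball.smul_top]

theorem out_eq_top_iff {q : D.Orbit} : (Quotient.out q : D.Ball) = ⊤ ↔ q = (⊤ : D.Ball).orbit := by
  rw [← orbit_eq_orbit_top_iff, orbit_out]

theorem orbit_parent_smul (g : G) {B : D.Ball} (hB : B ≠ ⊤) :
    (g • B).parent.orbit = B.parent.orbit := by
  rw [Ball.parent_smul g hB]
  exact orbit_eq_iff.mpr ⟨g, rfl⟩

theorem par_orbit {B : D.Ball} (hB : B ≠ ⊤) : D.par (some B.orbit) = some B.parent.orbit := by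
  rw [par, if_neg (orbit_eq_orbit_top_iff.not.mpr hB)]
  obtain ⟨g, hg⟩ := exists_out_eq B
  rw [hg, orbit_parent_smul g hB]

theorem par_orbit_top : D.par (some (⊤ : D.Ball).orbit) = none := by
  rw [par, if_pos rfl]

theorem par_eq_some_iff {q' q : D.Orbit} : D.par (some q') = some q ↔
    ∃ C : D.Ball, C ≠ ⊤ ∧ C.orbit = q' ∧ C.parent = Quotient.out q := by
  constructor
  · intro h
    have hne : (Quotient.out q' : D.Ball) ≠ ⊤ := by
      intro h'
      rw [out_eq_top_iff.mp h', par_orbit_top] at h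
      exact absurd h (by simp)
    rw [← orbit_out q', par_orbit hne, Option.some_inj] at h
    rw [← orbit_out q] at h
    obtain ⟨g, hg⟩ := orbit_eq_iff.mp h
    refine ⟨g⁻¹ • Quotient.out q', Ball.smul_ne_top hne _, ?_, ?_⟩
    · conv_rhs => rw [← orbit_out q']
      exact orbit_eq_iff.mpr ⟨g⁻¹, rfl⟩
    · rw [Ball.parent_smul _ hne, ← hg, inv_smul_smul]
  · rintro ⟨C, hC, rfl, h⟩
    rw [par_orbit hC, h, orbit_out]

theorem ncard_lt_ncard_parent {B : D.Ball} (hB : B ≠ ⊤) :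
    (B : Set Δ).ncard < (B.parent : Set Δ).ncard :=
  Set.ncard_lt_ncard (SetLike.coe_ssubset_coe.mpr (Ball.lt_parent hB))

variable (D) in
/-- The tree of orbits of balls, with an additional root. -/
def tree : ParentTree where
  V := Option D.Orbit
  finite_V := inferInstance
  root := none
  par := D.par
  par_root := rfl
  -- The height grows as balls shrink; the `+ 1` puts the whole space strictly above the extra root,
  -- which has height 0.
  height v := v.elim 0 fun q => Nat.card Δ + 1 - ((Quotient.out q : D.Ball) : Set Δ).ncard
  height_par_lt v hv := by
    obtain ⟨q, rfl⟩ := Option.ne_none_iff_exists'.mp hv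
    have hle : ∀ B : D.Ball, (B : Set Δ).ncard ≤ Nat.card Δ := fun B => Set.ncard_le_card _
    by_cases hq : q = (⊤ : D.Ball).orbit
    · have := hle (Quotient.out q)
      rw [hq, par_orbit_top, ← hq]
      simp only [Option.elim]
      omega
    · have hne := out_eq_top_iff.not.mpr hq
      have h1 := ncard_lt_ncard_parent hne
      have h2 := hle (Quotient.out q : D.Ball).parent
      conv_lhs => rw [← orbit_out q, par_orbit hne]
      simp only [Option.elim, ncard_out]
      omega
  existsUnique_child := by
    refine ⟨some (⊤ : D.Ball).orbit, ⟨by simp, par_orbit_top⟩, ?_⟩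
    rintro v ⟨hv, hpar⟩
    obtain ⟨q, rfl⟩ := Option.ne_none_iff_exists'.mp hv
    by_contra h
    rw [Option.some_inj] at h
    rw [← orbit_out q, par_orbit (out_eq_top_iff.not.mpr h)] at hpar
    exact absurd hpar (by simp)

variable (D) in
/-- The trunk tree of orbits of balls. -/
abbrev trunkTree : TrunkTree := D.tree.toTrunkTree

theorem succ_iff {v w : Option D.Orbit} : D.trunkTree.Succ v w ↔ w ≠ none ∧ D.par w = v :=
  ParentTree.succ_iff

theorem isLeaf_iff {q : D.Orbit} : D.trunkTree.IsLeaf (some q) ↔ (Quotient.out q : D.Ball).IsPoint := by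
  constructor
  · intro h
    by_contra hp
    obtain ⟨y, hy⟩ := (Quotient.out q : D.Ball).nonempty
    obtain ⟨C, -, hC, hC'⟩ := Ball.exists_parent_eq hp hy
    exact h (some C.orbit) (succ_iff.mpr ⟨by simp, par_eq_some_iff.mpr ⟨C, hC, rfl, hC'⟩⟩)
  · intro h w hw
    obtain ⟨hw, hpar⟩ := succ_iff.mp hw
    obtain ⟨q', rfl⟩ := Option.ne_none_iff_exists'.mp hw
    obtain ⟨C, hC, -, hC'⟩ := par_eq_some_iff.mp hpar
    exact Ball.not_lt_of_isPoint h (hC' ▸ Ball.lt_parent hC)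

theorem not_isLeaf_none : ¬ D.trunkTree.IsLeaf (none : Option D.Orbit) := fun h =>
  h (some (⊤ : D.Ball).orbit) (succ_iff.mpr ⟨by simp, par_orbit_top⟩)

theorem edge_exists (e : D.trunkTree.Edge) :
    ∃ q : D.Orbit, e.tgt = some q ∧ e.src = D.par (some q) := by
  obtain ⟨h, h'⟩ := succ_iff.mp e.succ
  obtain ⟨q, hq⟩ := Option.ne_none_iff_exists'.mp h
  exact ⟨q, hq, by rw [← hq]; exact h'.symm⟩

theorem edge_ext {e e' : D.trunkTree.Edge} (h : e.tgt = e'.tgt) : e = e' := by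
  have h1 := (succ_iff.mp e.succ).2
  have h2 := (succ_iff.mp e'.succ).2
  cases e; cases e'
  simp only at h h1 h2
  subst h
  simp only [TrunkTree.Edge.mk.injEq, and_true]
  exact h1.symm.trans h2

end UltrametricAction
end OrbitTree

/-! ### Hurwitz trees from fixed points -/

section FixedPointDatum

open scoped Pointwise

open Classical in
/-- The numerical data attached to the fixed points of a finite group of automorphisms of the open
disk: `v σ` is the Gauss valuation of `σ(z) - z`, so that
`v σ + ∑_{y' ∈ Δ_σ} min r (w y y')` is its valuation on the closed disk of radius `r` about `y`. -/
structure FixedPointDatum (p : ℕ) (G : Type*) [Group G] (Δ : Type) [Fintype Δ] [MulAction G Δ]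
    extends UltrametricAction G Δ where
  v : G → ℚ
  v_nonneg : ∀ σ ≠ 1, 0 ≤ v σ
  v_conj : ∀ σ τ, v (τ * σ * τ⁻¹) = v σ
  min_v_le : ∀ σ τ, σ ≠ 1 → τ ≠ 1 → σ * τ ≠ 1 → min (v σ) (v τ) ≤ v (σ * τ)
  -- The product formula for the displacement of `σ` at the point `y`.
  w_smul_self : ∀ (σ : G) (y : Δ), σ • y ≠ y → w y (σ • y) = v σ + ∑ y' ∈ fix σ, w y y'
  -- The last two hypotheses say that `σ` and `τ` preserve the ball about `y` with radius `w y y₁`;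
  -- the inequality comes from `στx - x = (στx - τx) + (τx - x)` on that ball. In the next field the
  -- displacement on a preserved ball is bounded by the size of the ball.
  min_disp_le : ∀ (σ τ : G) (y y₁ : Δ), σ ≠ 1 → τ ≠ 1 → σ * τ ≠ 1 →
    w y y₁ ≤ w y (σ • y) → w y y₁ ≤ w y (τ • y) →
    min (v σ + ∑ y' ∈ fix σ, min (w y y₁) (w y y')) (v τ + ∑ y' ∈ fix τ, min (w y y₁) (w y y')) ≤
      v (σ * τ) + ∑ y' ∈ fix (σ * τ), min (w y y₁) (w y y')
  le_disp : ∀ (σ : G) (y y₁ : Δ), σ ≠ 1 → w y y₁ ≤ w y (σ • y) →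
    w y y₁ ≤ v σ + ∑ y' ∈ fix σ, min (w y y₁) (w y y')
  stabilizer_ne_bot : ∀ y : Δ, MulAction.stabilizer G y ≠ ⊥
  isCyclic_stabilizer : ∀ y : Δ, IsCyclic (MulAction.stabilizer G y)
  -- In this field and the next, the left side is the valuation of `ζ - 1`, for `ζ` the derivative
  -- of `σ` at its fixed point `y`.
  v_add_sum_of_orderOf_eq : ∀ (σ : G) (y : Δ) (k : ℕ), σ • y = y → orderOf σ = p ^ (k + 1) →
    v σ + ∑ y' ∈ (fix σ).erase y, w y y' = 1 / (p ^ k * (p - 1))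
  v_add_sum_of_orderOf_ne : ∀ (σ : G) (y : Δ), σ • y = y → (∀ k : ℕ, orderOf σ ≠ p ^ k) →
    v σ + ∑ y' ∈ (fix σ).erase y, w y y' = 0

namespace FixedPointDatum

open UltrametricAction

variable {p : ℕ} {G : Type*} [Group G] {Δ : Type} [Fintype Δ] [MulAction G Δ]
  (D : FixedPointDatum p G Δ)

/-- The valuation of `σ(z) - z` on a ball, minus the radius of the ball. -/
def excess (B : D.Ball) (σ : G) : ℚ :=
  D.v σ + ∑ y' ∈ fix σ, min B.radius (D.w B.nonempty.choose y') - B.radius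

variable {D}

/-- By the ultrametric inequality, distances truncated at the radius do not see which centre is
taken, so the excess is independent of the chosen point. -/
theorem min_radius_w_eq {B : D.Ball} {y z : Δ} (hy : y ∈ B) (hz : z ∈ B) (x : Δ) :
    min B.radius (D.w y x) = min B.radius (D.w z x) := by
  have key : ∀ {y z : Δ}, y ∈ B → z ∈ B → min B.radius (D.w y x) ≤ D.w z x := by
    intro y z hy hz
    refine le_trans ?_ (D.min_w_le z y x)
    exact min_le_min_right _ ((Ball.mem_iff hz).mp hy)
  exact le_antisymm (le_min (min_le_left _ _) (key hy hz)) (le_min (min_le_left _ _) (key hz hy))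

theorem excess_eq {B : D.Ball} {y : Δ} (hy : y ∈ B) (σ : G) :
    D.excess B σ = D.v σ + ∑ y' ∈ fix σ, min B.radius (D.w y y') - B.radius := by
  simp only [excess, min_radius_w_eq B.nonempty.choose_spec hy]

theorem excess_smul (g : G) (B : D.Ball) (σ : G) :
    D.excess (g • B) (g * σ * g⁻¹) = D.excess B σ := by
  obtain ⟨y, hy⟩ := B.nonempty
  rw [excess_eq (Ball.smul_mem_smul hy), excess_eq hy, D.v_conj, Ball.radius_smul]
  congr 2
  symm
  refine Finset.sum_bij (fun y' _ => g • y') ?_ ?_ ?_ ?_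
  · intro a ha
    rw [mem_fix] at ha ⊢
    rw [mul_smul, mul_smul, inv_smul_smul, ha]
  · intro a _ b _ h
    exact smul_left_cancel g h
  · intro b hb
    rw [mem_fix, mul_smul, mul_smul] at hb
    refine ⟨g⁻¹ • b, ?_, smul_inv_smul g b⟩
    rw [mem_fix, eq_inv_smul_iff, hb]
  · intro a _
    rw [D.w_smul]

theorem le_w_smul {B : D.Ball} {σ : G} {y : Δ} (hy : y ∈ B) (hσ : σ ∈ MulAction.stabilizer G B) :
    B.radius ≤ D.w y (σ • y) :=
  (Ball.mem_iff hy).mp ((Ball.smul_eq_iff_of_mem hy).mp hσ)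

theorem excess_nonneg {B : D.Ball} {σ : G} (hσ : σ ∈ MulAction.stabilizer G B) (h1 : σ ≠ 1) :
    0 ≤ D.excess B σ := by
  obtain ⟨y, hy⟩ := B.nonempty
  obtain ⟨z, -, hz⟩ := B.hasRadius.exists_w_eq hy
  rw [excess_eq hy, sub_nonneg, ← hz]
  refine D.le_disp σ y z h1 ?_
  rw [hz]
  exact le_w_smul hy hσ

theorem min_excess_le {B : D.Ball} {σ τ : G} (hσ : σ ∈ MulAction.stabilizer G B)
    (hτ : τ ∈ MulAction.stabilizer G B) (h1 : σ ≠ 1) (h2 : τ ≠ 1) (h3 : σ * τ ≠ 1) :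
    min (D.excess B σ) (D.excess B τ) ≤ D.excess B (σ * τ) := by
  obtain ⟨y, hy⟩ := B.nonempty
  obtain ⟨z, -, hz⟩ := B.hasRadius.exists_w_eq hy
  rw [excess_eq hy, excess_eq hy, excess_eq hy, min_sub_sub_right]
  refine sub_le_sub_right ?_ _
  have hσ' := le_w_smul hy hσ
  have hτ' := le_w_smul hy hτ
  rw [← hz] at hσ' hτ' ⊢
  exact D.min_disp_le σ τ y z h1 h2 h3 hσ' hτ'

/-- The term `y' = y` contributes `wTop`, which is also the radius being subtracted. The artificial
value on the diagonal therefore leaves no trace in the depth of a leaf. -/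
theorem sum_erase_eq_excess {B : D.Ball} {y : Δ} (hB : (B : Set Δ) = {y}) {σ : G}
    (hσ : σ • y = y) : open Classical in
    D.v σ + ∑ y' ∈ (fix σ).erase y, D.w y y' = D.excess B σ := by
  classical
  have hy : y ∈ B := by
    have : y ∈ (B : Set Δ) := by rw [hB]; rfl
    exact this
  rw [excess_eq hy, ← Finset.add_sum_erase _ _ (mem_fix.mpr hσ), Ball.radius_eq_of_isPoint ⟨y, hB⟩,
    D.w_self, min_self]
  have : ∀ y' ∈ (fix σ).erase y, min D.wTop (D.w y y') = D.w y y' := fun y' _ =>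
    min_eq_right (D.w_le_wTop y y')
  rw [Finset.sum_congr rfl this]
  ring

section Parent

variable [Nonempty Δ]

open Classical in
-- If `σ` preserves `B`, only the fixed points in `B` contribute to the growth of the truncated sum,
-- and the subtracted radius gives the `- 1`. If `σ` preserves only the parent, it has no fixed
-- point in `B`, and it moves each `y` in `B` by exactly the radius of the parent. No truncation
-- occurs at `y`, so `w_smul_self` says that the excess on the parent is zero.
theorem ite_excess_eq {B : D.Ball} (hB : B ≠ ⊤) {σ : G} :
    (if σ ∈ MulAction.stabilizer G B then D.excess B σ else 0) =
      (if σ ∈ MulAction.stabilizer G B.parent then D.excess B.parent σ else 0) +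
        (B.radius - B.parent.radius) * (((fix σ : Finset Δ).filter (· ∈ B)).card -
          if σ ∈ MulAction.stabilizer G B then 1 else 0) := by
  obtain ⟨y, hy⟩ := B.nonempty
  have hlt := Ball.lt_parent hB
  have hrad := Ball.radius_lt_of_lt hlt
  have hy' : y ∈ B.parent := hlt.le hy
  by_cases h : σ ∈ MulAction.stabilizer G B
  · have h' : σ ∈ MulAction.stabilizer G B.parent := by
      rw [MulAction.mem_stabilizer_iff] at h ⊢
      rw [← Ball.parent_smul σ hB, h]
    rw [if_pos h, if_pos h', if_pos h, excess_eq hy, excess_eq hy', Finset.card_filter]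
    push_cast
    have key : ∀ z ∈ fix σ, min B.radius (D.w y z) = min B.parent.radius (D.w y z) +
        (B.radius - B.parent.radius) * if z ∈ B then 1 else 0 := by
      intro z _
      split_ifs with hz
      · rw [min_eq_left ((Ball.mem_iff hy).mp hz), min_eq_left ((Ball.mem_iff hy').mp (hlt.le hz))]
        ring
      · have := Ball.w_le_radius_parent hy hz
        rw [min_eq_right this, min_eq_right (this.trans hrad.le)]
        ring
    rw [Finset.sum_congr rfl key, Finset.sum_add_distrib, ← Finset.mul_sum]
    ring
  · have h0 : (fix σ : Finset Δ).filter (· ∈ B) = ∅ := by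
      rw [Finset.filter_eq_empty_iff]
      exact fun z hz hzB => h (mem_stabilizer_of_mem_fix hz hzB)
    rw [if_neg h, if_neg h, h0]
    simp only [Finset.card_empty, Nat.cast_zero, sub_zero, mul_zero, add_zero]
    symm
    rw [ite_eq_right_iff]
    intro h'
    have hσy : σ • y ∉ B := fun hmem => h (Ball.smul_eq_of_mem hy hmem)
    have hne : σ • y ≠ y := fun he => hσy (he.symm ▸ hy)
    have h1 : D.w y (σ • y) = B.parent.radius :=
      (Ball.w_le_radius_parent hy hσy).antisymm (le_w_smul hy' h')
    have h2 : ∀ z ∈ fix σ, min B.parent.radius (D.w y z) = D.w y z := by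
      intro z hz
      refine min_eq_right (Ball.w_le_radius_parent hy fun hzB => ?_)
      exact h (mem_stabilizer_of_mem_fix hz hzB)
    rw [excess_eq hy', Finset.sum_congr rfl h2, ← D.w_smul_self σ y hne, h1, sub_self]

theorem stabilizer_top : MulAction.stabilizer G (⊤ : D.Ball) = ⊤ :=
  eq_top_iff.mpr fun g _ => Ball.smul_top g

end Parent

variable [Fintype G]

variable (D) in
/-- The depth character at a ball. -/
def ballDepth (B : D.Ball) : G → ℂ := classSum (MulAction.stabilizer G B) (D.excess B)

theorem ballDepth_smul (g : G) (B : D.Ball) : D.ballDepth (g • B) = D.ballDepth B := by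
  refine classSum_congr_conj g (fun ρ => ?_) fun ρ _ => excess_smul g B ρ
  rw [MulAction.mem_stabilizer_iff, MulAction.mem_stabilizer_iff, mul_smul, mul_smul,
    inv_smul_smul, smul_left_cancel_iff]

theorem ballDepth_out (B : D.Ball) : D.ballDepth (Quotient.out B.orbit) = D.ballDepth B := by
  obtain ⟨g, hg⟩ := exists_out_eq B
  rw [hg, ballDepth_smul]

theorem ballDepth_mem (B : D.Ball) : D.ballDepth B ∈ nonnegRationalCharacters G :=
  classSum_mem_nonnegRationalCharacters _ _
    (fun _ hσ _ hτ => min_excess_le hσ hτ) fun _ hσ => excess_nonneg hσ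

open Classical in
variable (D) in
/-- The Artin character of an orbit of balls. -/
def orbitArtin (q : D.Orbit) : G → ℂ :=
  balanced fun σ => -(((fix σ : Finset Δ).filter (· ∈ q.cover)).card : ℂ)

/-- The orbit of a point is `G/S`, with `S` its stabilizer. The number of fixed points of `σ` on
`G/S` is the induced trivial character of `S`, and this is `-u_S^*` away from `1`. -/
theorem orbitArtin_of_isPoint {B : D.Ball} (hB : B.IsPoint) :
    D.orbitArtin B.orbit = inducedAugmentation (MulAction.stabilizer G B) := by
  classical
  obtain ⟨y, hBy⟩ := hB
  have hmem : ∀ z, z ∈ B ↔ z = y := fun z => by rw [← SetLike.mem_coe, hBy]; rfl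
  refine ext_of_sum_eq_zero (sum_balanced _) (sum_inducedAugmentation _) fun σ hσ => ?_
  have hS : (Nat.card (MulAction.stabilizer G B) : ℂ) ≠ 0 := Nat.cast_ne_zero.mpr Nat.card_pos.ne'
  refine mul_left_cancel₀ hS ?_
  rw [card_mul_inducedAugmentation _ hσ, orbitArtin, balanced_apply _ hσ, mul_neg, neg_inj,
    ← Nat.cast_mul, ← sum_card_fix_conj B σ]
  push_cast
  refine Finset.sum_congr rfl fun τ _ => ?_
  have h1 : τ⁻¹ * σ * τ ∈ MulAction.stabilizer G B ↔ y ∈ fix (τ⁻¹ * σ * τ) := by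
    rw [MulAction.mem_stabilizer_iff, Ball.smul_eq_iff_of_mem ((hmem y).mpr rfl), hmem, mem_fix]
  simp only [h1, hmem]
  split_ifs with h
  · rw [Finset.card_eq_one.mpr ⟨y, ?_⟩, Nat.cast_one]
    ext z
    simp only [Finset.mem_filter, Finset.mem_singleton, and_iff_right_iff_imp]
    rintro rfl
    exact h
  · rw [Finset.filter_eq_empty_iff.mpr, Finset.card_empty, Nat.cast_zero]
    rintro z hz rfl
    exact h hz

variable [Nonempty Δ]

theorem ballDepth_eq_add {B : D.Ball} (hB : B ≠ ⊤) :
    D.ballDepth B = D.ballDepth B.parent +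
      (((B.radius - B.parent.radius) * Nat.card (MulAction.stabilizer G B) : ℚ) : ℂ) •
        (D.orbitArtin B.orbit - inducedAugmentation (MulAction.stabilizer G B)) := by
  classical
  exact classSum_eq_add _ _ _ (fun σ _ => ite_excess_eq hB) fun σ _ => sum_card_fix_conj B σ

/-- The trunk runs from radius 0, where the excess is `v`, to the radius of the whole of `Δ`; every
fixed point lies in that ball, and all of `G` preserves it. -/
theorem ballDepth_top_eq_add :
    D.ballDepth ⊤ = classSum ⊤ D.v +
      (((⊤ : D.Ball).radius * Nat.card (MulAction.stabilizer G (⊤ : D.Ball)) : ℚ) : ℂ) •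
        (D.orbitArtin (⊤ : D.Ball).orbit -
          inducedAugmentation (MulAction.stabilizer G (⊤ : D.Ball))) := by
  classical
  refine classSum_eq_add _ (fun σ => ((fix σ : Finset Δ).filter (· ∈ (⊤ : D.Ball))).card) _
    (fun σ _ => ?_) fun σ _ => sum_card_fix_conj ⊤ σ
  obtain ⟨y, hy⟩ := (⊤ : D.Ball).nonempty
  have key : ∀ z ∈ fix σ, min (⊤ : D.Ball).radius (D.w y z) = (⊤ : D.Ball).radius := fun z _ =>
    min_eq_left ((Ball.mem_iff hy).mp (Ball.mem_top z))
  have h0 : (fix σ : Finset Δ).filter (· ∈ (⊤ : D.Ball)) = fix σ :=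
    Finset.filter_true_of_mem fun z _ => Ball.mem_top z
  rw [stabilizer_top, if_pos (Subgroup.mem_top _), if_pos (Subgroup.mem_top _), excess_eq hy, h0,
    Finset.sum_congr rfl key, Finset.sum_const, nsmul_eq_mul, if_pos (Subgroup.mem_top _)]
  ring

end FixedPointDatum
end FixedPointDatum

/-! ### Artin characters, depths, monodromy and thickness on the tree of orbits -/

section FixedPointDatum

open scoped Pointwise

/-- A function whose sum over a fibre counts points is additive over a partition of the points. -/
theorem card_filter_eq_sum_card_filter {ι Δ : Type*} [Fintype ι] [DecidableEq ι] (s : Finset Δ)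
    (P : Δ → Prop) (Q : ι → Δ → Prop) [DecidablePred P] [∀ i, DecidablePred (Q i)]
    (h : ∀ y, P y → ∃! i, Q i y) (h' : ∀ i y, Q i y → P y) :
    (s.filter P).card = ∑ i, (s.filter (Q i)).card := by
  simp only [Finset.card_filter]
  rw [Finset.sum_comm]
  refine Finset.sum_congr rfl fun y _ => ?_
  split_ifs with hy
  · obtain ⟨i, hi, hu⟩ := h y hy
    rw [Finset.sum_eq_single i, if_pos hi]
    · exact fun j _ hj => if_neg fun hQ => hj (hu j hQ)
    · exact fun hi => absurd (Finset.mem_univ i) hi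
  · exact (Finset.sum_eq_zero fun i _ => if_neg fun hQ => hy (h' i y hQ)).symm

namespace FixedPointDatum

open UltrametricAction

variable {p : ℕ} {G : Type*} [Group G] {Δ : Type} [Fintype Δ] [MulAction G Δ]
  (D : FixedPointDatum p G Δ) [Fintype G]

/-- The Artin character of a vertex other than the root. -/
def artinAt (v : Option D.Orbit) : G → ℂ := v.elim 0 D.orbitArtin

variable [Nonempty Δ]

variable {D}

theorem mem_edge_iff {q : D.Orbit} (e : {e : D.trunkTree.Edge // e.src = some q}) :
    ∃ C : D.Ball, C ≠ ⊤ ∧ C.parent = Quotient.out q ∧ e.1.tgt = some C.orbit := by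
  obtain ⟨q', hq', hsrc⟩ := edge_exists e.1
  rw [e.2] at hsrc
  obtain ⟨C, hC, rfl, hC'⟩ := par_eq_some_iff.mp hsrc.symm
  exact ⟨C, hC, hC', hq'⟩

/-- The orbits of the children of a ball partition the points covered by the orbit of that ball, and
fixed points are counted on each part. -/
theorem orbitArtin_eq_sum {q : D.Orbit} (hq : ¬ (Quotient.out q : D.Ball).IsPoint)
    [Fintype {e : D.trunkTree.Edge // e.src = some q}] :
    D.orbitArtin q = ∑ e : {e : D.trunkTree.Edge // e.src = some q}, D.artinAt e.1.tgt := by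
  classical
  choose C hC hCq hCe using mem_edge_iff (D := D) (q := q)
  have hart : ∀ e : {e : D.trunkTree.Edge // e.src = some q},
      D.artinAt e.1.tgt = D.orbitArtin (C e).orbit := fun e => by rw [hCe]; rfl
  simp only [hart]
  refine ext_of_sum_eq_zero (sum_balanced _) ?_ fun σ hσ => ?_
  · simp only [Finset.sum_apply]
    rw [Finset.sum_comm]
    exact Finset.sum_eq_zero fun e _ => sum_balanced _
  · rw [Finset.sum_apply]
    simp only [orbitArtin, balanced_apply _ hσ]
    rw [Finset.sum_neg_distrib, neg_inj, ← Nat.cast_sum, Nat.cast_inj]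
    refine card_filter_eq_sum_card_filter _ _ _ ?_ ?_
    · intro y hy
      rw [← orbit_out q, mem_cover_orbit] at hy
      obtain ⟨g, hg⟩ := hy
      rw [Ball.mem_smul_iff] at hg
      obtain ⟨B, hyB, hB, hB'⟩ := Ball.exists_parent_eq hq hg
      have hpar : D.par (some B.orbit) = some q := par_eq_some_iff.mpr ⟨B, hB, rfl, hB'⟩
      let e : {e : D.trunkTree.Edge // e.src = some q} :=
        ⟨⟨some q, some B.orbit, succ_iff.mpr ⟨by simp, hpar⟩⟩, rfl⟩
      have he : (C e).orbit = B.orbit := (Option.some_inj.mp (hCe e)).symm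
      refine ⟨e, ?_, ?_⟩
      · change y ∈ (C e).orbit.cover
        rw [he, mem_cover_orbit]
        exact ⟨g, Ball.mem_smul_iff.mpr hyB⟩
      · intro e' (he' : y ∈ (C e').orbit.cover)
        rw [mem_cover_orbit] at he'
        obtain ⟨g', hg'⟩ := he'
        -- Both balls contain `y`, and their parents have the same radius as translates of one ball;
        -- so the child orbit containing `y` is unique.
        have h1 : g' • C e' = g • B := by
          refine Ball.eq_of_radius_parent_eq hg' (Ball.mem_smul_iff.mpr hyB)
            (Ball.smul_ne_top (hC e') _) (Ball.smul_ne_top hB _) ?_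
          rw [Ball.parent_smul _ (hC e'), Ball.parent_smul _ hB, hCq, hB', Ball.radius_smul,
            Ball.radius_smul]
        have h2 : (C e').orbit = B.orbit := by
          refine orbit_eq_iff.mpr ⟨g'⁻¹ * g, ?_⟩
          rw [mul_smul, ← h1, inv_smul_smul]
        refine Subtype.ext (edge_ext ?_)
        rw [hCe e', hCe e, h2, he]
    · intro e y (hy : y ∈ (C e).orbit.cover)
      rw [mem_cover_orbit] at hy
      obtain ⟨g, hg⟩ := hy
      rw [← orbit_out q, mem_cover_orbit, ← hCq e]
      exact ⟨g, Ball.smul_le_smul (Ball.lt_parent (hC e)).le hg⟩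

/-- Induction on the size of the ball: characters `u_S^*` at the points, sums of characters above
them. -/
theorem orbitArtin_mem (q : D.Orbit) : D.orbitArtin q ∈ trueCharacters G := by
  induction hn : ((Quotient.out q : D.Ball) : Set Δ).ncard using Nat.strong_induction_on
    generalizing q with
  | _ n ih =>
    by_cases hq : (Quotient.out q : D.Ball).IsPoint
    · rw [← orbit_out q, orbitArtin_of_isPoint hq]
      exact inducedAugmentation_mem_trueCharacters _
    · have : Finite D.trunkTree.Edge :=
        have := D.trunkTree.finite_V
        Finite.of_injective (fun e : D.trunkTree.Edge => e.tgt) fun _ _ h => edge_ext h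
      have := Fintype.ofFinite {e : D.trunkTree.Edge // e.src = some q}
      rw [orbitArtin_eq_sum hq]
      refine sum_mem_trueCharacters _ _ fun e _ => ?_
      obtain ⟨C, hC, hCq, hCe⟩ := mem_edge_iff e
      rw [hCe]
      refine ih _ ?_ C.orbit rfl
      rw [← hn, ← hCq, ncard_out]
      exact ncard_lt_ncard_parent hC

variable (D) in
/-- The depth character of a vertex. -/
def depthAt (v : Option D.Orbit) : G → ℂ :=
  v.elim (classSum ⊤ D.v) fun q => D.ballDepth (Quotient.out q)

theorem depthAt_mem (v : Option D.Orbit) : D.depthAt v ∈ nonnegRationalCharacters G := by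
  cases v with
  | none =>
    exact classSum_mem_nonnegRationalCharacters _ _ (fun σ _ τ _ => D.min_v_le σ τ)
      fun σ _ => D.v_nonneg σ
  | some q => exact ballDepth_mem _

variable (D) in
/-- The monodromy group of a vertex. -/
def monodromyAt (v : Option D.Orbit) : Subgroup G :=
  v.elim ⊤ fun q => MulAction.stabilizer G (Quotient.out q : D.Ball)

open Classical in
variable (D) in
/-- The thickness of the edge leading to an orbit of balls. -/
def thicknessAt (q : D.Orbit) : ℚ :=
  if (Quotient.out q : D.Ball).IsPoint then 0 else
    ((Quotient.out q : D.Ball).radius - if q = (⊤ : D.Ball).orbit then 0 else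
      (Quotient.out q : D.Ball).parent.radius) *
      Nat.card (MulAction.stabilizer G (Quotient.out q : D.Ball))

theorem thicknessAt_pos {q : D.Orbit} (hq : ¬ (Quotient.out q : D.Ball).IsPoint) :
    0 < D.thicknessAt q := by
  rw [thicknessAt, if_neg hq]
  refine mul_pos ?_ (by exact_mod_cast Nat.card_pos)
  split_ifs with h
  · rw [sub_zero]
    exact Ball.radius_pos _
  · rw [sub_pos]
    exact Ball.radius_lt_of_lt (Ball.lt_parent (out_eq_top_iff.not.mpr h))

theorem depthAt_eq_add (q : D.Orbit) :
    D.depthAt (some q) = D.depthAt (D.par (some q)) + (D.thicknessAt q : ℂ) •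
      (D.orbitArtin q - inducedAugmentation (D.monodromyAt (some q))) := by
  classical
  have key : D.depthAt (some q) = D.depthAt (D.par (some q)) +
      ((((Quotient.out q : D.Ball).radius - if q = (⊤ : D.Ball).orbit then 0 else
      (Quotient.out q : D.Ball).parent.radius) *
      Nat.card (MulAction.stabilizer G (Quotient.out q : D.Ball)) : ℚ) : ℂ) •
      (D.orbitArtin q - inducedAugmentation (D.monodromyAt (some q))) := by
    by_cases hq : q = (⊤ : D.Ball).orbit
    · have htop := out_eq_top_iff.mpr hq
      subst hq
      rw [if_pos rfl, sub_zero, par_orbit_top]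
      simp only [depthAt, monodromyAt, Option.elim, htop]
      exact ballDepth_top_eq_add
    · have hne := out_eq_top_iff.not.mpr hq
      have hpar : D.par (some q) = some (Quotient.out q : D.Ball).parent.orbit := by
        rw [← par_orbit hne, orbit_out]
      rw [if_neg hq, hpar]
      simp only [depthAt, monodromyAt, Option.elim]
      rw [ballDepth_out, ballDepth_eq_add hne, orbit_out]
  -- At a leaf the slope vanishes, so replacing the artificial thickness, which involves `wTop`, by
  -- 0 does not affect the relation.
  by_cases hp : (Quotient.out q : D.Ball).IsPoint
  · have h0 : D.orbitArtin q - inducedAugmentation (D.monodromyAt (some q)) = 0 := by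
      have := orbitArtin_of_isPoint hp
      rw [orbit_out] at this
      exact sub_eq_zero.mpr this
    rw [key, h0, smul_zero, smul_zero]
  · rw [key, thicknessAt, if_neg hp]

theorem card_monodromyAt_orbit (B : D.Ball) :
    Nat.card (D.monodromyAt (some B.orbit)) = Nat.card (MulAction.stabilizer G B) := by
  obtain ⟨g, hg⟩ := exists_out_eq B
  rw [monodromyAt, Option.elim, hg, card_stabilizer_smul]

theorem stabilizer_le_stabilizer_parent {B : D.Ball} (hB : B ≠ ⊤) :
    MulAction.stabilizer G B ≤ MulAction.stabilizer G B.parent := by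
  intro ρ hρ
  rw [MulAction.mem_stabilizer_iff] at hρ ⊢
  rw [← Ball.parent_smul ρ hB, hρ]

theorem exists_map_conj_le {v w : Option D.Orbit} (h : D.trunkTree.Succ v w) :
    ∃ g : G, (D.monodromyAt w).map (MulAut.conj g).toMonoidHom ≤ D.monodromyAt v := by
  cases v with
  | none => exact ⟨1, le_top⟩
  | some q =>
    obtain ⟨hw, hpar⟩ := succ_iff.mp h
    obtain ⟨q', rfl⟩ := Option.ne_none_iff_exists'.mp hw
    obtain ⟨C, hC, rfl, hCq⟩ := par_eq_some_iff.mp hpar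
    obtain ⟨g, hg⟩ := exists_out_eq C
    refine ⟨g⁻¹, ?_⟩
    rw [monodromyAt, monodromyAt, Option.elim, Option.elim, hg, ← hCq,
      ← MulAction.stabilizer_smul_eq_stabilizer_map_conj, inv_smul_smul]
    exact stabilizer_le_stabilizer_parent hC

/-- Each summand is at least 1. If a child `C` of `B` has a smaller stabilizer, its own summand
exceeds 1. If the stabilizers agree, all of `G_B` fixes `C`, which is not all of `B`; a child that
contains a point of `B` outside `C` then gives a second orbit. -/
theorem one_lt_sum_index {q : D.Orbit} (hq : ¬ (Quotient.out q : D.Ball).IsPoint) :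
    1 < ∑ᶠ w : {w : Option D.Orbit // D.trunkTree.Succ (some q) w},
      (Nat.card (D.monodromyAt (some q)) : ℚ) / Nat.card (D.monodromyAt w.1) := by
  classical
  have : Finite {w : Option D.Orbit // D.trunkTree.Succ (some q) w} :=
    have : Finite (Option D.Orbit) := inferInstance
    Subtype.finite
  have := Fintype.ofFinite {w : Option D.Orbit // D.trunkTree.Succ (some q) w}
  rw [finsum_eq_sum_of_fintype]
  set B : D.Ball := Quotient.out q with hBdef
  have hB : D.monodromyAt (some q) = MulAction.stabilizer G B := rfl
  have hone : ∀ w : {w : Option D.Orbit // D.trunkTree.Succ (some q) w},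
      (1 : ℚ) ≤ (Nat.card (D.monodromyAt (some q)) : ℚ) / Nat.card (D.monodromyAt w.1) := by
    intro w
    obtain ⟨g, hg⟩ := exists_map_conj_le w.2
    have h1 := Subgroup.card_le_of_le hg
    rw [← Nat.card_congr (Subgroup.equivMapOfInjective (D.monodromyAt w.1) _
      (MulAut.conj g).injective).toEquiv] at h1
    rw [le_div_iff₀ (by exact_mod_cast Nat.card_pos), one_mul]
    exact_mod_cast h1
  have hcardC : ∀ C : D.Ball, (Nat.card (D.monodromyAt (some C.orbit)) : ℚ) =
      Nat.card (MulAction.stabilizer G C) := fun C => by rw [card_monodromyAt_orbit]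
  obtain ⟨F, hF⟩ : ∃ F : {w : Option D.Orbit // D.trunkTree.Succ (some q) w} → ℚ, ∀ w, F w =
      (Nat.card (D.monodromyAt (some q)) : ℚ) / Nat.card (D.monodromyAt w.1) := ⟨_, fun _ => rfl⟩
  simp only [← hF] at hone ⊢
  obtain ⟨y, hy⟩ := B.nonempty
  obtain ⟨C, hyC, hC, hCB⟩ := Ball.exists_parent_eq hq hy
  have hsucc : ∀ {C : D.Ball}, C ≠ ⊤ → C.parent = B → D.trunkTree.Succ (some q) (some C.orbit) :=
    fun hC hCB => succ_iff.mpr ⟨by simp, par_eq_some_iff.mpr ⟨_, hC, rfl, hCB⟩⟩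
  let w₀ : {w : Option D.Orbit // D.trunkTree.Succ (some q) w} := ⟨some C.orbit, hsucc hC hCB⟩
  have hle : MulAction.stabilizer G C ≤ MulAction.stabilizer G B :=
    hCB ▸ stabilizer_le_stabilizer_parent hC
  by_cases hcard : MulAction.stabilizer G C = MulAction.stabilizer G B
  · obtain ⟨x, hxB, hxC⟩ : ∃ x ∈ B, x ∉ C := by
      by_contra! h
      exact (hCB ▸ Ball.lt_parent hC).not_ge h
    obtain ⟨C', hxC', hC', hCB'⟩ := Ball.exists_parent_eq hq hxB
    let w₁ : {w : Option D.Orbit // D.trunkTree.Succ (some q) w} := ⟨some C'.orbit, hsucc hC' hCB'⟩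
    have hne : w₀ ≠ w₁ := by
      intro h
      obtain ⟨g, hg⟩ := orbit_eq_iff.mp (Option.some_inj.mp (congrArg Subtype.val h)).symm
      have hgB : g ∈ MulAction.stabilizer G B := by
        rw [MulAction.mem_stabilizer_iff]
        conv_lhs => rw [← hCB, ← Ball.parent_smul g hC, hg, hCB']
      rw [← hcard, MulAction.mem_stabilizer_iff, hg] at hgB
      exact hxC (hgB ▸ hxC')
    calc (1 : ℚ) < 1 + 1 := by norm_num
      _ ≤ F w₀ + F w₁ := add_le_add (hone w₀) (hone w₁)
      _ = ∑ w ∈ {w₀, w₁}, F w := (Finset.sum_pair hne).symm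
      _ ≤ _ := Finset.sum_le_sum_of_subset_of_nonneg (Finset.subset_univ _)
        fun w _ _ => zero_le_one.trans (hone w)
  · have hlt : Nat.card (MulAction.stabilizer G C) < Nat.card (MulAction.stabilizer G B) := by
      refine (Subgroup.card_le_of_le hle).lt_of_ne fun h => hcard ?_
      exact Subgroup.eq_of_le_of_card_ge hle h.ge
    refine lt_of_lt_of_le ?_ (Finset.single_le_sum
      (fun w _ => zero_le_one.trans (hone w)) (Finset.mem_univ w₀))
    rw [hF w₀, hcardC C, hB, one_lt_div (by exact_mod_cast Nat.card_pos)]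
    exact_mod_cast hlt

end FixedPointDatum
end FixedPointDatum

/-! ### Depth at the leaves, and assembly of the Hurwitz tree -/

section FixedPointDatum

open scoped Pointwise

theorem sum_deltaMult {P : Type*} [Group P] [Fintype P] (p : ℕ) : ∑ σ : P, deltaMult p P σ = 0 :=
  sum_balanced _

/-- In a finite cyclic subgroup, the elements of `p`-power order form the Sylow `p`-subgroup. -/
theorem mem_sylow_map_iff {p : ℕ} [Fact p.Prime] {G : Type*} [Group G] [Finite G] (H : Subgroup G)
    (hH : IsCyclic H) (P : Sylow p H) {ρ : G} (hρ : ρ ∈ H) :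
    ρ ∈ (P : Subgroup H).map H.subtype ↔ ∃ k, orderOf ρ = p ^ k := by
  have hcomm : IsMulCommutative H := inferInstance
  have hord : orderOf (⟨ρ, hρ⟩ : H) = orderOf ρ := Subgroup.orderOf_mk ρ hρ
  have hmem : ρ ∈ (P : Subgroup H).map H.subtype ↔ (⟨ρ, hρ⟩ : H) ∈ (P : Subgroup H) := by
    constructor
    · rintro ⟨x, hx, rfl⟩
      exact hx
    · exact fun h => ⟨_, h, rfl⟩
  rw [hmem, ← hord]
  constructor
  · intro h
    obtain ⟨k, hk⟩ := (IsPGroup.iff_orderOf.mp P.isPGroup') ⟨_, h⟩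
    exact ⟨k, hk ▸ (Subgroup.orderOf_mk _ h).symm⟩
  · rintro ⟨k, hk⟩
    have hz : IsPGroup p (Subgroup.zpowers (⟨ρ, hρ⟩ : H)) :=
      IsPGroup.of_card (n := k) (by rw [Nat.card_zpowers, hk])
    obtain ⟨Q, hQ⟩ := hz.exists_le_sylow
    have hn : (P : Subgroup H).Normal := ⟨fun a ha g => by
      rwa [hcomm.is_comm.comm g a, mul_inv_cancel_right]⟩
    have := Sylow.unique_of_normal P hn
    have hQP : Q = P := Subsingleton.elim _ _
    rw [← hQP]
    exact hQ (Subgroup.mem_zpowers _)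

/-- With `|P| = p ^ (k + 1 + j)` the value of `δ^mult` is `-p ^ (j + 1) / (p - 1)`. Dividing by
`|P|` leaves `-1 / (p ^ k (p - 1))`, minus the valuation of `ζ - 1` for `ζ` of order `p ^ (k + 1)`.
-/
theorem inv_card_mul_deltaMult {p : ℕ} [hp : Fact p.Prime] {P : Type*} [Group P] [Finite P]
    (hP : IsPGroup p P) {x : P} {k : ℕ} (hx : orderOf x = p ^ (k + 1)) :
    (Nat.card P : ℂ)⁻¹ * deltaMult p P x = -((1 / (p ^ k * (p - 1)) : ℚ) : ℂ) := by
  obtain ⟨m, hm⟩ := IsPGroup.iff_card.mp hP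
  have hx1 : x ≠ 1 := by
    rintro rfl
    rw [orderOf_one] at hx
    exact (Nat.one_lt_pow (Nat.succ_ne_zero k) hp.out.one_lt).ne hx
  have hle : k + 1 ≤ m := by
    have := orderOf_dvd_natCard x
    rw [hx, hm] at this
    exact (Nat.pow_dvd_pow_iff_le_right hp.out.one_lt).mp this
  obtain ⟨j, rfl⟩ := Nat.exists_eq_add_of_le hle
  have hdiv : Nat.card P / orderOf x = p ^ j := by
    rw [hm, hx, pow_add, Nat.mul_div_cancel_left _ (pow_pos hp.out.pos _)]
  have hp0 : (p : ℂ) ≠ 0 := by exact_mod_cast hp.out.ne_zero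
  have hp1 : (p : ℂ) - 1 ≠ 0 := by
    rw [sub_ne_zero]; exact_mod_cast hp.out.one_lt.ne'
  rw [deltaMult, balanced_apply _ hx1, hdiv, padicValNat.prime_pow, hm]
  push_cast
  field_simp
  ring

namespace FixedPointDatum

open UltrametricAction

variable {p : ℕ} {G : Type*} [Group G] {Δ : Type} [Fintype Δ] [MulAction G Δ]
  {D : FixedPointDatum p G Δ} [Fintype G]

theorem stabilizer_eq_of_coe_eq {B : D.Ball} {y : Δ} (hB : (B : Set Δ) = {y}) :
    MulAction.stabilizer G B = MulAction.stabilizer G y := by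
  have hmem : ∀ z, z ∈ B ↔ z = y := fun z => by rw [← SetLike.mem_coe, hB]; rfl
  ext σ
  rw [MulAction.mem_stabilizer_iff, Ball.smul_eq_iff_of_mem ((hmem y).mpr rfl), hmem,
    MulAction.mem_stabilizer_iff]

/-- Compare the two sums over `τ` term by term. For `ρ` in the stabilizer, the excess is nonzero
only when `ρ` has `p`-power order, that is, when it lies in the Sylow subgroup, and there it is the
normalized value of `-δ^mult`. -/
theorem ballDepth_of_isPoint [Fact p.Prime] {B : D.Ball} (hB : B.IsPoint) {H : Subgroup G}
    (hH : H = MulAction.stabilizer G B) (P : Sylow p H) :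
    D.ballDepth B = induced ((P : Subgroup H).map H.subtype)
      (deltaMult p ((P : Subgroup H).map H.subtype)) := by
  classical
  obtain ⟨y, hBy⟩ := hB
  have hst : H = MulAction.stabilizer G y := hH.trans (stabilizer_eq_of_coe_eq hBy)
  have hcyc : IsCyclic H := hst ▸ D.isCyclic_stabilizer y
  set Q : Subgroup G := (P : Subgroup H).map H.subtype with hQ
  have hQp : IsPGroup p Q := P.isPGroup'.map _
  have hQH : Q ≤ H := Subgroup.map_subtype_le _
  refine ext_of_sum_eq_zero (sum_balanced _) (sum_induced _ _ (sum_deltaMult p)) fun σ hσ => ?_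
  rw [ballDepth, classSum, balanced_apply _ hσ, induced_apply, Finset.mul_sum, Rat.cast_sum,
    ← Finset.sum_neg_distrib, ← hH]
  refine Finset.sum_congr rfl fun τ _ => ?_
  have h1 := conj_ne_one hσ τ
  generalize τ⁻¹ * σ * τ = ρ at h1
  by_cases hρ : ρ ∈ H
  · have hy : ρ • y = y := by rw [hst] at hρ; exact hρ
    have hmem := mem_sylow_map_iff H hcyc P hρ
    rw [← hQ] at hmem
    rw [if_pos hρ, ← sum_erase_eq_excess hBy hy]
    by_cases hρQ : ρ ∈ Q
    · obtain ⟨k, hk⟩ := hmem.mp hρQ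
      obtain _ | k := k
      · rw [pow_zero, orderOf_eq_one_iff] at hk
        exact absurd hk h1
      · rw [dif_pos hρQ, D.v_add_sum_of_orderOf_eq ρ y k hy hk,
          inv_card_mul_deltaMult hQp (by rw [Subgroup.orderOf_mk, hk])]
    · rw [dif_neg hρQ, D.v_add_sum_of_orderOf_ne ρ y hy fun k hk => hρQ (hmem.mpr ⟨k, hk⟩)]
      simp
  · rw [if_neg hρ, dif_neg fun h => hρ (hQH h)]
    simp

variable [Nonempty Δ]

theorem exists_hurwitzTree [Fact p.Prime] (D : FixedPointDatum p G Δ) :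
    ∃ T : HurwitzTree G p,
      T.depth = balanced (fun σ => -((Nat.card G : ℂ) * (D.v σ : ℂ))) ∧
      T.artin = balanced (fun σ => -((fix σ : Finset Δ).card : ℂ)) := by
  classical
  have hartin : ∀ (e : D.trunkTree.Edge) (q : D.Orbit), e.tgt = some q →
      D.artinAt e.tgt = D.orbitArtin q := fun e q h => by rw [h]; rfl
  have hpoint : ∀ (q : D.Orbit), ¬ D.trunkTree.IsLeaf (some q) →
      ¬ (Quotient.out q : D.Ball).IsPoint := fun q h => isLeaf_iff.not.mp h
  let T : HurwitzTree G p :=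
    { toTrunkTree := D.trunkTree
      thickness := fun e => Option.elim (e.tgt : Option D.Orbit) 0 D.thicknessAt
      thickness_nonneg := fun e => by
        obtain ⟨q, hq, -⟩ := edge_exists e
        rw [hq]
        by_cases hp : (Quotient.out q : D.Ball).IsPoint
        · rw [Option.elim, thicknessAt, if_pos hp]
        · exact (thicknessAt_pos hp).le
      thickness_eq_zero_iff := fun e => by
        obtain ⟨q, hq, -⟩ := edge_exists e
        rw [hq, isLeaf_iff]
        by_cases hp : (Quotient.out q : D.Ball).IsPoint
        · rw [Option.elim, thicknessAt, if_pos hp]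
          exact iff_of_true rfl hp
        · exact iff_of_false (thicknessAt_pos hp).ne' hp
      monodromy := D.monodromyAt
      artinChar := fun e => D.artinAt e.tgt
      artinChar_mem := fun e => by
        obtain ⟨q, hq, -⟩ := edge_exists e
        rw [hq]
        exact orbitArtin_mem q
      depthChar := D.depthAt
      depthChar_mem := depthAt_mem
      monodromy_succ := fun v w => exists_map_conj_le
      one_lt_sum_index := fun v hv hl => by
        obtain ⟨q, rfl⟩ := Option.ne_none_iff_exists'.mp hv
        exact one_lt_sum_index (hpoint q hl)
      monodromy_root := rfl
      monodromy_root_succ := fun w hw => by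
        obtain ⟨h1, h2⟩ := succ_iff.mp hw
        obtain ⟨q, rfl⟩ := Option.ne_none_iff_exists'.mp h1
        have hq : q = (⊤ : D.Ball).orbit := by
          by_contra hne
          rw [← orbit_out q, par_orbit (out_eq_top_iff.not.mpr hne)] at h2
          exact absurd h2 (Option.some_ne_none _)
        rw [monodromyAt, Option.elim, out_eq_top_iff.mpr hq, stabilizer_top]
      monodromy_leaf := fun b hb => by
        have hne : b ≠ none := fun h => not_isLeaf_none (h ▸ hb)
        obtain ⟨q, rfl⟩ := Option.ne_none_iff_exists'.mp hne
        obtain ⟨y, hy⟩ := isLeaf_iff.mp hb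
        rw [monodromyAt, Option.elim, stabilizer_eq_of_coe_eq hy]
        exact ⟨D.stabilizer_ne_bot y, D.isCyclic_stabilizer y⟩
      artinChar_eq_sum := fun e he => by
        obtain ⟨q, hq, -⟩ := edge_exists e
        rw [hq] at he ⊢
        have : Finite D.trunkTree.Edge :=
          have := D.trunkTree.finite_V
          Finite.of_injective (fun e : D.trunkTree.Edge => e.tgt) fun _ _ h => edge_ext h
        have := Fintype.ofFinite {e : D.trunkTree.Edge // e.src = some q}
        rw [finsum_eq_sum_of_fintype]
        exact orbitArtin_eq_sum (hpoint q he)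
      artinChar_leaf := fun e he => by
        obtain ⟨q, hq, -⟩ := edge_exists e
        rw [hq] at he ⊢
        have := orbitArtin_of_isPoint (isLeaf_iff.mp he)
        rw [orbit_out] at this
        exact this
      depthChar_tgt := fun e => by
        obtain ⟨q, hq, hsrc⟩ := edge_exists e
        rw [hq, hsrc]
        exact depthAt_eq_add q
      depthChar_leaf := fun b hb P => by
        have hne : b ≠ none := fun h => not_isLeaf_none (h ▸ hb)
        obtain ⟨q, rfl⟩ := Option.ne_none_iff_exists'.mp hne
        exact ballDepth_of_isPoint (isLeaf_iff.mp hb) rfl P }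
  refine ⟨T, ?_, ?_⟩
  · refine ext_of_sum_eq_zero (sum_balanced _) (sum_balanced _) fun σ hσ => ?_
    change classSum ⊤ D.v σ = _
    rw [classSum, balanced_apply _ hσ, balanced_apply _ hσ]
    -- As `v` is a class function, its sum over conjugates is `|G| v(σ)`; this is the factor `|G|`
    -- in the depth character.
    have : ∀ τ : G, D.v (τ⁻¹ * σ * τ) = D.v σ := fun τ => by
      simpa using D.v_conj σ τ⁻¹
    simp [this]
  · have htgt : T.trunk.tgt = some (⊤ : D.Ball).orbit := by
      obtain ⟨q, hq, hsrc⟩ := edge_exists (T.trunk : D.trunkTree.Edge)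
      have h2 : D.par (some q) = none := hsrc.symm
      have hq' : q = (⊤ : D.Ball).orbit := by
        by_contra hne
        rw [← orbit_out q, par_orbit (out_eq_top_iff.not.mpr hne)] at h2
        exact absurd h2 (Option.some_ne_none _)
      rw [← hq']
      exact hq
    have : T.artin = D.orbitArtin (⊤ : D.Ball).orbit := hartin _ _ htgt
    rw [this, orbitArtin]
    congr 1
    ext σ
    congr 3
    refine Finset.filter_true_of_mem fun z _ => ?_
    rw [mem_cover_orbit]
    exact ⟨1, by rw [one_smul]; exact Ball.mem_top z⟩

end FixedPointDatum
end FixedPointDatum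

/-! ### Analytic functions on the open disk -/

section DiskFunctions

open Filter Topology

variable {K : Type*} [NontriviallyNormedField K] [IsUltrametricDist K]

theorem norm_sub_le_max_of_ultrametric {E : Type*} [SeminormedAddCommGroup E] [IsUltrametricDist E]
    (x y : E) : ‖x - y‖ ≤ max ‖x‖ ‖y‖ := by
  rw [sub_eq_add_neg, ← norm_neg y]
  exact IsUltrametricDist.norm_add_le_max _ _

theorem mem_integerRing_iff {x : K} : x ∈ integerRing K ↔ ‖x‖ ≤ 1 := by
  rw [Valuation.mem_valuationSubring_iff, NormedField.valuation_apply, ← NNReal.coe_le_coe]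
  rfl

theorem norm_coe_integerRing_le (x : integerRing K) : ‖(x : K)‖ ≤ 1 := mem_integerRing_iff.mp x.2

theorem isUnit_integerRing_iff {x : integerRing K} : IsUnit x ↔ ‖(x : K)‖ = 1 := by
  constructor
  · rintro ⟨u, rfl⟩
    have h : ‖((u : integerRing K) : K)‖ * ‖((u⁻¹ : (integerRing K)ˣ) : K)‖ = 1 := by
      rw [← norm_mul, ← MulMemClass.coe_mul, Units.mul_inv, OneMemClass.coe_one, norm_one]
    nlinarith [norm_coe_integerRing_le (u : integerRing K), norm_nonneg ((u : integerRing K) : K),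
      norm_coe_integerRing_le ((u⁻¹ : (integerRing K)ˣ) : integerRing K)]
  · intro h
    have h0 : (x : K) ≠ 0 := norm_ne_zero_iff.mp (by rw [h]; exact one_ne_zero)
    refine IsUnit.of_mul_eq_one ⟨(x : K)⁻¹, mem_integerRing_iff.mpr (by simp [h])⟩ ?_
    exact Subtype.ext (mul_inv_cancel₀ h0)

/-- Power series whose coefficients lie in the valuation ring. -/
def IsIntegralSeries (f : PowerSeries K) : Prop := ∀ i, ‖PowerSeries.coeff i f‖ ≤ 1

theorem isIntegralSeries_map (f : PowerSeries (integerRing K)) :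
    IsIntegralSeries (f.map (algebraMap (integerRing K) K)) := fun i => by
  rw [PowerSeries.coeff_map]
  exact norm_coe_integerRing_le _

theorem IsIntegralSeries.exists_map_eq {f : PowerSeries K} (hf : IsIntegralSeries f) :
    ∃ g : PowerSeries (integerRing K), g.map (algebraMap (integerRing K) K) = f := by
  refine ⟨PowerSeries.mk fun i => ⟨PowerSeries.coeff i f, mem_integerRing_iff.mpr (hf i)⟩, ?_⟩
  ext i
  rw [PowerSeries.coeff_map, PowerSeries.coeff_mk]
  rfl

theorem IsIntegralSeries.mul {f g : PowerSeries K} (hf : IsIntegralSeries f)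
    (hg : IsIntegralSeries g) : IsIntegralSeries (f * g) := by
  obtain ⟨f, rfl⟩ := hf.exists_map_eq
  obtain ⟨g, rfl⟩ := hg.exists_map_eq
  rw [← map_mul]
  exact isIntegralSeries_map _

theorem IsIntegralSeries.add {f g : PowerSeries K} (hf : IsIntegralSeries f)
    (hg : IsIntegralSeries g) : IsIntegralSeries (f + g) := by
  obtain ⟨f, rfl⟩ := hf.exists_map_eq
  obtain ⟨g, rfl⟩ := hg.exists_map_eq
  rw [← map_add]
  exact isIntegralSeries_map _

theorem IsIntegralSeries.sub {f g : PowerSeries K} (hf : IsIntegralSeries f)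
    (hg : IsIntegralSeries g) : IsIntegralSeries (f - g) := by
  obtain ⟨f, rfl⟩ := hf.exists_map_eq
  obtain ⟨g, rfl⟩ := hg.exists_map_eq
  rw [← map_sub]
  exact isIntegralSeries_map _

theorem isIntegralSeries_C {a : K} (ha : ‖a‖ ≤ 1) : IsIntegralSeries (PowerSeries.C a) := fun i => by
  rw [PowerSeries.coeff_C]
  split_ifs
  · exact ha
  · simp

theorem isIntegralSeries_one : IsIntegralSeries (1 : PowerSeries K) := by
  have := isIntegralSeries_C (K := K) (a := 1) (by simp)
  rwa [map_one] at this

theorem isIntegralSeries_X : IsIntegralSeries (PowerSeries.X : PowerSeries K) := fun i => by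
  rw [PowerSeries.coeff_X]
  split_ifs <;> simp

theorem IsIntegralSeries.exists_mul_eq_one {f : PowerSeries K} (hf : IsIntegralSeries f)
    (h0 : ‖PowerSeries.coeff 0 f‖ = 1) : ∃ g, IsIntegralSeries g ∧ f * g = 1 := by
  obtain ⟨f, rfl⟩ := hf.exists_map_eq
  have hu : IsUnit f := by
    rw [PowerSeries.isUnit_iff_constantCoeff, isUnit_integerRing_iff]
    rwa [PowerSeries.coeff_map, PowerSeries.coeff_zero_eq_constantCoeff_apply] at h0
  obtain ⟨g, hg⟩ := hu.exists_right_inv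
  exact ⟨_, isIntegralSeries_map g, by rw [← map_mul, hg, map_one]⟩

theorem mem_diskFunctions_iff {f : PowerSeries K} : f ∈ diskFunctions K ↔
    ∀ c : ℝ, 0 < c → c < 1 → Tendsto (fun i => ‖PowerSeries.coeff i f‖ * c ^ i) atTop (𝓝 0) :=
  forall₃_congr fun c _ _ => PowerSeries.isRestricted_iff' c f

theorem IsIntegralSeries.mem_diskFunctions {f : PowerSeries K} (hf : IsIntegralSeries f) :
    f ∈ diskFunctions K := by
  rw [mem_diskFunctions_iff]
  intro c h0 h1
  refine squeeze_zero (fun i => by positivity) (fun i => ?_)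
    (tendsto_pow_atTop_nhds_zero_of_lt_one h0.le h1)
  exact mul_le_of_le_one_left (by positivity) (hf i)

theorem IsIntegralSeries.exists_disk_mul_eq_one {f : diskFunctions K}
    (hf : IsIntegralSeries (f : PowerSeries K)) (h0 : ‖PowerSeries.coeff 0 (f : PowerSeries K)‖ = 1) :
    ∃ g : diskFunctions K, IsIntegralSeries (g : PowerSeries K) ∧ f * g = 1 := by
  obtain ⟨g, hg, hfg⟩ := hf.exists_mul_eq_one h0
  exact ⟨⟨g, hg.mem_diskFunctions⟩, hg, Subtype.ext hfg⟩

theorem exists_last_max {a : ℕ → ℝ} (ha : Tendsto a atTop (𝓝 0)) (h0 : 0 < a 0) :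
    ∃ i, (∀ j, a j ≤ a i) ∧ ∀ j, i < j → a j < a i := by
  have hfin : {j | a 0 ≤ a j}.Finite := by
    obtain ⟨N, hN⟩ := eventually_atTop.mp (ha.eventually (gt_mem_nhds h0))
    refine (Set.finite_lt_nat N).subset fun j (hj : a 0 ≤ a j) => ?_
    by_contra h
    exact (hN j (not_lt.mp h)).not_ge hj
  obtain ⟨i, hi, hmax⟩ := hfin.toFinset.exists_max_image (fun j => toLex (a j, j))
    ⟨0, by simp⟩
  rw [Set.Finite.mem_toFinset] at hi
  have hi' : a 0 ≤ a i := hi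
  have key : ∀ j, a 0 ≤ a j → a j < a i ∨ a j = a i ∧ j ≤ i := fun j hj => by
    have := hmax j (by rw [Set.Finite.mem_toFinset]; exact hj)
    rwa [Prod.Lex.toLex_le_toLex] at this
  refine ⟨i, fun j => ?_, fun j hj => ?_⟩
  · by_cases h : a 0 ≤ a j
    · exact (key j h).elim le_of_lt fun h => h.1.le
    · exact (not_le.mp h).le.trans hi'
  · by_cases h : a 0 ≤ a j
    · exact (key j h).elim id fun h => absurd h.2 hj.not_ge
    · exact (not_le.mp h).trans_le hi'

/-- A unit on a disk is dominated by its constant term. -/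
theorem norm_coeff_mul_pow_le_of_mul_eq_one {f g : PowerSeries K} (h : f * g = 1) {c : ℝ}
    (hc : 0 < c) (hf : Tendsto (fun i => ‖PowerSeries.coeff i f‖ * c ^ i) atTop (𝓝 0))
    (hg : Tendsto (fun i => ‖PowerSeries.coeff i g‖ * c ^ i) atTop (𝓝 0)) (i : ℕ) :
    ‖PowerSeries.coeff i f‖ * c ^ i ≤ ‖PowerSeries.coeff 0 f‖ := by
  have h00 : PowerSeries.coeff 0 f * PowerSeries.coeff 0 g = 1 := by
    simpa using congrArg (PowerSeries.coeff 0) h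
  have hf0 : 0 < ‖PowerSeries.coeff 0 f‖ * c ^ 0 := by
    rw [pow_zero, mul_one]; exact norm_pos_iff.mpr (left_ne_zero_of_mul_eq_one h00)
  have hg0 : 0 < ‖PowerSeries.coeff 0 g‖ * c ^ 0 := by
    rw [pow_zero, mul_one]; exact norm_pos_iff.mpr (right_ne_zero_of_mul_eq_one h00)
  obtain ⟨m, hm, hm'⟩ := exists_last_max hf hf0
  obtain ⟨n, hn, hn'⟩ := exists_last_max hg hg0
  have hpos : 0 < ‖PowerSeries.coeff m f‖ * c ^ m * (‖PowerSeries.coeff n g‖ * c ^ n) :=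
    mul_pos (hf0.trans_le (hm 0)) (hg0.trans_le (hn 0))
  -- Here `m` and `n` are the last indices at which the terms of `f` and `g` are maximal on the
  -- circle of radius `c`. One product then dominates strictly in the coefficient of index `m + n`,
  -- so that coefficient of `1` is nonzero and `m = n = 0`.
  have key : ‖PowerSeries.coeff (m + n) (f * g)‖ =
      ‖PowerSeries.coeff m f * PowerSeries.coeff n g‖ := by
    rw [PowerSeries.coeff_mul]
    refine IsNonarchimedean.apply_sum_eq_of_lt
      (l := fun x : ℕ × ℕ => PowerSeries.coeff x.1 f * PowerSeries.coeff x.2 g) (k := (m, n))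
      (s := Finset.HasAntidiagonal.antidiagonal (m + n))
      IsUltrametricDist.isNonarchimedean_norm (fun x : K => (norm_neg x).symm)
      (Finset.HasAntidiagonal.mem_antidiagonal.mpr rfl) ?_
    rintro ⟨a, b⟩ hab hne
    rw [Finset.HasAntidiagonal.mem_antidiagonal] at hab
    simp only at hab ⊢
    have hcab : c ^ a * c ^ b = c ^ m * c ^ n := by rw [← pow_add, ← pow_add, hab]
    refine lt_of_mul_lt_mul_right (a := c ^ m * c ^ n) ?_ (by positivity)
    rw [norm_mul, norm_mul]
    have h1 : ‖PowerSeries.coeff a f‖ * c ^ a * (‖PowerSeries.coeff b g‖ * c ^ b) <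
        ‖PowerSeries.coeff m f‖ * c ^ m * (‖PowerSeries.coeff n g‖ * c ^ n) := by
      have hb0 : 0 ≤ ‖PowerSeries.coeff b g‖ * c ^ b := by positivity
      have ha0 : 0 ≤ ‖PowerSeries.coeff a f‖ * c ^ a := by positivity
      have hmpos := hf0.trans_le (hm 0)
      have hnpos := hg0.trans_le (hn 0)
      rcases lt_trichotomy a m with hlt | rfl | hlt
      · have hb : n < b := by omega
        exact (mul_le_mul_of_nonneg_right (hm a) hb0).trans_lt
          (mul_lt_mul_of_pos_left (hn' b hb) hmpos)
      · exact absurd (by rw [show b = n by omega]) hne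
      · exact (mul_le_mul_of_nonneg_left (hn b) ha0).trans_lt
          (mul_lt_mul_of_pos_right (hm' a hlt) hnpos)
    calc _ = ‖PowerSeries.coeff a f‖ * c ^ a * (‖PowerSeries.coeff b g‖ * c ^ b) := by
          rw [← hcab]; ring
      _ < _ := h1
      _ = _ := by ring
  have hmn : m = 0 := by
    by_contra hm0
    rw [h, PowerSeries.coeff_one, if_neg (by omega), norm_zero, norm_mul] at key
    have : ‖PowerSeries.coeff m f‖ * c ^ m * (‖PowerSeries.coeff n g‖ * c ^ n) = 0 := by
      calc _ = ‖PowerSeries.coeff m f‖ * ‖PowerSeries.coeff n g‖ * (c ^ m * c ^ n) := by ring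
        _ = 0 := by rw [← key, zero_mul]
    exact hpos.ne' this
  subst hmn
  simpa using hm i

theorem norm_coeff_le_of_isUnit {f : diskFunctions K} (hf : IsUnit f) (i : ℕ) :
    ‖PowerSeries.coeff i (f : PowerSeries K)‖ ≤ ‖PowerSeries.coeff 0 (f : PowerSeries K)‖ := by
  obtain ⟨g, hg⟩ := hf.exists_right_inv
  have key : ∀ c : ℝ, 0 < c → c < 1 → ‖PowerSeries.coeff i (f : PowerSeries K)‖ * c ^ i ≤
      ‖PowerSeries.coeff 0 (f : PowerSeries K)‖ := fun c h0 h1 =>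
    norm_coeff_mul_pow_le_of_mul_eq_one (congrArg Subtype.val hg) h0
      (mem_diskFunctions_iff.mp f.2 c h0 h1) (mem_diskFunctions_iff.mp g.2 c h0 h1) i
  have hlim : Tendsto (fun c : ℝ => ‖PowerSeries.coeff i (f : PowerSeries K)‖ * c ^ i) (𝓝[<] 1)
      (𝓝 (‖PowerSeries.coeff i (f : PowerSeries K)‖ * 1 ^ i)) :=
    ((continuous_const.mul (continuous_pow i)).tendsto 1).mono_left nhdsWithin_le_nhds
  rw [one_pow, mul_one] at hlim
  refine le_of_tendsto hlim ?_
  filter_upwards [Ioo_mem_nhdsLT (zero_lt_one (α := ℝ))] with c hc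
  exact key c hc.1 hc.2

variable (σ : diskFunctions K →ₐ[K] diskFunctions K)

/-- Units are preserved by any algebra homomorphism, so no continuity is needed: for `|a| ≤ 1` the
function `1 - a f` is a unit, hence so is `1 - a σ(f)`, and a unit is dominated by its constant
term. -/
theorem isIntegralSeries_hom_of_lt {f : diskFunctions K} (hf : IsIntegralSeries (f : PowerSeries K))
    (h0 : ‖PowerSeries.coeff 0 (f : PowerSeries K)‖ < 1) :
    IsIntegralSeries (σ f : PowerSeries K) ∧
      ‖PowerSeries.coeff 0 (σ f : PowerSeries K)‖ < 1 := by
  have key : ∀ a : K, ‖a‖ ≤ 1 → IsUnit (1 - a • σ f) := by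
    intro a ha
    have h1 : IsIntegralSeries ((1 - a • f : diskFunctions K) : PowerSeries K) := by
      have : ((1 - a • f : diskFunctions K) : PowerSeries K) =
          1 - PowerSeries.C a * (f : PowerSeries K) := by
        rw [← PowerSeries.smul_eq_C_mul]; rfl
      rw [this]
      exact isIntegralSeries_one.sub ((isIntegralSeries_C ha).mul hf)
    have h2 : ‖PowerSeries.coeff 0 ((1 - a • f : diskFunctions K) : PowerSeries K)‖ = 1 := by
      have h3 : PowerSeries.coeff 0 ((1 - a • f : diskFunctions K) : PowerSeries K) =
          1 - a * PowerSeries.coeff 0 (f : PowerSeries K) := by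
        change PowerSeries.coeff 0 (1 - a • (f : PowerSeries K)) = _
        simp
      have h4 : ‖a * PowerSeries.coeff 0 (f : PowerSeries K)‖ < 1 := by
        rw [norm_mul]
        exact (mul_le_of_le_one_left (norm_nonneg _) ha).trans_lt h0
      rw [h3, sub_eq_add_neg, add_comm, IsUltrametricDist.norm_add_eq_max_of_norm_ne_norm, norm_neg,
        norm_one, max_eq_right h4.le]
      rw [norm_neg, norm_one]
      exact h4.ne
    obtain ⟨g, -, hg⟩ := h1.exists_disk_mul_eq_one h2
    have := (IsUnit.of_mul_eq_one g hg).map σ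
    rwa [map_sub, map_one, map_smul] at this
  have hcoeff : ∀ (a : K) (i : ℕ), PowerSeries.coeff i ((1 - a • σ f : diskFunctions K) :
      PowerSeries K) = (if i = 0 then 1 else 0) - a * PowerSeries.coeff i (σ f : PowerSeries K) := by
    intro a i
    change PowerSeries.coeff i (1 - a • (σ f : PowerSeries K)) = _
    simp [PowerSeries.coeff_one]
  have h1 : ‖PowerSeries.coeff 0 (σ f : PowerSeries K)‖ < 1 := by
    by_contra h
    rw [not_lt] at h
    have hne : PowerSeries.coeff 0 (σ f : PowerSeries K) ≠ 0 :=
      norm_pos_iff.mp (zero_lt_one.trans_le h)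
    -- This choice of `a` cancels the constant term, so the unit `1 - a σ(f)` would be zero.
    have hu := key (PowerSeries.coeff 0 (σ f : PowerSeries K))⁻¹
      (by rw [norm_inv]; exact inv_le_one_of_one_le₀ h)
    have hz : ((1 - (PowerSeries.coeff 0 (σ f : PowerSeries K))⁻¹ • σ f : diskFunctions K) :
        PowerSeries K) = 0 := by
      ext i
      have := norm_coeff_le_of_isUnit hu i
      rw [hcoeff _ 0, if_pos rfl, inv_mul_cancel₀ hne, sub_self, norm_zero, norm_le_zero_iff] at this
      rw [this, map_zero]
    have hz' : (1 - (PowerSeries.coeff 0 (σ f : PowerSeries K))⁻¹ • σ f : diskFunctions K) = 0 :=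
      Subtype.ext hz
    rw [hz'] at hu
    exact not_isUnit_zero hu
  refine ⟨fun i => ?_, h1⟩
  by_cases hi : i = 0
  · rw [hi]; exact h1.le
  · have := norm_coeff_le_of_isUnit (key 1 (by simp)) i
    rw [hcoeff, hcoeff, if_neg hi, if_pos rfl, zero_sub, one_mul, one_mul, norm_neg] at this
    exact this.trans ((norm_sub_le_max_of_ultrametric _ _).trans (by rw [norm_one]; exact max_le le_rfl h1.le))

theorem isIntegralSeries_hom {f : diskFunctions K} (hf : IsIntegralSeries (f : PowerSeries K)) :
    IsIntegralSeries (σ f : PowerSeries K) := by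
  set a := PowerSeries.coeff 0 (f : PowerSeries K) with ha
  have hcoe : ∀ g : diskFunctions K, ((g - algebraMap K _ a : diskFunctions K) : PowerSeries K) =
      g - PowerSeries.C a := fun g => rfl
  have h1 := isIntegralSeries_hom_of_lt σ (f := f - algebraMap K _ a)
    (by rw [hcoe]; exact hf.sub (isIntegralSeries_C (hf 0)))
    (by rw [hcoe, map_sub, ← ha]; simp)
  rw [map_sub, AlgHom.commutes, hcoe] at h1
  have := h1.1.add (isIntegralSeries_C (hf 0))
  rwa [sub_add_cancel] at this

theorem coe_coordinate : ((coordinate : diskFunctions K) : PowerSeries K) = PowerSeries.X := rfl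

theorem coe_aeval_coordinate (P : Polynomial K) :
    ((Polynomial.aeval (coordinate : diskFunctions K) P : diskFunctions K) : PowerSeries K) =
      (P : PowerSeries K) := by
  have h1 : ((Polynomial.aeval (coordinate : diskFunctions K) P : diskFunctions K) :
      PowerSeries K) = Polynomial.aeval (PowerSeries.X : PowerSeries K) P :=
    (Polynomial.aeval_algHom_apply (diskFunctions K).val coordinate P).symm
  have h2 := Polynomial.aeval_algHom_apply (Polynomial.coeToPowerSeries.algHom K (R := K))
    Polynomial.X P
  rw [Polynomial.aeval_X_left_apply] at h2
  rw [h1]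
  simpa using h2

/-- The decomposition of an analytic function into a polynomial and a multiple of `z ^ n`. -/
theorem exists_eq_trunc_add (f : diskFunctions K) (n : ℕ) :
    ∃ g : diskFunctions K, f = Polynomial.aeval coordinate (PowerSeries.trunc n (f : PowerSeries K)) +
      coordinate ^ n * g ∧ ∀ i, PowerSeries.coeff i (g : PowerSeries K) =
        PowerSeries.coeff (i + n) (f : PowerSeries K) := by
  have hmem : (PowerSeries.mk fun i => PowerSeries.coeff (i + n) (f : PowerSeries K)) ∈
      diskFunctions K := by
    rw [mem_diskFunctions_iff]
    intro c h0 h1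
    have h := ((tendsto_add_atTop_iff_nat n).mpr (mem_diskFunctions_iff.mp f.2 c h0 h1)).mul_const
      (c ^ n)⁻¹
    rw [zero_mul] at h
    refine h.congr fun i => ?_
    rw [PowerSeries.coeff_mk, pow_add]
    field_simp
  refine ⟨⟨_, hmem⟩, Subtype.ext ?_, fun i => PowerSeries.coeff_mk i
    fun i => PowerSeries.coeff (i + n) (f : PowerSeries K)⟩
  change _ = ((Polynomial.aeval coordinate (PowerSeries.trunc n (f : PowerSeries K)) :
    diskFunctions K) : PowerSeries K) + PowerSeries.X ^ n *
    PowerSeries.mk fun i => PowerSeries.coeff (i + n) (f : PowerSeries K)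
  rw [coe_aeval_coordinate]
  rw [add_comm]
  exact PowerSeries.eq_X_pow_mul_shift_add_trunc n _

/-- A homomorphism of the algebra of analytic functions that fixes the coordinate is the
identity. -/
theorem hom_eq_self_of_coordinate (h : σ coordinate = coordinate) (f : diskFunctions K) :
    σ f = f := by
  apply Subtype.ext
  ext i
  -- Modulo `z ^ (i + 1)` the function is a polynomial in the coordinate, and `σ` preserves the
  -- multiples of `z ^ (i + 1)`.
  obtain ⟨g, hg, -⟩ := exists_eq_trunc_add f (i + 1)
  have h0 : σ f = Polynomial.aeval coordinate (PowerSeries.trunc (i + 1) (f : PowerSeries K)) +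
      coordinate ^ (i + 1) * σ g := by
    conv_lhs => rw [hg]
    rw [map_add, map_mul, map_pow, ← Polynomial.aeval_algHom_apply, h]
  have h1 : σ f = f + coordinate ^ (i + 1) * (σ g - g) := by
    rw [h0, eq_sub_of_add_eq hg.symm]
    ring
  have h2 : PowerSeries.coeff i (PowerSeries.X ^ (i + 1) * ((σ g - g : diskFunctions K) :
      PowerSeries K)) = 0 := by
    rw [PowerSeries.coeff_X_pow_mul', if_neg (by omega)]
  have h3 := congrArg (fun F : diskFunctions K => PowerSeries.coeff i (F : PowerSeries K)) h1
  have h4 : PowerSeries.coeff i (σ f : PowerSeries K) = PowerSeries.coeff i (f : PowerSeries K) +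
      PowerSeries.coeff i (PowerSeries.X ^ (i + 1) * ((σ g - g : diskFunctions K) :
      PowerSeries K)) := h3
  rw [h4, h2, add_zero]

end DiskFunctions

/-! ### Evaluation at the points of an extension -/

section Evaluation

open Filter Topology

variable {K : Type*} [NontriviallyNormedField K] [IsUltrametricDist K]
variable {L : Type*} [NormedField L] [NormedAlgebra K L] [IsUltrametricDist L] [CompleteSpace L]

theorem summable_norm_smul_pow (f : diskFunctions K) {x : L} (hx : ‖x‖ < 1) :
    Summable fun i => ‖PowerSeries.coeff i (f : PowerSeries K) • x ^ i‖ := by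
  obtain ⟨c, hxc, hc1⟩ := exists_between hx
  have hc0 : 0 < c := (norm_nonneg x).trans_lt hxc
  obtain ⟨B, hB⟩ := (mem_diskFunctions_iff.mp f.2 c hc0 hc1).bddAbove_range
  refine Summable.of_nonneg_of_le (fun i => norm_nonneg _) (fun i => ?_)
    ((summable_geometric_of_lt_one (r := ‖x‖ / c) (by positivity)
      ((div_lt_one hc0).mpr hxc)).mul_left B)
  rw [norm_smul, norm_pow]
  calc ‖PowerSeries.coeff i (f : PowerSeries K)‖ * ‖x‖ ^ i
      = ‖PowerSeries.coeff i (f : PowerSeries K)‖ * c ^ i * (‖x‖ / c) ^ i := by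
        rw [div_pow]; field_simp
    _ ≤ B * (‖x‖ / c) ^ i := by
        refine mul_le_mul_of_nonneg_right (hB ⟨i, rfl⟩) (by positivity)

theorem summable_smul_pow (f : diskFunctions K) {x : L} (hx : ‖x‖ < 1) :
    Summable fun i => PowerSeries.coeff i (f : PowerSeries K) • x ^ i :=
  (summable_norm_smul_pow f hx).of_norm

theorem tsum_add_smul_pow (f g : diskFunctions K) {x : L} (hx : ‖x‖ < 1) :
    ∑' i, PowerSeries.coeff i ((f + g : diskFunctions K) : PowerSeries K) • x ^ i =
      ∑' i, PowerSeries.coeff i (f : PowerSeries K) • x ^ i +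
      ∑' i, PowerSeries.coeff i (g : PowerSeries K) • x ^ i := by
  rw [← (summable_smul_pow f hx).tsum_add (summable_smul_pow g hx)]
  refine tsum_congr fun i => ?_
  rw [← add_smul, ← map_add]
  rfl

theorem tsum_smul_smul_pow (a : K) (f : diskFunctions K) {x : L} (hx : ‖x‖ < 1) :
    ∑' i, PowerSeries.coeff i ((a • f : diskFunctions K) : PowerSeries K) • x ^ i =
      a • ∑' i, PowerSeries.coeff i (f : PowerSeries K) • x ^ i := by
  rw [← (summable_smul_pow f hx).tsum_const_smul a]
  refine tsum_congr fun i => ?_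
  rw [smul_smul]
  rfl

theorem coeff_coe_mul (f g : diskFunctions K) (n : ℕ) :
    PowerSeries.coeff n ((f * g : diskFunctions K) : PowerSeries K) =
      ∑ i ∈ Finset.range (n + 1), PowerSeries.coeff i (f : PowerSeries K) *
        PowerSeries.coeff (n - i) (g : PowerSeries K) := by
  have h : ((f * g : diskFunctions K) : PowerSeries K) = (f : PowerSeries K) * (g : PowerSeries K) :=
    rfl
  rw [h, PowerSeries.coeff_mul]
  exact Finset.Nat.sum_antidiagonal_eq_sum_range_succ_mk _ n

theorem tsum_mul_smul_pow (f g : diskFunctions K) {x : L} (hx : ‖x‖ < 1) :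
    ∑' i, PowerSeries.coeff i ((f * g : diskFunctions K) : PowerSeries K) • x ^ i =
      (∑' i, PowerSeries.coeff i (f : PowerSeries K) • x ^ i) *
      ∑' i, PowerSeries.coeff i (g : PowerSeries K) • x ^ i := by
  have hmul := tsum_mul_tsum_eq_tsum_sum_range_of_summable_norm (R := L)
    (f := fun i => PowerSeries.coeff i (f : PowerSeries K) • x ^ i)
    (g := fun i => PowerSeries.coeff i (g : PowerSeries K) • x ^ i)
    (summable_norm_smul_pow f hx) (summable_norm_smul_pow g hx)
  refine Eq.trans (tsum_congr fun n => ?_) hmul.symm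
  rw [coeff_coe_mul, Finset.sum_smul]
  refine Finset.sum_congr rfl fun i hi => ?_
  have hi' : x ^ n = x ^ i * x ^ (n - i) := by
    rw [← pow_add, Nat.add_sub_cancel' (Nat.lt_succ_iff.mp (Finset.mem_range.mp hi))]
  rw [hi', Algebra.smul_def, Algebra.smul_def, Algebra.smul_def, map_mul]
  ring

/-- Evaluation of analytic functions at a point of the disk with values in a complete extension. -/
def evalAt (x : L) (hx : ‖x‖ < 1) : diskFunctions K →ₐ[K] L :=
  AlgHom.ofLinearMap
    { toFun := fun f => ∑' i, PowerSeries.coeff i (f : PowerSeries K) • x ^ i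
      map_add' := fun f g => tsum_add_smul_pow f g hx
      map_smul' := fun a f => tsum_smul_smul_pow a f hx }
    (by
      change ∑' i, PowerSeries.coeff i (1 : PowerSeries K) • x ^ i = 1
      rw [tsum_eq_single 0 fun i hi => by rw [PowerSeries.coeff_one, if_neg hi, zero_smul]]
      simp)
    (fun f g => tsum_mul_smul_pow f g hx)

theorem evalAt_apply (x : L) (hx : ‖x‖ < 1) (f : diskFunctions K) :
    evalAt x hx f = ∑' i, PowerSeries.coeff i (f : PowerSeries K) • x ^ i := rfl

theorem hasSum_evalAt (x : L) (hx : ‖x‖ < 1) (f : diskFunctions K) :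
    HasSum (fun i => PowerSeries.coeff i (f : PowerSeries K) • x ^ i) (evalAt x hx f) :=
  (summable_norm_smul_pow f hx).of_norm.hasSum

theorem norm_le_of_hasSum {u : ℕ → L} {s : L} (hs : HasSum u s) {B : ℝ} (hB : 0 ≤ B)
    (hu : ∀ i, ‖u i‖ ≤ B) : ‖s‖ ≤ B := by
  refine le_of_tendsto hs.norm (Eventually.of_forall fun F => ?_)
  exact IsUltrametricDist.norm_sum_le_of_forall_le_of_nonneg hB fun i _ => hu i

theorem evalAt_coordinate (x : L) (hx : ‖x‖ < 1) :
    evalAt x hx (coordinate : diskFunctions K) = x := by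
  rw [evalAt_apply, coe_coordinate, tsum_eq_single 1 fun i hi => by
    rw [PowerSeries.coeff_X, if_neg hi, zero_smul]]
  simp

theorem norm_evalAt_le {f : diskFunctions K} {x : L} (hx : ‖x‖ < 1)
    (hf : IsIntegralSeries (f : PowerSeries K)) : ‖evalAt x hx f‖ ≤ 1 := by
  refine norm_le_of_hasSum (hasSum_evalAt x hx f) zero_le_one fun i => ?_
  rw [norm_smul, norm_pow]
  exact mul_le_one₀ (hf i) (by positivity) (pow_le_one₀ (norm_nonneg _) hx.le)

theorem norm_evalAt_lt {f : diskFunctions K} {x : L} (hx : ‖x‖ < 1)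
    (hf : IsIntegralSeries (f : PowerSeries K))
    (h0 : ‖PowerSeries.coeff 0 (f : PowerSeries K)‖ < 1) : ‖evalAt x hx f‖ < 1 := by
  have : ‖evalAt x hx f‖ ≤ max ‖PowerSeries.coeff 0 (f : PowerSeries K)‖ ‖x‖ := by
    refine norm_le_of_hasSum (hasSum_evalAt x hx f) (le_max_of_le_right (norm_nonneg _)) fun i => ?_
    rw [norm_smul, norm_pow]
    rcases i with _ | i
    · simp
    · refine (mul_le_of_le_one_left (by positivity) (hf _)).trans (le_max_of_le_right ?_)
      exact pow_le_of_le_one (norm_nonneg _) hx.le (Nat.succ_ne_zero i)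
  exact this.trans_lt (max_lt h0 hx)

theorem norm_evalAt_sub_le {f : diskFunctions K} {x x' : L} (hx : ‖x‖ < 1) (hx' : ‖x'‖ < 1)
    (hf : IsIntegralSeries (f : PowerSeries K)) :
    ‖evalAt x hx f - evalAt x' hx' f‖ ≤ ‖x - x'‖ := by
  refine norm_le_of_hasSum ((hasSum_evalAt x hx f).sub (hasSum_evalAt x' hx' f)) (norm_nonneg _)
    fun i => ?_
  rw [← smul_sub, norm_smul, ← (Commute.all x x').mul_geom_sum₂, norm_mul]
  have : ‖∑ j ∈ Finset.range i, x ^ j * x' ^ (i - 1 - j)‖ ≤ 1 := by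
    refine IsUltrametricDist.norm_sum_le_of_forall_le_of_nonneg zero_le_one fun j _ => ?_
    rw [norm_mul, norm_pow, norm_pow]
    exact mul_le_one₀ (pow_le_one₀ (norm_nonneg _) hx.le) (by positivity)
      (pow_le_one₀ (norm_nonneg _) hx'.le)
  exact (mul_le_of_le_one_left (by positivity) (hf i)).trans
    (mul_le_of_le_one_right (norm_nonneg _) this)

theorem norm_pow_sub_pow_le {L : Type*} [NormedField L] [IsUltrametricDist L] {x y : L} (hx : ‖x‖ ≤ 1) (hy : ‖y‖ ≤ 1) (i : ℕ) :
    ‖x ^ i - y ^ i‖ ≤ ‖x - y‖ := by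
  rw [← (Commute.all x y).mul_geom_sum₂, norm_mul]
  refine mul_le_of_le_one_right (norm_nonneg _) ?_
  refine IsUltrametricDist.norm_sum_le_of_forall_le_of_nonneg zero_le_one fun j _ => ?_
  rw [norm_mul, norm_pow, norm_pow]
  exact mul_le_one₀ (pow_le_one₀ (norm_nonneg _) hx) (by positivity)
    (pow_le_one₀ (norm_nonneg _) hy)

/-- An integral analytic function is strictly differentiable, with an explicit error term. -/
theorem exists_norm_evalAt_sub_sub_le {f : diskFunctions K}
    (hf : IsIntegralSeries (f : PowerSeries K)) {y : L} (hy : ‖y‖ < 1) :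
    ∃ ζ : L, ∀ (x x' : L) (hx : ‖x‖ < 1) (hx' : ‖x'‖ < 1),
      ‖evalAt x hx f - evalAt x' hx' f - ζ * (x - x')‖ ≤ ‖x - x'‖ * max ‖x - y‖ ‖x' - y‖ := by
  have hsum : Summable fun i : ℕ =>
      PowerSeries.coeff i (f : PowerSeries K) • ((i : L) * y ^ (i - 1)) := by
    apply Summable.of_norm
    rw [← summable_nat_add_iff 1]
    refine Summable.of_nonneg_of_le (fun i => norm_nonneg _) (fun i => ?_)
      (summable_geometric_of_lt_one (norm_nonneg y) hy)
    rw [norm_smul, norm_mul, norm_pow, Nat.add_sub_cancel]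
    refine (mul_le_of_le_one_left (by positivity) (hf _)).trans
      (mul_le_of_le_one_left (by positivity) ?_)
    exact IsUltrametricDist.norm_natCast_le_one L _
  refine ⟨∑' i : ℕ, PowerSeries.coeff i (f : PowerSeries K) • ((i : L) * y ^ (i - 1)),
    fun x x' hx hx' => ?_⟩
  refine norm_le_of_hasSum (((hasSum_evalAt x hx f).sub (hasSum_evalAt x' hx' f)).sub
    (hsum.hasSum.mul_right (x - x'))) (by positivity) fun i => ?_
  have h1 : PowerSeries.coeff i (f : PowerSeries K) • x ^ i -
      PowerSeries.coeff i (f : PowerSeries K) • x' ^ i -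
      PowerSeries.coeff i (f : PowerSeries K) • ((i : L) * y ^ (i - 1)) * (x - x') =
      PowerSeries.coeff i (f : PowerSeries K) • ((x - x') *
        ∑ j ∈ Finset.range i, (x ^ j * x' ^ (i - 1 - j) - y ^ (i - 1))) := by
    rw [Finset.sum_sub_distrib, mul_sub (x - x'), (Commute.all x x').mul_geom_sum₂,
      Finset.sum_const, Finset.card_range, nsmul_eq_mul, smul_sub, smul_sub, smul_mul_assoc,
      mul_comm (x - x')]
  rw [h1, norm_smul, norm_mul]
  refine (mul_le_of_le_one_left (by positivity) (hf i)).trans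
    (mul_le_mul_of_nonneg_left ?_ (norm_nonneg _))
  refine IsUltrametricDist.norm_sum_le_of_forall_le_of_nonneg (by positivity) fun j hj => ?_
  have hj' : j + (i - 1 - j) = i - 1 := by have := Finset.mem_range.mp hj; omega
  have h2 : x ^ j * x' ^ (i - 1 - j) - y ^ (i - 1) =
      (x ^ j - y ^ j) * x' ^ (i - 1 - j) + y ^ j * (x' ^ (i - 1 - j) - y ^ (i - 1 - j)) := by
    rw [← hj', pow_add, hj']; ring
  rw [h2]
  refine (IsUltrametricDist.norm_add_le_max _ _).trans (max_le_max ?_ ?_)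
  · rw [norm_mul, norm_pow]
    exact (mul_le_of_le_one_right (norm_nonneg _) (pow_le_one₀ (norm_nonneg _) hx'.le)).trans
      (norm_pow_sub_pow_le hx.le hy.le j)
  · rw [norm_mul, norm_pow]
    exact (mul_le_of_le_one_left (norm_nonneg _) (pow_le_one₀ (norm_nonneg _) hy.le)).trans
      (norm_pow_sub_pow_le hx'.le hy.le _)

/-- A homomorphism that is bounded on integral functions is an evaluation on them. -/
theorem hom_eq_evalAt (φ : diskFunctions K →ₐ[K] L)
    (hφ : ∀ g : diskFunctions K, IsIntegralSeries (g : PowerSeries K) → ‖φ g‖ ≤ 1)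
    (hz : ‖φ coordinate‖ < 1) {f : diskFunctions K} (hf : IsIntegralSeries (f : PowerSeries K)) :
    φ f = evalAt (φ coordinate) hz f := by
  -- Both homomorphisms agree on polynomials, and the remainder is `z ^ n` times an integral
  -- function, on which both are bounded by 1.
  have key : ∀ n : ℕ, ‖φ f - evalAt (φ coordinate) hz f‖ ≤ ‖φ coordinate‖ ^ n := by
    intro n
    obtain ⟨g, hg, hg'⟩ := exists_eq_trunc_add f n
    have hgi : IsIntegralSeries (g : PowerSeries K) := fun i => by rw [hg']; exact hf _
    have h1 : φ f - evalAt (φ coordinate) hz f =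
        φ coordinate ^ n * (φ g - evalAt (φ coordinate) hz g) := by
      conv_lhs => rw [hg]
      rw [map_add, map_add, map_mul, map_mul, map_pow, map_pow, ← Polynomial.aeval_algHom_apply,
        ← Polynomial.aeval_algHom_apply, evalAt_coordinate]
      ring
    rw [h1, norm_mul, norm_pow]
    refine mul_le_of_le_one_right (by positivity) ((norm_sub_le_max_of_ultrametric _ _).trans
      (max_le (hφ g hgi) (norm_evalAt_le hz hgi)))
  have h0 := ge_of_tendsto' (tendsto_pow_atTop_nhds_zero_of_lt_one (norm_nonneg _) hz) key
  exact sub_eq_zero.mp (norm_le_zero_iff.mp h0)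

theorem isIntegralSeries_coordinate :
    IsIntegralSeries ((coordinate : diskFunctions K) : PowerSeries K) := isIntegralSeries_X

theorem isIntegralSeries_hom_coordinate (σ : diskFunctions K →ₐ[K] diskFunctions K) :
    IsIntegralSeries (σ coordinate : PowerSeries K) ∧
      ‖PowerSeries.coeff 0 (σ coordinate : PowerSeries K)‖ < 1 :=
  isIntegralSeries_hom_of_lt σ isIntegralSeries_coordinate (by
    rw [coe_coordinate, PowerSeries.coeff_zero_X, norm_zero]; exact zero_lt_one)

theorem norm_evalAt_hom_coordinate_lt (σ : diskFunctions K →ₐ[K] diskFunctions K) {x : L}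
    (hx : ‖x‖ < 1) : ‖evalAt x hx (σ coordinate)‖ < 1 :=
  norm_evalAt_lt hx (isIntegralSeries_hom_coordinate σ).1 (isIntegralSeries_hom_coordinate σ).2

theorem evalAt_hom (σ : diskFunctions K →ₐ[K] diskFunctions K) {x : L} (hx : ‖x‖ < 1)
    {f : diskFunctions K} (hf : IsIntegralSeries (f : PowerSeries K)) :
    evalAt x hx (σ f) =
      evalAt (evalAt x hx (σ coordinate)) (norm_evalAt_hom_coordinate_lt σ hx) f :=
  hom_eq_evalAt ((evalAt x hx).comp σ) (fun _ hg => norm_evalAt_le hx (isIntegralSeries_hom σ hg))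
    (norm_evalAt_hom_coordinate_lt σ hx) hf

end Evaluation

/-! ### The action on points -/

section Points

variable (K : Type*) [NontriviallyNormedField K] [IsUltrametricDist K]
variable (L : Type*) [NormedField L] [NormedAlgebra K L] [IsUltrametricDist L] [CompleteSpace L]

/-- The points of the open unit disk over `K` with coordinate in `L`. -/
@[ext] structure DiskPoint where
  coord : L
  norm_lt : ‖coord‖ < 1

variable {K L}

/-- A point is moved by substituting it into `σ⁻¹(z)`: the inverse turns the contravariance of
functions into a left action, and integrality keeps the image in the disk. -/
instance : MulAction (DiskAut K) (DiskPoint L) where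
  smul σ x := ⟨evalAt x.coord x.norm_lt (σ⁻¹ coordinate),
    norm_evalAt_hom_coordinate_lt ((σ⁻¹ : DiskAut K) : diskFunctions K →ₐ[K] diskFunctions K)
      x.norm_lt⟩
  one_smul x := DiskPoint.ext (by
    change evalAt x.coord x.norm_lt ((1 : DiskAut K)⁻¹ coordinate) = _
    rw [inv_one, AlgEquiv.one_apply, evalAt_coordinate])
  mul_smul σ τ x := DiskPoint.ext (by
    change evalAt x.coord x.norm_lt ((σ * τ)⁻¹ coordinate) = evalAt (evalAt x.coord x.norm_lt
      (τ⁻¹ coordinate)) _ (σ⁻¹ coordinate)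
    rw [mul_inv_rev, AlgEquiv.mul_apply]
    exact evalAt_hom ((τ⁻¹ : DiskAut K) : diskFunctions K →ₐ[K] diskFunctions K) x.norm_lt
      (isIntegralSeries_hom_coordinate
        ((σ⁻¹ : DiskAut K) : diskFunctions K →ₐ[K] diskFunctions K)).1)

theorem coord_smul (σ : DiskAut K) (x : DiskPoint L) :
    (σ • x).coord = evalAt x.coord x.norm_lt (σ⁻¹ coordinate) := rfl

theorem isIntegralSeries_aut_coordinate (σ : DiskAut K) :
    IsIntegralSeries (σ coordinate : PowerSeries K) :=
  (isIntegralSeries_hom_coordinate (σ : diskFunctions K →ₐ[K] diskFunctions K)).1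

/-- An integral series is 1-Lipschitz on the disk, and this applies both to `σ` and to its inverse.
-/
theorem norm_coord_smul_sub (σ : DiskAut K) (x x' : DiskPoint L) :
    ‖(σ • x).coord - (σ • x').coord‖ = ‖x.coord - x'.coord‖ := by
  have key : ∀ (σ : DiskAut K) (x x' : DiskPoint L),
      ‖(σ • x).coord - (σ • x').coord‖ ≤ ‖x.coord - x'.coord‖ := fun σ x x' =>
    norm_evalAt_sub_le x.norm_lt x'.norm_lt (isIntegralSeries_aut_coordinate σ⁻¹)
  refine (key σ x x').antisymm ?_
  have := key σ⁻¹ (σ • x) (σ • x')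
  rwa [inv_smul_smul, inv_smul_smul] at this

end Points

/-! ### Weierstrass preparation -/

section Preparation

open Filter Topology

variable {K : Type*} [NontriviallyNormedField K] [IsUltrametricDist K]

theorem mem_maximalIdeal_iff {x : integerRing K} :
    x ∈ IsLocalRing.maximalIdeal (integerRing K) ↔ ‖(x : K)‖ < 1 := by
  rw [IsLocalRing.mem_maximalIdeal, mem_nonunits_iff, isUnit_integerRing_iff]
  exact ⟨fun h => lt_of_le_of_ne (norm_coe_integerRing_le x) h, fun h => h.ne⟩

theorem residue_eq_zero_iff {x : integerRing K} :
    IsLocalRing.residue (integerRing K) x = 0 ↔ ‖(x : K)‖ < 1 := by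
  rw [IsLocalRing.residue_eq_zero_iff, mem_maximalIdeal_iff]

theorem integerRing_dvd_iff {x y : integerRing K} : x ∣ y ↔ ‖(y : K)‖ ≤ ‖(x : K)‖ := by
  constructor
  · rintro ⟨z, rfl⟩
    rw [MulMemClass.coe_mul, norm_mul]
    exact mul_le_of_le_one_right (norm_nonneg _) (norm_coe_integerRing_le z)
  · intro h
    by_cases hx : (x : K) = 0
    · rw [hx, norm_zero, norm_le_zero_iff] at h
      exact ⟨0, Subtype.ext (by rw [mul_zero, h]; rfl)⟩
    · refine ⟨⟨(y : K) / x, mem_integerRing_iff.mpr ?_⟩, Subtype.ext ?_⟩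
      · rw [norm_div]
        exact div_le_one_of_le₀ h (norm_nonneg _)
      · exact (mul_div_cancel₀ _ hx).symm

variable [IsDiscreteValuationRing (integerRing K)]

variable (K) in
theorem exists_uniformizer : ∃ π : integerRing K, Irreducible π ∧ 0 < ‖(π : K)‖ ∧ ‖(π : K)‖ < 1 ∧
    ∀ x : K, x ≠ 0 → ‖x‖ ≤ 1 → ∃ n : ℕ, ‖x‖ = ‖(π : K)‖ ^ n := by
  obtain ⟨π, hπ⟩ := IsDiscreteValuationRing.exists_irreducible (integerRing K)
  refine ⟨π, hπ, norm_pos_iff.mpr fun h => hπ.ne_zero (Subtype.ext h),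
    mem_maximalIdeal_iff.mp hπ.not_isUnit, fun x hx h => ?_⟩
  obtain ⟨n, u, hu⟩ := IsDiscreteValuationRing.eq_unit_mul_pow_irreducible
    (x := (⟨x, mem_integerRing_iff.mpr h⟩ : integerRing K))
    (fun h => hx (congrArg Subtype.val h)) hπ
  refine ⟨n, ?_⟩
  have h1 : x = ((u : integerRing K) : K) * (π : K) ^ n := congrArg Subtype.val hu
  rw [h1, norm_mul, norm_pow, isUnit_integerRing_iff.mp u.isUnit, one_mul]

instance isAdicComplete_integerRing [CompleteSpace K] :
    IsAdicComplete (IsLocalRing.maximalIdeal (integerRing K)) (integerRing K) := by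
  obtain ⟨π, hπ, hπ0, hπ1, -⟩ := exists_uniformizer K
  -- Powers of the maximal ideal are the closed balls of radius `|π| ^ n`, so adic completeness is
  -- metric completeness.
  have hmem : ∀ (n : ℕ) (x y : integerRing K),
      x ≡ y [SMOD (IsLocalRing.maximalIdeal (integerRing K) ^ n • ⊤ :
        Submodule (integerRing K) (integerRing K))] ↔ ‖(x : K) - y‖ ≤ ‖(π : K)‖ ^ n := by
    intro n x y
    rw [SModEq.sub_mem, smul_eq_mul, Ideal.mul_top, hπ.maximalIdeal_eq, Ideal.span_singleton_pow,
      Ideal.mem_span_singleton, integerRing_dvd_iff]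
    simp
  have hlim : Tendsto (fun n : ℕ => ‖(π : K)‖ ^ n) atTop (𝓝 0) :=
    tendsto_pow_atTop_nhds_zero_of_lt_one hπ0.le hπ1
  have h1 : IsHausdorff (IsLocalRing.maximalIdeal (integerRing K)) (integerRing K) := by
    refine ⟨fun x hx => Subtype.ext (norm_le_zero_iff.mp (ge_of_tendsto' hlim fun n => ?_))⟩
    have := (hmem n x 0).mp (hx n)
    rwa [ZeroMemClass.coe_zero, sub_zero] at this
  have h2 : IsPrecomplete (IsLocalRing.maximalIdeal (integerRing K)) (integerRing K) := by
    refine ⟨fun f hf => ?_⟩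
    have hf' : ∀ m n, m ≤ n → ‖(f m : K) - f n‖ ≤ ‖(π : K)‖ ^ m := fun m n hmn =>
      (hmem m _ _).mp (hf hmn)
    have hc : CauchySeq fun n => (f n : K) := by
      refine cauchySeq_of_le_tendsto_0 (fun N => ‖(π : K)‖ ^ N) (fun n m N hn hm => ?_) hlim
      rw [dist_eq_norm]
      have : (f n : K) - f m = ((f N : K) - f m) - ((f N : K) - f n) := by ring
      rw [this]
      exact (norm_sub_le_max_of_ultrametric _ _).trans (max_le (hf' N m hm) (hf' N n hn))
    obtain ⟨a, ha⟩ := cauchySeq_tendsto_of_complete hc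
    have ha1 : ‖a‖ ≤ 1 := le_of_tendsto' ha.norm fun n => norm_coe_integerRing_le (f n)
    refine ⟨⟨a, mem_integerRing_iff.mpr ha1⟩, fun n => (hmem n _ _).mpr ?_⟩
    refine le_of_tendsto ((tendsto_const_nhds.sub ha).norm) ?_
    filter_upwards [eventually_ge_atTop n] with m hm
    exact hf' n m hm
  exact { toIsHausdorff := h1, toIsPrecomplete := h2 }

/-- Nonzero coefficients have absolute value a power of the uniformizer, so the smallest exponent
that occurs gives the maximum. -/
theorem IsIntegralSeries.exists_norm_max {f : PowerSeries K} (hf : IsIntegralSeries f)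
    (h0 : f ≠ 0) : ∃ i, PowerSeries.coeff i f ≠ 0 ∧
      ∀ j, ‖PowerSeries.coeff j f‖ ≤ ‖PowerSeries.coeff i f‖ := by
  obtain ⟨π, -, hπ0, hπ1, hπ⟩ := exists_uniformizer K
  have hex : ∃ n : ℕ, ∃ i, PowerSeries.coeff i f ≠ 0 ∧ ‖PowerSeries.coeff i f‖ = ‖(π : K)‖ ^ n := by
    have : ∃ i, PowerSeries.coeff i f ≠ 0 := by
      by_contra h
      push Not at h
      exact h0 (by ext i; rw [h i, map_zero])
    obtain ⟨i, hi⟩ := this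
    obtain ⟨n, hn⟩ := hπ _ hi (hf i)
    exact ⟨n, i, hi, hn⟩
  classical
  obtain ⟨i, hi, hin⟩ := Nat.find_spec hex
  refine ⟨i, hi, fun j => ?_⟩
  by_cases hj : PowerSeries.coeff j f = 0
  · rw [hj, norm_zero]; exact norm_nonneg _
  · obtain ⟨n, hn⟩ := hπ _ hj (hf j)
    rw [hin, hn]
    exact pow_le_pow_of_le_one hπ0.le hπ1.le (Nat.find_min' hex ⟨j, hj, hn⟩)

/-- The Weierstrass factorization `f = c P(z) u` of a bounded analytic function `f`, into a
constant, a distinguished polynomial and a unit. -/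
structure WeierstrassData (f : diskFunctions K) where
  c : K
  P : Polynomial K
  u : diskFunctions K
  c_ne_zero : c ≠ 0
  monic : P.Monic
  norm_coeff_lt : ∀ i, i < P.natDegree → ‖P.coeff i‖ < 1
  isUnit : IsUnit u
  integral : IsIntegralSeries (u : PowerSeries K)
  integral_inv : ∃ w : diskFunctions K, IsIntegralSeries (w : PowerSeries K) ∧ u * w = 1
  eq_mul : f = c • (Polynomial.aeval coordinate P * u)
  norm_coeff_le : ∀ i, ‖PowerSeries.coeff i (f : PowerSeries K)‖ ≤ ‖c‖
  norm_coeff_natDegree : ‖PowerSeries.coeff P.natDegree (f : PowerSeries K)‖ = ‖c‖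
  norm_coeff_lt_of_lt : ∀ i, i < P.natDegree → ‖PowerSeries.coeff i (f : PowerSeries K)‖ < ‖c‖

/-- Divide by a coefficient of maximal absolute value; the reduction is then nonzero, and
Weierstrass preparation over the complete ring `R` applies. The degree of the distinguished factor
is the order of the reduction. -/
theorem nonempty_weierstrassData [CompleteSpace K] {f : diskFunctions K}
    (hf : IsIntegralSeries (f : PowerSeries K)) (h0 : f ≠ 0) : Nonempty (WeierstrassData f) := by
  obtain ⟨k, hk, hmax⟩ := hf.exists_norm_max fun h => h0 (Subtype.ext h)
  set c := PowerSeries.coeff k (f : PowerSeries K) with hc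
  have hgi : IsIntegralSeries ((c⁻¹ • f : diskFunctions K) : PowerSeries K) := fun i => by
    change ‖PowerSeries.coeff i (c⁻¹ • (f : PowerSeries K))‖ ≤ 1
    rw [PowerSeries.coeff_smul, smul_eq_mul, norm_mul, norm_inv]
    exact inv_mul_le_one_of_le₀ (hmax i) (norm_nonneg _)
  obtain ⟨g, hg⟩ := hgi.exists_map_eq
  have hgc : ∀ i, PowerSeries.coeff i (f : PowerSeries K) =
      c * ((PowerSeries.coeff i g : integerRing K) : K) := by
    intro i
    have : ((PowerSeries.coeff i g : integerRing K) : K) =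
        PowerSeries.coeff i (c⁻¹ • (f : PowerSeries K)) := by
      have h := congrArg (PowerSeries.coeff i) hg
      rw [PowerSeries.coeff_map] at h
      exact h
    rw [this, PowerSeries.coeff_smul, smul_eq_mul, mul_inv_cancel_left₀ hk]
  have hred : g.map (IsLocalRing.residue (integerRing K)) ≠ 0 := by
    intro h
    have h1 := congrArg (PowerSeries.coeff k) h
    rw [PowerSeries.coeff_map, map_zero, residue_eq_zero_iff] at h1
    have h2 := hgc k
    rw [← hc] at h2
    have h3 : ((PowerSeries.coeff k g : integerRing K) : K) = 1 := by
      exact (mul_right_eq_self₀.mp h2.symm).resolve_right hk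
    rw [h3, norm_one] at h1
    exact lt_irrefl _ h1
  obtain ⟨Q, u, H⟩ := PowerSeries.exists_isWeierstrassFactorization hred
  have hdeg := PowerSeries.IsWeierstrassFactorization.natDegree_eq_toNat_order_map H
  set ι := algebraMap (integerRing K) K with hι
  have hιinj : Function.Injective ι := Subtype.val_injective
  have hnat : (Q.map ι).natDegree = Q.natDegree := Polynomial.natDegree_map_eq_of_injective hιinj Q
  obtain ⟨w, hw⟩ := H.isUnit.exists_right_inv
  have hu := isIntegralSeries_map u
  have hw' := isIntegralSeries_map w
  have huw : (⟨_, hu.mem_diskFunctions⟩ : diskFunctions K) * ⟨_, hw'.mem_diskFunctions⟩ = 1 :=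
    Subtype.ext (by
      change u.map ι * w.map ι = 1
      rw [← map_mul, hw, map_one])
  have hord : ∀ i, i < Q.natDegree → ‖((PowerSeries.coeff i g : integerRing K) : K)‖ < 1 := by
    intro i hi
    rw [← residue_eq_zero_iff, ← PowerSeries.coeff_map]
    refine PowerSeries.coeff_of_lt_order i ?_
    rw [hdeg] at hi
    rw [← ENat.natCast_toNat (PowerSeries.order_finite_iff_ne_zero.mpr hred).ne]
    exact_mod_cast hi
  have hord' : ‖((PowerSeries.coeff Q.natDegree g : integerRing K) : K)‖ = 1 := by
    refine (norm_coe_integerRing_le _).antisymm (not_lt.mp fun h => ?_)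
    rw [← residue_eq_zero_iff, ← PowerSeries.coeff_map, hdeg] at h
    exact PowerSeries.coeff_order hred h
  exact ⟨{
    c := c
    P := Q.map ι
    u := ⟨_, hu.mem_diskFunctions⟩
    c_ne_zero := hk
    monic := H.isDistinguishedAt.monic.map ι
    norm_coeff_lt := fun i hi => by
      rw [hnat] at hi
      rw [Polynomial.coeff_map]
      exact mem_maximalIdeal_iff.mp (H.isDistinguishedAt.mem hi)
    isUnit := IsUnit.of_mul_eq_one _ huw
    integral := hu
    integral_inv := ⟨_, hw', huw⟩
    eq_mul := Subtype.ext (by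
      change (f : PowerSeries K) = c • (((Polynomial.aeval coordinate (Q.map ι) : diskFunctions K) :
        PowerSeries K) * u.map ι)
      rw [coe_aeval_coordinate, Polynomial.polynomial_map_coe, ← map_mul, ← H.eq_mul, hg]
      change _ = c • c⁻¹ • (f : PowerSeries K)
      rw [smul_inv_smul₀ hk])
    norm_coeff_le := hmax
    norm_coeff_natDegree := by
      rw [hnat, hgc, norm_mul, hord', mul_one]
    norm_coeff_lt_of_lt := fun i hi => by
      rw [hnat] at hi
      rw [hgc, norm_mul]
      exact mul_lt_of_lt_one_right (norm_pos_iff.mpr hk) (hord i hi) }⟩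

end Preparation

/-! ### The normalized valuation -/

section Valuation

variable (p : ℕ) [hp : Fact p.Prime] (K : Type*) [NontriviallyNormedField K] [IsUltrametricDist K]
  [CharZero K] [CharP (IsLocalRing.ResidueField (integerRing K)) p]

theorem norm_prime_pos : 0 < ‖(p : K)‖ :=
  norm_pos_iff.mpr (Nat.cast_ne_zero.mpr hp.out.ne_zero)

theorem norm_natCast_lt_one_iff (m : ℕ) : ‖(m : K)‖ < 1 ↔ p ∣ m := by
  have : (m : K) = ((m : integerRing K) : K) := by simp
  rw [this, ← residue_eq_zero_iff, map_natCast, CharP.cast_eq_zero_iff _ p]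

theorem norm_prime_lt_one : ‖(p : K)‖ < 1 := (norm_natCast_lt_one_iff p K p).mpr dvd_rfl

theorem norm_natCast_eq_one {m : ℕ} (h : ¬ p ∣ m) : ‖(m : K)‖ = 1 :=
  (IsUltrametricDist.norm_natCast_le_one K m).antisymm
    (not_lt.mp fun h' => h ((norm_natCast_lt_one_iff p K m).mp h'))

/-- The absolute value of the elements of valuation `q`, for the valuation with `val p = 1`. -/
def absOfVal (q : ℚ) : ℝ := ‖(p : K)‖ ^ (q : ℝ)

theorem absOfVal_pos (q : ℚ) : 0 < absOfVal p K q := Real.rpow_pos_of_pos (norm_prime_pos p K) _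

theorem absOfVal_zero : absOfVal p K 0 = 1 := by rw [absOfVal, Rat.cast_zero, Real.rpow_zero]

theorem absOfVal_add (q r : ℚ) : absOfVal p K (q + r) = absOfVal p K q * absOfVal p K r := by
  rw [absOfVal, Rat.cast_add, Real.rpow_add (norm_prime_pos p K), absOfVal, absOfVal]

theorem absOfVal_sum {ι : Type*} (s : Finset ι) (q : ι → ℚ) :
    absOfVal p K (∑ i ∈ s, q i) = ∏ i ∈ s, absOfVal p K (q i) := by
  classical
  induction s using Finset.induction_on with
  | empty => simp [absOfVal_zero]
  | insert a s ha ih => rw [Finset.sum_insert ha, Finset.prod_insert ha, absOfVal_add, ih]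

theorem absOfVal_natCast (n : ℕ) : absOfVal p K n = ‖(p : K) ^ n‖ := by
  rw [absOfVal, Rat.cast_natCast, Real.rpow_natCast, norm_pow]

theorem absOfVal_strictAnti : StrictAnti (absOfVal p K) := fun q r h => by
  refine Real.rpow_lt_rpow_of_exponent_gt (norm_prime_pos p K) (norm_prime_lt_one p K) ?_
  exact_mod_cast h

theorem absOfVal_le_iff {q r : ℚ} : absOfVal p K q ≤ absOfVal p K r ↔ r ≤ q :=
  (absOfVal_strictAnti p K).le_iff_ge

theorem absOfVal_lt_iff {q r : ℚ} : absOfVal p K q < absOfVal p K r ↔ r < q :=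
  (absOfVal_strictAnti p K).lt_iff_gt

theorem absOfVal_injective : Function.Injective (absOfVal p K) :=
  (absOfVal_strictAnti p K).injective

theorem absOfVal_min (q r : ℚ) :
    absOfVal p K (min q r) = max (absOfVal p K q) (absOfVal p K r) :=
  (absOfVal_strictAnti p K).antitone.map_min

variable {K}

theorem val_eq_iff {x : K} (hx : x ≠ 0) (q : ℚ) : val p x = q ↔ ‖x‖ = absOfVal p K q := by
  have hlog : Real.log ‖(p : K)‖ < 0 :=
    Real.log_neg (norm_prime_pos p K) (norm_prime_lt_one p K)
  rw [val, div_eq_iff hlog.ne, absOfVal, ← Real.log_rpow (norm_prime_pos p K)]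
  exact Real.log_injOn_pos.eq_iff (norm_pos_iff.mpr hx) (absOfVal_pos p K q)

theorem le_val_iff {x : K} (hx : x ≠ 0) (q : ℚ) : q ≤ val p x ↔ ‖x‖ ≤ absOfVal p K q := by
  have hlog : Real.log ‖(p : K)‖ < 0 :=
    Real.log_neg (norm_prime_pos p K) (norm_prime_lt_one p K)
  rw [val, le_div_iff_of_neg hlog, absOfVal, ← Real.log_rpow (norm_prime_pos p K)]
  exact Real.log_le_log_iff (norm_pos_iff.mpr hx) (absOfVal_pos p K q)

theorem exists_norm_eq_absOfVal [IsDiscreteValuationRing (integerRing K)] {x : K} (hx : x ≠ 0) :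
    ∃ q : ℚ, ‖x‖ = absOfVal p K q := by
  obtain ⟨π, -, hπ0, hπ1, hπ⟩ := exists_uniformizer K
  obtain ⟨e, he⟩ := hπ p (Nat.cast_ne_zero.mpr hp.out.ne_zero) (norm_prime_lt_one p K).le
  have he0 : e ≠ 0 := by
    rintro rfl
    exact (norm_prime_lt_one p K).ne (by rw [he, pow_zero])
  have key : ∀ x : K, x ≠ 0 → ‖x‖ ≤ 1 → ∃ q : ℚ, ‖x‖ = absOfVal p K q := by
    intro x hx hx1
    obtain ⟨n, hn⟩ := hπ x hx hx1
    -- `e` is the ramification index, `|p| = |π| ^ e`, so the uniformizer has valuation `1 / e`.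
    refine ⟨n / e, ?_⟩
    rw [absOfVal, he, hn, ← Real.rpow_natCast, ← Real.rpow_natCast, ← Real.rpow_mul hπ0.le]
    congr 1
    push_cast
    field_simp
  rcases le_total ‖x‖ 1 with h | h
  · exact key x hx h
  · obtain ⟨q, hq⟩ := key x⁻¹ (inv_ne_zero hx) (by rw [norm_inv]; exact inv_le_one_of_one_le₀ h)
    refine ⟨-q, ?_⟩
    have h1 : absOfVal p K (-q) * absOfVal p K q = 1 := by
      rw [← absOfVal_add, neg_add_cancel, absOfVal_zero]
    rw [← hq, norm_inv] at h1
    exact (eq_of_mul_inv_eq_one h1).symm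

/-- The Gauss valuation and the number of zeros, read off a Weierstrass factorization. -/
theorem WeierstrassData.gaussVal_eq {f : diskFunctions K} (D : WeierstrassData f) {q : ℚ}
    (hq : ‖D.c‖ = absOfVal p K q) : gaussVal p (f : PowerSeries K) = q := by
  have hne : PowerSeries.coeff D.P.natDegree (f : PowerSeries K) ≠ 0 := by
    rw [← norm_pos_iff, D.norm_coeff_natDegree]
    exact norm_pos_iff.mpr D.c_ne_zero
  refine IsLeast.csInf_eq ⟨⟨D.P.natDegree, hne, ?_⟩, ?_⟩
  · exact ((val_eq_iff p hne q).mpr (by rw [D.norm_coeff_natDegree, hq])).symm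
  · rintro r ⟨i, hi, rfl⟩
    exact (le_val_iff p hi q).mpr (by rw [← hq]; exact D.norm_coeff_le i)

theorem WeierstrassData.zeroCount_eq {f : diskFunctions K} (D : WeierstrassData f) {q : ℚ}
    (hq : ‖D.c‖ = absOfVal p K q) : zeroCount p (f : PowerSeries K) = D.P.natDegree := by
  have hne : PowerSeries.coeff D.P.natDegree (f : PowerSeries K) ≠ 0 := by
    rw [← norm_pos_iff, D.norm_coeff_natDegree]
    exact norm_pos_iff.mpr D.c_ne_zero
  refine IsLeast.csInf_eq ⟨⟨hne, ?_⟩, ?_⟩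
  · rw [D.gaussVal_eq p hq, val_eq_iff p hne, D.norm_coeff_natDegree, hq]
  · rintro i ⟨hi, hi'⟩
    rw [D.gaussVal_eq p hq, val_eq_iff p hi, ← hq] at hi'
    exact not_lt.mp fun h => (D.norm_coeff_lt_of_lt i h).ne hi'

/-- Absolute values of algebraic elements have rational valuation. -/
theorem exists_norm_eq_absOfVal_of_isAlgebraic [IsDiscreteValuationRing (integerRing K)]
    [CompleteSpace K] {L : Type*} [NormedField L] [NormedAlgebra K L] [IsUltrametricDist L]
    [Algebra.IsAlgebraic K L] {x : L} (hx : x ≠ 0) : ∃ q : ℚ, ‖x‖ = absOfVal p K q := by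
  have hint : IsIntegral K x := (Algebra.IsAlgebraic.isAlgebraic x).isIntegral
  have h0 : (minpoly K x).coeff 0 ≠ 0 := minpoly.coeff_zero_ne_zero hint hx
  obtain ⟨q, hq⟩ := exists_norm_eq_absOfVal p h0
  refine ⟨q / (minpoly K x).natDegree, ?_⟩
  rw [NormedAlgebra.norm_eq_spectralNorm K, spectralNorm.spectralNorm_eq_norm_coeff_zero_rpow, hq,
    absOfVal, absOfVal, ← Real.rpow_mul (norm_nonneg _)]
  congr 1
  push_cast
  ring

end Valuation

/-! ### Multipliers at points -/

section Multiplier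

open Filter Topology

variable {K : Type*} [NontriviallyNormedField K] [IsUltrametricDist K]
variable {L : Type*} [NormedField L] [NormedAlgebra K L] [IsUltrametricDist L] [CompleteSpace L]

theorem norm_eq_of_norm_sub_lt {E : Type*} [SeminormedAddCommGroup E] [IsUltrametricDist E]
    {a b : E} (h : ‖a - b‖ < ‖b‖) : ‖a‖ = ‖b‖ := by
  have := IsUltrametricDist.norm_add_eq_max_of_norm_ne_norm h.ne
  rwa [sub_add_cancel, max_eq_right h.le] at this

theorem exists_diskPoint_near (K : Type*) [NontriviallyNormedField K] {L : Type*} [NormedField L]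
    [NormedAlgebra K L] [IsUltrametricDist L] (y : DiskPoint L) {ε : ℝ} (hε : 0 < ε) :
    ∃ x : DiskPoint L, 0 < ‖x.coord - y.coord‖ ∧ ‖x.coord - y.coord‖ < ε := by
  obtain ⟨t, ht0, ht⟩ := NormedField.exists_norm_lt K (lt_min hε zero_lt_one)
  have h1 : ‖algebraMap K L t‖ = ‖t‖ := norm_algebraMap' L t
  refine ⟨⟨y.coord + algebraMap K L t, ?_⟩, ?_, ?_⟩
  · refine (IsUltrametricDist.norm_add_le_max _ _).trans_lt (max_lt y.norm_lt ?_)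
    rw [h1]
    exact ht.trans_le (min_le_right _ _)
  · rwa [add_sub_cancel_left, h1]
  · rw [add_sub_cancel_left, h1]
    exact ht.trans_le (min_le_left _ _)

theorem multiset_prod_map_le_one {ι : Type*} {s : Multiset ι} {f : ι → ℝ} (h0 : ∀ i ∈ s, 0 ≤ f i)
    (h1 : ∀ i ∈ s, f i ≤ 1) : (s.map f).prod ≤ 1 := by
  induction s using Multiset.induction_on with
  | empty => simp
  | cons a s ih =>
    rw [Multiset.map_cons, Multiset.prod_cons]
    have hs := ih (fun i hi => h0 i (Multiset.mem_cons_of_mem hi))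
      fun i hi => h1 i (Multiset.mem_cons_of_mem hi)
    refine mul_le_one₀ (h1 a (Multiset.mem_cons_self a s)) (Multiset.prod_nonneg ?_) hs
    intro b hb
    obtain ⟨i, hi, rfl⟩ := Multiset.mem_map.mp hb
    exact h0 i (Multiset.mem_cons_of_mem hi)

theorem exists_norm_sub_eq (S : Finset L) (y : L) :
    ∃ δ : ℝ, 0 < δ ∧ ∀ s ∈ S, s ≠ y → ∀ x : L, ‖x - y‖ < δ → ‖x - s‖ = ‖y - s‖ := by
  classical
  induction S using Finset.induction_on with
  | empty => exact ⟨1, one_pos, by simp⟩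
  | insert a S ha ih =>
    obtain ⟨δ, hδ, h⟩ := ih
    by_cases hay : a = y
    · refine ⟨δ, hδ, fun s hs hsy x hx => ?_⟩
      rcases Finset.mem_insert.mp hs with rfl | hs
      · exact absurd hay hsy
      · exact h s hs hsy x hx
    · refine ⟨min δ ‖y - a‖, lt_min hδ (norm_pos_iff.mpr (sub_ne_zero.mpr (Ne.symm hay))),
        fun s hs hsy x hx => ?_⟩
      rcases Finset.mem_insert.mp hs with rfl | hs
      · refine norm_eq_of_norm_sub_lt ?_
        rw [sub_sub_sub_cancel_right]
        exact hx.trans_le (min_le_right _ _)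
      · exact h s hs hsy x (hx.trans_le (min_le_left _ _))

/-- `ζ` is the derivative at `y` of the action of `σ` on points. -/
def IsMultiplier (σ : DiskAut K) (y : DiskPoint L) (ζ : L) : Prop :=
  ∀ x x' : DiskPoint L, ‖(σ • x).coord - (σ • x').coord - ζ * (x.coord - x'.coord)‖ ≤
    ‖x.coord - x'.coord‖ * max ‖x.coord - y.coord‖ ‖x'.coord - y.coord‖

theorem exists_isMultiplier (σ : DiskAut K) (y : DiskPoint L) : ∃ ζ, IsMultiplier σ y ζ := by
  obtain ⟨ζ, h⟩ := exists_norm_evalAt_sub_sub_le (isIntegralSeries_aut_coordinate σ⁻¹) y.norm_lt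
  exact ⟨ζ, fun x x' => h _ _ x.norm_lt x'.norm_lt⟩

theorem IsMultiplier.norm_sub_le {σ : DiskAut K} {y : DiskPoint L} {ζ : L}
    (h : IsMultiplier σ y ζ) (x : DiskPoint L) :
    ‖(σ • x).coord - (σ • y).coord - ζ * (x.coord - y.coord)‖ ≤
      ‖x.coord - y.coord‖ * ‖x.coord - y.coord‖ := by
  have := h x y
  rwa [sub_self y.coord, norm_zero, max_eq_left (norm_nonneg _)] at this

theorem IsMultiplier.eq {σ : DiskAut K} {y : DiskPoint L} {ζ ζ' : L}
    (h : IsMultiplier σ y ζ) (h' : IsMultiplier σ y ζ') : ζ = ζ' := by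
  by_contra hne
  obtain ⟨x, hx0, hx⟩ := exists_diskPoint_near K y (norm_pos_iff.mpr (sub_ne_zero.mpr hne))
  have h1 : ‖(ζ - ζ') * (x.coord - y.coord)‖ ≤ ‖x.coord - y.coord‖ * ‖x.coord - y.coord‖ := by
    have : (ζ - ζ') * (x.coord - y.coord) =
      ((σ • x).coord - (σ • y).coord - ζ' * (x.coord - y.coord)) -
        ((σ • x).coord - (σ • y).coord - ζ * (x.coord - y.coord)) := by ring
    rw [this]
    exact (norm_sub_le_max_of_ultrametric _ _).trans (max_le (h'.norm_sub_le x) (h.norm_sub_le x))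
  rw [norm_mul] at h1
  exact (le_of_mul_le_mul_right h1 hx0).not_gt hx

theorem IsMultiplier.norm_le_one {σ : DiskAut K} {y : DiskPoint L} {ζ : L}
    (h : IsMultiplier σ y ζ) : ‖ζ‖ ≤ 1 := by
  obtain ⟨x, hx0, hx⟩ := exists_diskPoint_near K y one_pos
  have h1 : ‖ζ * (x.coord - y.coord)‖ ≤ ‖x.coord - y.coord‖ := by
    have : ζ * (x.coord - y.coord) = ((σ • x).coord - (σ • y).coord) -
      ((σ • x).coord - (σ • y).coord - ζ * (x.coord - y.coord)) := by ring
    rw [this]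
    refine (norm_sub_le_max_of_ultrametric _ _).trans (max_le (norm_coord_smul_sub σ x y).le
      ((h.norm_sub_le x).trans (mul_le_of_le_one_right (norm_nonneg _) hx.le)))
  rw [norm_mul] at h1
  exact le_of_mul_le_mul_right (by rwa [one_mul]) hx0

theorem isMultiplier_one (y : DiskPoint L) : IsMultiplier (1 : DiskAut K) y 1 := fun x x' => by
  rw [one_smul, one_smul, one_mul, sub_self, norm_zero]
  positivity

/-- The chain rule; the error terms keep their size because `τ` is an isometry fixing `y`. -/
theorem IsMultiplier.mul {σ τ : DiskAut K} {y : DiskPoint L} {ζ ζ' : L}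
    (h : IsMultiplier σ y ζ) (h' : IsMultiplier τ y ζ') (hτ : τ • y = y) :
    IsMultiplier (σ * τ) y (ζ * ζ') := fun x x' => by
  have h1 : ((σ * τ) • x).coord - ((σ * τ) • x').coord - ζ * ζ' * (x.coord - x'.coord) =
      ((σ • τ • x).coord - (σ • τ • x').coord - ζ * ((τ • x).coord - (τ • x').coord)) +
        ζ * ((τ • x).coord - (τ • x').coord - ζ' * (x.coord - x'.coord)) := by
    rw [mul_smul, mul_smul]; ring
  rw [h1]
  refine (IsUltrametricDist.norm_add_le_max _ _).trans (max_le ?_ ?_)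
  · have h2 : ∀ x : DiskPoint L, ‖(τ • x).coord - y.coord‖ = ‖x.coord - y.coord‖ := fun x => by
      conv_lhs => rw [← hτ]
      exact norm_coord_smul_sub τ x y
    have := h (τ • x) (τ • x')
    rwa [norm_coord_smul_sub, h2, h2] at this
  · rw [norm_mul]
    exact (mul_le_of_le_one_left (norm_nonneg _) h.norm_le_one).trans (h' x x')

theorem IsMultiplier.pow {σ : DiskAut K} {y : DiskPoint L} {ζ : L}
    (h : IsMultiplier σ y ζ) (hσ : σ • y = y) (n : ℕ) : IsMultiplier (σ ^ n) y (ζ ^ n) := by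
  induction n with
  | zero => rw [pow_zero, pow_zero]; exact isMultiplier_one y
  | succ n ih => rw [pow_succ, pow_succ]; exact ih.mul h hσ

/-- If the derivative at a fixed point is `1`, then all points near it are fixed. -/
theorem IsMultiplier.smul_eq_of_one [CharZero L] {σ : DiskAut K} {y : DiskPoint L}
    (h : IsMultiplier σ y 1) (hσ : σ • y = y) {n : ℕ} (hσn : σ ^ n = 1)
    {x : DiskPoint L} (hx : ‖x.coord - y.coord‖ < ‖(n : L)‖) : σ • x = x := by
  set d := (σ • x).coord - x.coord with hd
  -- Successive steps along the orbit of `x` all nearly equal the first step `d`. Over a full period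
  -- they add up to zero, so `|n d| ≤ |d| |x - y|`, which forces `d = 0`.
  have h1 : ∀ j : ℕ, ‖(σ ^ (j + 1) • x).coord - (σ ^ j • x).coord - d‖ ≤
      ‖d‖ * ‖x.coord - y.coord‖ := by
    intro j
    have h2 : ‖(σ • x).coord - y.coord‖ = ‖x.coord - y.coord‖ := by
      conv_lhs => rw [← hσ]
      exact norm_coord_smul_sub σ x y
    have := (h.pow hσ j) (σ • x) x
    rwa [smul_smul, ← pow_succ, one_pow, one_mul, ← hd, h2, max_self] at this
  have h2 : ∑ j ∈ Finset.range n, ((σ ^ (j + 1) • x).coord - (σ ^ j • x).coord) = 0 := by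
    rw [Finset.sum_range_sub (fun j => (σ ^ j • x).coord), hσn, pow_zero, sub_self]
  have h3 : ‖(n : L) * d‖ ≤ ‖d‖ * ‖x.coord - y.coord‖ := by
    have : (n : L) * d = -∑ j ∈ Finset.range n,
        ((σ ^ (j + 1) • x).coord - (σ ^ j • x).coord - d) := by
      rw [Finset.sum_sub_distrib, h2, Finset.sum_const, Finset.card_range, nsmul_eq_mul]
      ring
    rw [this, norm_neg]
    exact IsUltrametricDist.norm_sum_le_of_forall_le_of_nonneg (by positivity) fun j _ => h1 j
  have h4 : d = 0 := by
    by_contra hne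
    rw [norm_mul, mul_comm] at h3
    exact (le_of_mul_le_mul_left h3 (norm_pos_iff.mpr hne)).not_gt hx
  exact DiskPoint.ext (sub_eq_zero.mp h4)

end Multiplier

/-! ### The displacement of an automorphism -/

section Displacement

open Filter Topology

variable {K : Type*} [NontriviallyNormedField K] [IsUltrametricDist K]
variable {L : Type*} [NormedField L] [NormedAlgebra K L] [IsUltrametricDist L] [CompleteSpace L]

theorem WeierstrassData.norm_evalAt {f : diskFunctions K} (D : WeierstrassData f)
    (hs : (D.P.map (algebraMap K L)).Splits) (x : DiskPoint L) :
    ‖evalAt x.coord x.norm_lt f‖ =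
      ‖D.c‖ * ((D.P.aroots L).map fun r => ‖x.coord - r‖).prod := by
  obtain ⟨w, hw, huw⟩ := D.integral_inv
  -- The unit factor and its inverse are both integral, hence both bounded by 1.
  have hu : ‖evalAt x.coord x.norm_lt D.u‖ = 1 := by
    have h1 : ‖evalAt x.coord x.norm_lt D.u‖ * ‖evalAt x.coord x.norm_lt w‖ = 1 := by
      rw [← norm_mul, ← map_mul, huw, map_one, norm_one]
    nlinarith [norm_evalAt_le x.norm_lt D.integral, norm_evalAt_le x.norm_lt hw,
      norm_nonneg (evalAt x.coord x.norm_lt D.u), norm_nonneg (evalAt x.coord x.norm_lt w)]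
  have hP : Polynomial.aeval x.coord D.P = ((D.P.aroots L).map fun r => x.coord - r).prod := by
    rw [hs.aeval_eq_prod_aroots, D.monic.leadingCoeff, map_one, one_mul]
  conv_lhs => rw [D.eq_mul]
  rw [map_smul, map_mul, ← Polynomial.aeval_algHom_apply, evalAt_coordinate, hP, norm_smul,
    norm_mul, hu, mul_one]
  congr 1
  have := map_multiset_prod (normHom : L →*₀ ℝ) ((D.P.aroots L).map fun r => x.coord - r)
  rw [Multiset.map_map] at this
  exact this

/-- For `|r| ≥ 1` the leading term of a distinguished polynomial strictly dominates all the others,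
so it could not cancel. -/
theorem WeierstrassData.norm_lt_one_of_mem_aroots {f : diskFunctions K} (D : WeierstrassData f)
    {r : L} (hr : r ∈ D.P.aroots L) : ‖r‖ < 1 := by
  by_contra h
  rw [not_lt] at h
  have h0 : Polynomial.aeval r D.P = 0 := (Polynomial.mem_aroots.mp hr).2
  rw [Polynomial.aeval_eq_sum_range, Finset.sum_range_succ, D.monic.coeff_natDegree, one_smul] at h0
  have h1 : ‖r ^ D.P.natDegree‖ =
      ‖∑ i ∈ Finset.range D.P.natDegree, D.P.coeff i • r ^ i‖ := by
    rw [eq_neg_of_add_eq_zero_right h0, norm_neg]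
  have hpos : 0 < ‖r‖ ^ D.P.natDegree := by positivity
  by_cases hd : D.P.natDegree = 0
  · rw [hd, Finset.range_zero, Finset.sum_empty, pow_zero, norm_one, norm_zero] at h1
    exact one_ne_zero h1
  · obtain ⟨i, hi, hle⟩ := IsUltrametricDist.exists_norm_finsetSum_le_of_nonempty
      (t := Finset.range D.P.natDegree) (Finset.nonempty_range_iff.mpr hd)
      (fun i => D.P.coeff i • r ^ i)
    have hi := Finset.mem_range.mp hi
    rw [← h1, norm_smul, norm_pow, norm_pow] at hle
    have h2 : ‖r‖ ^ i ≤ ‖r‖ ^ D.P.natDegree := pow_le_pow_right₀ h hi.le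
    have h3 := D.norm_coeff_lt i hi
    have h4 : ‖D.P.coeff i‖ * ‖r‖ ^ i ≤ ‖D.P.coeff i‖ * ‖r‖ ^ D.P.natDegree :=
      mul_le_mul_of_nonneg_left h2 (norm_nonneg _)
    have h5 : ‖D.P.coeff i‖ * ‖r‖ ^ D.P.natDegree < 1 * ‖r‖ ^ D.P.natDegree :=
      mul_lt_mul_of_pos_right h3 hpos
    linarith

/-- The Weierstrass data of `σ z - z`. -/
abbrev DisplacementData (σ : DiskAut K) := WeierstrassData (σ coordinate - coordinate)

variable {σ : DiskAut K} (D : DisplacementData σ)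

theorem nonempty_displacementData [CompleteSpace K] [IsDiscreteValuationRing (integerRing K)]
    (hσ : σ ≠ 1) : Nonempty (DisplacementData σ) := by
  refine nonempty_weierstrassData
    ((isIntegralSeries_aut_coordinate σ).sub isIntegralSeries_coordinate) fun h => hσ ?_
  ext1 f
  exact hom_eq_self_of_coordinate (σ : diskFunctions K →ₐ[K] diskFunctions K) (sub_eq_zero.mp h) f

theorem norm_displacementData_le_one : ‖D.c‖ ≤ 1 := by
  rw [← D.norm_coeff_natDegree]
  exact ((isIntegralSeries_aut_coordinate σ).sub isIntegralSeries_coordinate) _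

/-- Evaluating `σ(z) - z` at `x` gives the displacement of `σ⁻¹`, and the displacements of `σ` and
`σ⁻¹` at `x` have the same size because `σ` is an isometry. -/
theorem norm_coord_smul_sub_self_eq_prod_aroots (hs : (D.P.map (algebraMap K L)).Splits)
    (x : DiskPoint L) : ‖(σ • x).coord - x.coord‖ =
      ‖D.c‖ * ((D.P.aroots L).map fun r => ‖x.coord - r‖).prod := by
  rw [← D.norm_evalAt hs, map_sub, evalAt_coordinate]
  have h1 : (σ⁻¹ • x).coord = evalAt x.coord x.norm_lt (σ coordinate) := by
    rw [coord_smul, inv_inv]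
  rw [← h1, ← norm_coord_smul_sub σ (σ⁻¹ • x) x, smul_inv_smul, norm_sub_rev]

theorem smul_eq_iff_mem_aroots (hs : (D.P.map (algebraMap K L)).Splits) {x : DiskPoint L} :
    σ • x = x ↔ x.coord ∈ D.P.aroots L := by
  rw [DiskPoint.ext_iff, ← sub_eq_zero, ← norm_eq_zero,
    norm_coord_smul_sub_self_eq_prod_aroots D hs, mul_eq_zero, norm_eq_zero,
    or_iff_right D.c_ne_zero, Multiset.prod_eq_zero_iff, Multiset.mem_map]
  constructor
  · rintro ⟨r, hr, h⟩
    rwa [sub_eq_zero.mp (norm_eq_zero.mp h)]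
  · exact fun h => ⟨_, h, by rw [sub_self, norm_zero]⟩

/-- Derivative 1 would make all points near `y` fixed, whereas the fixed points are among the
finitely many roots of `P`. -/
theorem IsMultiplier.ne_one [CharZero L] (hs : (D.P.map (algebraMap K L)).Splits)
    (hfin : IsOfFinOrder σ) {y : DiskPoint L} (hy : σ • y = y) {ζ : L}
    (h : IsMultiplier σ y ζ) : ζ ≠ 1 := by
  classical
  rintro rfl
  obtain ⟨δ, hδ, hS⟩ := exists_norm_sub_eq (D.P.aroots L).toFinset y.coord
  have hn : 0 < orderOf σ := hfin.orderOf_pos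
  have hn' : 0 < ‖(orderOf σ : L)‖ := norm_pos_iff.mpr (Nat.cast_ne_zero.mpr hn.ne')
  obtain ⟨x, hx0, hx⟩ := exists_diskPoint_near K y (lt_min hδ hn')
  have h1 := h.smul_eq_of_one hy (pow_orderOf_eq_one σ) (hx.trans_le (min_le_right _ _))
  rw [smul_eq_iff_mem_aroots D hs] at h1
  have h2 := hS x.coord (Multiset.mem_toFinset.mpr h1)
    (sub_ne_zero.mp (norm_pos_iff.mp hx0)) x.coord (hx.trans_le (min_le_left _ _))
  rw [sub_self, norm_zero, norm_sub_rev] at h2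
  exact hx0.ne h2

/-- For `x` near `y` the displacement has size `|ζ - 1| |x - y|`; compare with the product formula
and cancel one factor `|x - y|`. A double root would leave another such factor and give `|ζ - 1| ≤
|x - y|`, which fails for `x` close enough to `y`. -/
theorem notMem_erase_and_norm_multiplier_sub_one [CharZero L] [DecidableEq L] (hs : (D.P.map (algebraMap K L)).Splits)
    (hfin : IsOfFinOrder σ) {y : DiskPoint L} (hy : σ • y = y) {ζ : L} (h : IsMultiplier σ y ζ) :
    y.coord ∉ (D.P.aroots L).erase y.coord ∧ ‖ζ - 1‖ =
      ‖D.c‖ * (((D.P.aroots L).erase y.coord).map fun r => ‖y.coord - r‖).prod := by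
  have hyr := (smul_eq_iff_mem_aroots D hs).mp hy
  have hζ : 0 < ‖ζ - 1‖ := norm_pos_iff.mpr (sub_ne_zero.mpr (h.ne_one D hs hfin hy))
  have key : ∀ x : DiskPoint L, 0 < ‖x.coord - y.coord‖ → ‖x.coord - y.coord‖ < ‖ζ - 1‖ →
      ‖ζ - 1‖ = ‖D.c‖ * (((D.P.aroots L).erase y.coord).map fun r => ‖x.coord - r‖).prod := by
    intro x hx0 hx
    have h1 := h.norm_sub_le x
    rw [hy] at h1
    have h2 : ‖(σ • x).coord - x.coord‖ = ‖(ζ - 1) * (x.coord - y.coord)‖ := by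
      refine norm_eq_of_norm_sub_lt ?_
      have : (σ • x).coord - x.coord - (ζ - 1) * (x.coord - y.coord) =
        (σ • x).coord - y.coord - ζ * (x.coord - y.coord) := by ring
      rw [this, norm_mul]
      exact h1.trans_lt (mul_lt_mul_of_pos_right hx hx0)
    rw [norm_coord_smul_sub_self_eq_prod_aroots D hs, norm_mul, ← Multiset.cons_erase hyr,
      Multiset.map_cons, Multiset.prod_cons, mul_left_comm, mul_comm ‖ζ - 1‖] at h2
    exact (mul_left_cancel₀ hx0.ne' h2).symm
  obtain ⟨δ, hδ, hS⟩ := exists_norm_sub_eq (D.P.aroots L).toFinset y.coord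
  obtain ⟨x, hx0, hx⟩ := exists_diskPoint_near K y (lt_min hδ hζ)
  have hkey := key x hx0 (hx.trans_le (min_le_right _ _))
  have hnot : y.coord ∉ (D.P.aroots L).erase y.coord := by
    intro hmem
    rw [← Multiset.cons_erase hmem, Multiset.map_cons, Multiset.prod_cons] at hkey
    have h3 : ((((D.P.aroots L).erase y.coord).erase y.coord).map
        fun r => ‖x.coord - r‖).prod ≤ 1 := by
      refine multiset_prod_map_le_one (fun r _ => norm_nonneg _) fun r hr => ?_
      exact (norm_sub_le_max_of_ultrametric _ _).trans (max_le x.norm_lt.le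
        (D.norm_lt_one_of_mem_aroots (Multiset.mem_of_mem_erase (Multiset.mem_of_mem_erase hr))).le)
    have h4 : ‖ζ - 1‖ ≤ ‖x.coord - y.coord‖ := by
      rw [hkey]
      refine (mul_le_of_le_one_left ?_ (norm_displacementData_le_one D)).trans
        (mul_le_of_le_one_right (norm_nonneg _) h3)
      refine mul_nonneg (norm_nonneg _) (Multiset.prod_nonneg ?_)
      intro a ha
      obtain ⟨r, -, rfl⟩ := Multiset.mem_map.mp ha
      exact norm_nonneg _
    exact h4.not_gt (hx.trans_le (min_le_right _ _))
  refine ⟨hnot, hkey.trans ?_⟩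
  congr 2
  refine Multiset.map_congr rfl fun r hr => ?_
  exact hS r (Multiset.mem_toFinset.mpr (Multiset.mem_of_mem_erase hr))
    (fun h => hnot (h ▸ hr)) x.coord (hx.trans_le (min_le_left _ _))

theorem nodup_aroots [CharZero L] (hs : (D.P.map (algebraMap K L)).Splits)
    (hfin : IsOfFinOrder σ) : (D.P.aroots L).Nodup := by
  classical
  rw [Multiset.nodup_iff_count_le_one]
  intro r
  by_contra hr
  have hmem : r ∈ D.P.aroots L := Multiset.count_pos.mp (by omega)
  set y : DiskPoint L := ⟨r, D.norm_lt_one_of_mem_aroots hmem⟩ with hy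
  have hfix : σ • y = y := (smul_eq_iff_mem_aroots D hs).mpr hmem
  obtain ⟨ζ, hζ⟩ := exists_isMultiplier σ y
  refine (notMem_erase_and_norm_multiplier_sub_one D hs hfin hfix hζ).1 ?_
  rw [← Multiset.count_pos, Multiset.count_erase_self]
  change 0 < Multiset.count r _ - 1
  omega

variable (L) in
open Classical in
/-- The coordinates of the fixed points of `σ`. -/
def fixedCoords : Finset L := (D.P.aroots L).toFinset

theorem smul_eq_iff_mem_fixedCoords (hs : (D.P.map (algebraMap K L)).Splits) {x : DiskPoint L} :
    σ • x = x ↔ x.coord ∈ fixedCoords L D := by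
  classical
  rw [smul_eq_iff_mem_aroots D hs, fixedCoords, Multiset.mem_toFinset]

theorem norm_lt_one_of_mem_fixedCoords {r : L} (hr : r ∈ fixedCoords L D) : ‖r‖ < 1 := by
  classical
  exact D.norm_lt_one_of_mem_aroots (Multiset.mem_toFinset.mp hr)

theorem fixedCoords_val [CharZero L] (hs : (D.P.map (algebraMap K L)).Splits)
    (hfin : IsOfFinOrder σ) : (fixedCoords L D).val = D.P.aroots L := by
  classical
  rw [fixedCoords, Multiset.toFinset_val]
  convert (nodup_aroots D hs hfin).dedup

theorem card_fixedCoords [CharZero L] (hs : (D.P.map (algebraMap K L)).Splits)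
    (hfin : IsOfFinOrder σ) : (fixedCoords L D).card = D.P.natDegree := by
  rw [Finset.card_def, fixedCoords_val D hs hfin, Polynomial.aroots,
    ← hs.natDegree_eq_card_roots, Polynomial.natDegree_map]

theorem norm_coord_smul_sub_self [CharZero L] (hs : (D.P.map (algebraMap K L)).Splits)
    (hfin : IsOfFinOrder σ) (x : DiskPoint L) : ‖(σ • x).coord - x.coord‖ =
      ‖D.c‖ * ∏ r ∈ fixedCoords L D, ‖x.coord - r‖ := by
  rw [norm_coord_smul_sub_self_eq_prod_aroots D hs, Finset.prod, fixedCoords_val D hs hfin]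

theorem norm_multiplier_sub_one [CharZero L] [DecidableEq L]
    (hs : (D.P.map (algebraMap K L)).Splits)
    (hfin : IsOfFinOrder σ) {y : DiskPoint L} (hy : σ • y = y) {ζ : L} (h : IsMultiplier σ y ζ) :
    ‖ζ - 1‖ = ‖D.c‖ * ∏ r ∈ (fixedCoords L D).erase y.coord, ‖y.coord - r‖ := by
  rw [(notMem_erase_and_norm_multiplier_sub_one D hs hfin hy h).2, Finset.prod, Finset.erase_val, fixedCoords_val D hs hfin]

end Displacement

/-! ### Points in general position -/

section GenericPoint

variable {K : Type*} [NontriviallyNormedField K] [IsUltrametricDist K]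
variable {L : Type*} [NormedField L] [NormedAlgebra K L] [IsUltrametricDist L]

/-- The circle of radius `‖c‖` around `y` contains a point at maximal distance from all the points
of a given finite set. -/
theorem exists_generic_diskPoint [Infinite (IsLocalRing.ResidueField (integerRing K))]
    (S : Finset L) (y : DiskPoint L) {c : L} (hc : c ≠ 0) (hc1 : ‖c‖ < 1) :
    ∃ x : DiskPoint L, ‖x.coord - y.coord‖ = ‖c‖ ∧
      ∀ s ∈ S, ‖x.coord - s‖ = max ‖c‖ ‖y.coord - s‖ := by
  have hc0 : 0 < ‖c‖ := norm_pos_iff.mpr hc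
  choose lift hlift using IsLocalRing.residue_surjective (R := integerRing K)
  have hnorm : ∀ a : integerRing K, ‖algebraMap K L (a : K)‖ = ‖(a : K)‖ := fun a =>
    norm_algebraMap' L _
  have hunit : ∀ a, a ≠ 0 → ‖algebraMap K L (lift a : K) * c‖ = ‖c‖ := by
    intro a ha
    rw [norm_mul, hnorm]
    have h1 : ¬ ‖(lift a : K)‖ < 1 := fun h => ha (by rw [← hlift a, residue_eq_zero_iff.mpr h])
    rw [(norm_coe_integerRing_le _).antisymm (not_lt.mp h1), one_mul]
  set bad : L → Set (IsLocalRing.ResidueField (integerRing K)) := fun s =>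
    {a | a ≠ 0 ∧ ‖y.coord + algebraMap K L (lift a : K) * c - s‖ ≠ max ‖c‖ ‖y.coord - s‖} with hbad
  -- Each `s` excludes at most one nonzero residue class: two bad translates lie in the same open
  -- ball about `s`, so their residues agree. Since the residue field is infinite, some class avoids
  -- all of `S`.
  have hsub : ∀ s, (bad s).Subsingleton := by
    intro s
    have hlt : ∀ a ∈ bad s, ‖y.coord - s + algebraMap K L (lift a : K) * c‖ < ‖c‖ := by
      rintro a ⟨ha, hne⟩
      have h1 : y.coord + algebraMap K L (lift a : K) * c - s =
        y.coord - s + algebraMap K L (lift a : K) * c := by ring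
      rw [h1] at hne
      have h2 : ‖y.coord - s‖ = ‖c‖ := by
        by_contra h
        refine hne ?_
        rw [IsUltrametricDist.norm_add_eq_max_of_norm_ne_norm (by rwa [hunit a ha]), hunit a ha,
          max_comm]
      have h3 := IsUltrametricDist.norm_add_le_max (y.coord - s) (algebraMap K L (lift a : K) * c)
      rw [hunit a ha, h2, max_self] at h3
      rw [h2, max_self] at hne
      exact lt_of_le_of_ne h3 hne
    intro a ha b hb
    have h1 : ‖(algebraMap K L (lift a : K) - algebraMap K L (lift b : K)) * c‖ < ‖c‖ := by
      have : (algebraMap K L (lift a : K) - algebraMap K L (lift b : K)) * c =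
        (y.coord - s + algebraMap K L (lift a : K) * c) -
          (y.coord - s + algebraMap K L (lift b : K) * c) := by ring
      rw [this]
      exact (norm_sub_le_max_of_ultrametric _ _).trans_lt (max_lt (hlt a ha) (hlt b hb))
    have h2 : ‖((lift a - lift b : integerRing K) : K)‖ < 1 := by
      rw [← hnorm, AddSubgroupClass.coe_sub, map_sub]
      rw [norm_mul] at h1
      exact lt_of_mul_lt_mul_right (by rwa [one_mul]) hc0.le
    rw [← residue_eq_zero_iff, map_sub, hlift, hlift, sub_eq_zero] at h2
    exact h2
  have hfin : ({0} ∪ ⋃ s ∈ S, bad s).Finite :=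
    (Set.finite_singleton _).union (S.finite_toSet.biUnion fun s _ => (hsub s).finite)
  obtain ⟨a, ha⟩ := hfin.exists_notMem
  simp only [Set.mem_union, Set.mem_singleton_iff, Set.mem_iUnion, not_or, not_exists] at ha
  refine ⟨⟨y.coord + algebraMap K L (lift a : K) * c, ?_⟩, ?_, fun s hs => ?_⟩
  · refine (IsUltrametricDist.norm_add_le_max _ _).trans_lt (max_lt y.norm_lt ?_)
    rwa [hunit a ha.1]
  · rw [add_sub_cancel_left, hunit a ha.1]
  · by_contra h
    exact ha.2 s hs ⟨ha.1, h⟩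

end GenericPoint

/-! ### Gauss norms -/

section GaussNorm

variable {K : Type*} [NontriviallyNormedField K] [IsUltrametricDist K]

theorem norm_coeff_hom_le (σ : diskFunctions K →ₐ[K] diskFunctions K) {f : diskFunctions K} {c : K}
    (hc : c ≠ 0) (hf : ∀ i, ‖PowerSeries.coeff i (f : PowerSeries K)‖ ≤ ‖c‖) (i : ℕ) :
    ‖PowerSeries.coeff i (σ f : PowerSeries K)‖ ≤ ‖c‖ := by
  have h1 : IsIntegralSeries ((c⁻¹ • f : diskFunctions K) : PowerSeries K) := fun i => by
    change ‖PowerSeries.coeff i (c⁻¹ • (f : PowerSeries K))‖ ≤ 1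
    rw [PowerSeries.coeff_smul, smul_eq_mul, norm_mul, norm_inv]
    exact inv_mul_le_one_of_le₀ (hf i) (norm_nonneg _)
  have h2 := isIntegralSeries_hom σ h1 i
  rw [map_smul] at h2
  change ‖PowerSeries.coeff i (c⁻¹ • (σ f : PowerSeries K))‖ ≤ 1 at h2
  rwa [PowerSeries.coeff_smul, smul_eq_mul, norm_mul, norm_inv,
    inv_mul_le_one₀ (norm_pos_iff.mpr hc)] at h2

/-- Follows from `στ(z) - z = σ(τ(z) - z) + (σ(z) - z)`, as `σ` does not increase the Gauss norm. -/
theorem norm_displacementData_mul_le {σ τ : DiskAut K} (D : DisplacementData σ)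
    (D' : DisplacementData τ) (E : DisplacementData (σ * τ)) : ‖E.c‖ ≤ max ‖D.c‖ ‖D'.c‖ := by
  rw [← E.norm_coeff_natDegree]
  generalize E.P.natDegree = n
  have h1 : (σ * τ) coordinate - coordinate =
      σ (τ coordinate - coordinate) + (σ coordinate - coordinate) := by
    rw [AlgEquiv.mul_apply, map_sub]; ring
  rw [h1]
  change ‖PowerSeries.coeff _ ((σ (τ coordinate - coordinate) : PowerSeries K) +
    ((σ coordinate - coordinate : diskFunctions K) : PowerSeries K))‖ ≤ _
  rw [map_add, max_comm]
  refine (IsUltrametricDist.norm_add_le_max _ _).trans (max_le_max ?_ (D.norm_coeff_le _))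
  exact norm_coeff_hom_le (σ : diskFunctions K →ₐ[K] diskFunctions K) D'.c_ne_zero
    D'.norm_coeff_le _

end GaussNorm

/-! ### Roots of unity -/

section RootsOfUnity

variable (p : ℕ) [hp : Fact p.Prime] (K : Type*) [NontriviallyNormedField K] [IsUltrametricDist K]
  [CharZero K] [CharP (IsLocalRing.ResidueField (integerRing K)) p]
variable {L : Type*} [NormedField L] [NormedAlgebra K L] [IsUltrametricDist L]

theorem norm_natCast_extension {K L : Type*} [NormedField K] [NormedField L] [NormedAlgebra K L]
    (n : ℕ) : ‖(n : L)‖ = ‖(n : K)‖ := by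
  rw [← map_natCast (algebraMap K L), norm_algebraMap']

theorem norm_eq_one_of_isOfFinOrder {ζ : L} (h : 0 < orderOf ζ) : ‖ζ‖ = 1 := by
  have h1 : ‖ζ‖ ^ orderOf ζ = 1 := by rw [← norm_pow, pow_orderOf_eq_one, norm_one]
  exact (pow_eq_one_iff_of_nonneg (norm_nonneg _) h.ne').mp h1

theorem norm_pow_sub_one_le {ζ : L} (h : ‖ζ‖ ≤ 1) (i : ℕ) : ‖ζ ^ i - 1‖ ≤ ‖ζ - 1‖ := by
  have := norm_pow_sub_pow_le h (norm_one (α := L)).le i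
  rwa [one_pow] at this

/-- Raising to a power of `p` gives `ξ ≠ 1` of order `m` prime to `p`. If `|ζ - 1| < 1`, then `ξ`
reduces to 1 and the vanishing sum of its `m` powers reduces to `m`, which is a unit. -/
theorem norm_sub_one_of_orderOf_ne (p : ℕ) [hp : Fact p.Prime] (K : Type*)
    [NontriviallyNormedField K] [IsUltrametricDist K] [CharZero K]
    [CharP (IsLocalRing.ResidueField (integerRing K)) p] {L : Type*} [NormedField L]
    [NormedAlgebra K L] [IsUltrametricDist L] {ζ : L} (h0 : 0 < orderOf ζ) (hζ : ∀ k, orderOf ζ ≠ p ^ k) :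
    ‖ζ - 1‖ = 1 := by
  have hζ1 := norm_eq_one_of_isOfFinOrder h0
  refine le_antisymm ?_ (not_lt.mp fun hlt => ?_)
  · refine (norm_sub_le_max_of_ultrametric _ _).trans ?_
    rw [hζ1, norm_one, max_self]
  obtain ⟨a, m, hm, hn⟩ := Nat.exists_eq_pow_mul_and_not_dvd h0.ne' p hp.out.ne_one
  have hpa : p ^ a ≠ 0 := pow_ne_zero _ hp.out.ne_zero
  set ξ := ζ ^ p ^ a with hξ
  have hord : orderOf ξ = m := by
    rw [hξ, orderOf_pow_of_dvd hpa (hn ▸ dvd_mul_right _ _), hn,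
      Nat.mul_div_cancel_left _ (Nat.pos_of_ne_zero hpa)]
  have hm1 : m ≠ 1 := fun h => hζ a (by rw [hn, h, mul_one])
  have hξ1 : ‖ξ - 1‖ < 1 := (norm_pow_sub_one_le hζ1.le _).trans_lt hlt
  have hξn : ‖ξ‖ ≤ 1 := by rw [hξ, norm_pow, hζ1, one_pow]
  have hne : ξ ≠ 1 := fun h => hm1 (by rw [← hord, h, orderOf_one])
  have hsum : ∑ i ∈ Finset.range m, ξ ^ i = 0 := by
    have h1 := mul_geom_sum ξ m
    rw [← hord, pow_orderOf_eq_one, sub_self, hord] at h1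
    exact (mul_eq_zero.mp h1).resolve_left (sub_ne_zero.mpr hne)
  have h2 : ‖(m : L)‖ ≤ ‖ξ - 1‖ := by
    have : (m : L) = -∑ i ∈ Finset.range m, (ξ ^ i - 1) := by
      rw [Finset.sum_sub_distrib, hsum, Finset.sum_const, Finset.card_range, nsmul_eq_mul]
      ring
    rw [this, norm_neg]
    exact IsUltrametricDist.norm_sum_le_of_forall_le_of_nonneg (norm_nonneg _)
      fun i _ => norm_pow_sub_one_le hξn i
  rw [norm_natCast_extension (K := K), norm_natCast_eq_one p K hm] at h2
  exact h2.not_gt hξ1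

/-- Primitive roots of the same order are powers of one another, so all `1 - μ` have the same
absolute value; their product is the cyclotomic polynomial at 1, which is `p`, and there are `p ^ k
(p - 1)` of them. -/
theorem norm_sub_one_of_orderOf_eq {ζ : L} {k : ℕ} (hζ : orderOf ζ = p ^ (k + 1)) :
    ‖ζ - 1‖ = absOfVal p K (1 / ((p : ℚ) ^ k * (p - 1))) := by
  have h0 : 0 < orderOf ζ := hζ ▸ pow_pos hp.out.pos _
  have hprim : IsPrimitiveRoot ζ (p ^ (k + 1)) := IsPrimitiveRoot.iff_orderOf.mpr hζ
  have heq : ∀ μ ∈ primitiveRoots (p ^ (k + 1)) L, ‖1 - μ‖ = ‖ζ - 1‖ := by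
    intro μ hμ
    have hμ := isPrimitiveRoot_of_mem_primitiveRoots hμ
    have hμ0 : 0 < orderOf μ := hμ.eq_orderOf ▸ pow_pos hp.out.pos _
    have hpos : NeZero (p ^ (k + 1)) := ⟨pow_ne_zero _ hp.out.ne_zero⟩
    obtain ⟨i, -, hi⟩ := hprim.eq_pow_of_pow_eq_one hμ.pow_eq_one
    obtain ⟨j, -, hj⟩ := hμ.eq_pow_of_pow_eq_one hprim.pow_eq_one
    rw [norm_sub_rev]
    refine le_antisymm ?_ ?_
    · rw [← hi]; exact norm_pow_sub_one_le (norm_eq_one_of_isOfFinOrder h0).le i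
    · rw [← hj]; exact norm_pow_sub_one_le (norm_eq_one_of_isOfFinOrder hμ0).le j
  have hprod : ‖(p : L)‖ = ‖ζ - 1‖ ^ (p ^ k * (p - 1)) := by
    have h1 := Polynomial.eval_one_cyclotomic_prime_pow (R := L) (p := p) k
    rw [Polynomial.cyclotomic_eq_prod_X_sub_primitiveRoots hprim, Polynomial.eval_prod] at h1
    rw [← h1, norm_prod, Finset.prod_congr rfl fun μ hμ => by
      rw [Polynomial.eval_sub, Polynomial.eval_X, Polynomial.eval_C, heq μ hμ], Finset.prod_const,
      hprim.card_primitiveRoots, Nat.totient_prime_pow_succ hp.out]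
  have hp1 : 0 < p - 1 := Nat.sub_pos_of_lt hp.out.one_lt
  have hd : ((p ^ k * (p - 1) : ℕ) : ℝ) ≠ 0 :=
    Nat.cast_ne_zero.mpr (mul_pos (pow_pos hp.out.pos k) hp1).ne'
  rw [norm_natCast_extension (K := K)] at hprod
  rw [absOfVal, hprod, ← Real.rpow_natCast, ← Real.rpow_mul (norm_nonneg _)]
  have hcast : ((p ^ k * (p - 1) : ℕ) : ℝ) = (((p : ℚ) ^ k * (p - 1) : ℚ) : ℝ) := by
    push_cast [Nat.cast_sub hp.out.one_lt.le]
    ring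
  rw [Rat.cast_div, Rat.cast_one, ← hcast, mul_one_div_cancel hd, Real.rpow_one]

end RootsOfUnity

/-! ### The fixed points of a finite group of automorphisms -/

section Model

/-- The finite set of all points of the disk with nontrivial stabilizer in `G`, indexed by `Δ`, over
an extension `L` that contains all their coordinates. -/
structure FixedPointModel {K : Type*} [NontriviallyNormedField K] [IsUltrametricDist K]
    (G : Subgroup (DiskAut K)) (L : Type*) [NormedField L] [NormedAlgebra K L]
    [IsUltrametricDist L] [CompleteSpace L] (Δ : Type) [MulAction G Δ] where
  data : ∀ σ : G, σ ≠ 1 → DisplacementData (σ : DiskAut K)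
  splits : ∀ σ h, ((data σ h).P.map (algebraMap K L)).Splits
  pt : Δ → DiskPoint L
  pt_injective : Function.Injective pt
  pt_smul : ∀ (σ : G) (y : Δ), pt (σ • y) = (σ : DiskAut K) • pt y
  exists_pt : ∀ σ : G, σ ≠ 1 → ∀ x : DiskPoint L, (σ : DiskAut K) • x = x → ∃ y, pt y = x
  exists_smul_eq : ∀ y : Δ, ∃ σ : G, σ ≠ 1 ∧ σ • y = y

namespace FixedPointModel

variable {p : ℕ} [hp : Fact p.Prime] {K : Type*} [NontriviallyNormedField K] [IsUltrametricDist K]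
  [CharZero K] [CharP (IsLocalRing.ResidueField (integerRing K)) p]
  [IsDiscreteValuationRing (integerRing K)] [CompleteSpace K]
  [Infinite (IsLocalRing.ResidueField (integerRing K))]
variable {L : Type*} [NormedField L] [NormedAlgebra K L] [IsUltrametricDist L] [CompleteSpace L]
  [Algebra.IsAlgebraic K L] [CharZero L]
variable {G : Subgroup (DiskAut K)} [Finite G] {Δ : Type} [Fintype Δ] [MulAction G Δ]
variable (M : FixedPointModel G L Δ)

theorem isOfFinOrder_coe (σ : G) : IsOfFinOrder (σ : DiskAut K) :=
  (Submonoid.isOfFinOrder_coe (H := G.toSubmonoid)).mpr (isOfFinOrder_of_finite σ)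

/-- The coordinates of the points of `Δ`. -/
def coordEmbedding : Δ ↪ L :=
  ⟨fun y => (M.pt y).coord, fun _ _ h => M.pt_injective (DiskPoint.ext h)⟩

theorem smul_pt_eq_iff (σ : G) (y : Δ) : (σ : DiskAut K) • M.pt y = M.pt y ↔ σ • y = y := by
  rw [← M.pt_smul]
  exact M.pt_injective.eq_iff

theorem fixedCoords_eq_map {σ : G} (h : σ ≠ 1) :
    fixedCoords L (M.data σ h) = (fix σ : Finset Δ).map M.coordEmbedding := by
  ext r
  rw [Finset.mem_map]
  constructor
  · intro hr
    have hr1 := norm_lt_one_of_mem_fixedCoords _ hr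
    have hfix := (smul_eq_iff_mem_fixedCoords (M.data σ h) (M.splits σ h) (x := ⟨r, hr1⟩)).mpr hr
    obtain ⟨y, hy⟩ := M.exists_pt σ h _ hfix
    refine ⟨y, mem_fix.mpr ((M.smul_pt_eq_iff σ y).mp (by rw [hy]; exact hfix)), ?_⟩
    exact congrArg DiskPoint.coord hy
  · rintro ⟨y, hy, rfl⟩
    exact (smul_eq_iff_mem_fixedCoords (M.data σ h) (M.splits σ h)).mp
      ((M.smul_pt_eq_iff σ y).mpr (mem_fix.mp hy))

theorem card_fix {σ : G} (h : σ ≠ 1) : (fix σ : Finset Δ).card = (M.data σ h).P.natDegree := by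
  rw [← card_fixedCoords (M.data σ h) (M.splits σ h) (isOfFinOrder_coe σ), M.fixedCoords_eq_map h,
    Finset.card_map]

variable (p) in
/-- The Gauss valuation of `σ z - z`. -/
def gauss (σ : G) : ℚ :=
  open Classical in
  if h : σ = 1 then 0 else (exists_norm_eq_absOfVal p (M.data σ h).c_ne_zero).choose

theorem norm_c_eq {σ : G} (h : σ ≠ 1) : ‖(M.data σ h).c‖ = absOfVal p K (M.gauss p σ) := by
  rw [gauss, dif_neg h]
  exact (exists_norm_eq_absOfVal p (M.data σ h).c_ne_zero).choose_spec

theorem norm_smul_sub_self {σ : G} (h : σ ≠ 1) (x : DiskPoint L) :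
    ‖((σ : DiskAut K) • x).coord - x.coord‖ =
      absOfVal p K (M.gauss p σ) * ∏ y ∈ fix σ, ‖x.coord - (M.pt y).coord‖ := by
  rw [norm_coord_smul_sub_self (M.data σ h) (M.splits σ h) (isOfFinOrder_coe σ),
    M.fixedCoords_eq_map h, Finset.prod_map, M.norm_c_eq h]
  rfl

theorem exists_valDiff (y y' : Δ) : ∃ q : ℚ, y ≠ y' →
    ‖(M.pt y).coord - (M.pt y').coord‖ = absOfVal p K q := by
  by_cases h : y = y'
  · exact ⟨0, fun h' => absurd h h'⟩
  · obtain ⟨q, hq⟩ := exists_norm_eq_absOfVal_of_isAlgebraic (K := K) p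
      (sub_ne_zero.mpr fun h' => h (M.pt_injective (DiskPoint.ext h')))
    exact ⟨q, fun _ => hq⟩

variable (p) in
-- The bound is taken to be an integer so that it is the valuation of a power of `p`; a generic
-- point is needed on that circle too.
theorem exists_top : ∃ R : ℕ, 0 < R ∧ ∀ y y', (M.exists_valDiff (p := p) y y').choose < R := by
  obtain ⟨q, hq⟩ := (Set.finite_range fun yy : Δ × Δ =>
    (M.exists_valDiff (p := p) yy.1 yy.2).choose).bddAbove
  obtain ⟨n, hn⟩ := exists_nat_gt q
  refine ⟨n + 1, Nat.succ_pos n, fun y y' => (hq ⟨(y, y'), rfl⟩).trans_lt (hn.trans ?_)⟩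
  push_cast
  exact lt_add_one _

variable (p) in
/-- The valuation of the difference of two points, with a large number as the value of `0`. -/
def valDiff (y y' : Δ) : ℚ :=
  open Classical in
  if y = y' then (M.exists_top p).choose else (M.exists_valDiff (p := p) y y').choose

theorem norm_pt_sub {y y' : Δ} (h : y ≠ y') :
    ‖(M.pt y).coord - (M.pt y').coord‖ = absOfVal p K (M.valDiff p y y') := by
  rw [valDiff, if_neg h]
  exact (M.exists_valDiff y y').choose_spec h

theorem valDiff_self (y : Δ) : M.valDiff p y y = (M.exists_top p).choose := if_pos rfl

theorem valDiff_lt {y y' : Δ} (h : y ≠ y') : M.valDiff p y y' < (M.exists_top p).choose := by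
  rw [valDiff, if_neg h]
  exact (M.exists_top p).choose_spec.2 y y'

theorem valDiff_le (y y' : Δ) : M.valDiff p y y' ≤ (M.exists_top p).choose := by
  by_cases h : y = y'
  · rw [h, valDiff_self]
  · exact (M.valDiff_lt h).le

theorem norm_pt_sub_le (y y' : Δ) :
    ‖(M.pt y).coord - (M.pt y').coord‖ ≤ absOfVal p K (M.valDiff p y y') := by
  by_cases h : y = y'
  · rw [h, sub_self, norm_zero]
    exact (absOfVal_pos p K _).le
  · exact (M.norm_pt_sub h).le

theorem valDiff_pos (y y' : Δ) : 0 < M.valDiff p y y' := by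
  by_cases h : y = y'
  · rw [h, valDiff_self]
    exact_mod_cast (M.exists_top p).choose_spec.1
  · rw [← absOfVal_lt_iff p K, ← M.norm_pt_sub h, absOfVal_zero]
    exact (norm_sub_le_max_of_ultrametric _ _).trans_lt (max_lt (M.pt y).norm_lt (M.pt y').norm_lt)

theorem valDiff_comm (y y' : Δ) : M.valDiff p y y' = M.valDiff p y' y := by
  by_cases h : y = y'
  · rw [h]
  · exact absOfVal_injective p K (by
      rw [← M.norm_pt_sub h, ← M.norm_pt_sub (Ne.symm h), norm_sub_rev])

theorem min_valDiff_le (x y z : Δ) :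
    min (M.valDiff p x y) (M.valDiff p y z) ≤ M.valDiff p x z := by
  by_cases h : x = z
  · rw [h, valDiff_self]
    exact (min_le_right _ _).trans (M.valDiff_le _ _)
  · rw [← absOfVal_le_iff p K, absOfVal_min, ← M.norm_pt_sub h,
      ← sub_add_sub_cancel (M.pt x).coord (M.pt y).coord]
    exact (IsUltrametricDist.norm_add_le_max _ _).trans
      (max_le_max (M.norm_pt_sub_le x y) (M.norm_pt_sub_le y z))

theorem valDiff_smul (σ : G) (x y : Δ) : M.valDiff p (σ • x) (σ • y) = M.valDiff p x y := by
  by_cases h : x = y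
  · rw [h, valDiff_self, valDiff_self]
  · exact absOfVal_injective p K (by
      rw [← M.norm_pt_sub h, ← M.norm_pt_sub (smul_left_cancel_iff σ |>.not.mpr h), M.pt_smul,
        M.pt_smul, norm_coord_smul_sub])

theorem absOfVal_min_valDiff (y y₁ y' : Δ) :
    absOfVal p K (min (M.valDiff p y y₁) (M.valDiff p y y')) =
      max (absOfVal p K (M.valDiff p y y₁)) ‖(M.pt y).coord - (M.pt y').coord‖ := by
  by_cases h : y = y'
  · subst h
    rw [valDiff_self, min_eq_left (M.valDiff_le _ _), sub_self, norm_zero,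
      max_eq_left (absOfVal_pos p K _).le]
  · rw [absOfVal_min, M.norm_pt_sub h]

theorem exists_norm_eq_absOfVal_valDiff (y y₁ : Δ) :
    ∃ c : L, ‖c‖ = absOfVal p K (M.valDiff p y y₁) := by
  by_cases h : y = y₁
  · refine ⟨algebraMap K L ((p : K) ^ (M.exists_top p).choose), ?_⟩
    rw [h, valDiff_self, absOfVal_natCast, norm_algebraMap']
  · exact ⟨_, M.norm_pt_sub h⟩

theorem exists_generic (y y₁ : Δ) : ∃ x : DiskPoint L,
    ‖x.coord - (M.pt y).coord‖ ≤ absOfVal p K (M.valDiff p y y₁) ∧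
    ∀ y', ‖x.coord - (M.pt y').coord‖ =
      absOfVal p K (min (M.valDiff p y y₁) (M.valDiff p y y')) := by
  obtain ⟨c, hc⟩ := M.exists_norm_eq_absOfVal_valDiff (p := p) y y₁
  have hc0 : c ≠ 0 := norm_pos_iff.mp (hc ▸ absOfVal_pos p K _)
  have hc1 : ‖c‖ < 1 := by
    rw [hc, ← absOfVal_zero p K, absOfVal_lt_iff]
    exact M.valDiff_pos y y₁
  obtain ⟨x, hx, hx'⟩ := exists_generic_diskPoint (K := K) (Finset.univ.map M.coordEmbedding)
    (M.pt y) hc0 hc1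
  refine ⟨x, (hx.trans hc).le, fun y' => ?_⟩
  rw [absOfVal_min_valDiff, ← hc]
  exact hx' _ (Finset.mem_map_of_mem _ (Finset.mem_univ y'))

theorem norm_smul_sub_self_eq {σ : G} (h : σ ≠ 1) {y y₁ : Δ} {x : DiskPoint L}
    (hx : ∀ y', ‖x.coord - (M.pt y').coord‖ =
      absOfVal p K (min (M.valDiff p y y₁) (M.valDiff p y y'))) :
    ‖((σ : DiskAut K) • x).coord - x.coord‖ = absOfVal p K
      (M.gauss p σ + ∑ y' ∈ fix σ, min (M.valDiff p y y₁) (M.valDiff p y y')) := by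
  rw [M.norm_smul_sub_self (p := p) h, absOfVal_add, absOfVal_sum]
  simp only [hx]

theorem norm_smul_sub_self_le {σ : G} (h : σ ≠ 1) {y y₁ : Δ} {x : DiskPoint L}
    (hx : ‖x.coord - (M.pt y).coord‖ ≤ absOfVal p K (M.valDiff p y y₁)) :
    ‖((σ : DiskAut K) • x).coord - x.coord‖ ≤ absOfVal p K
      (M.gauss p σ + ∑ y' ∈ fix σ, min (M.valDiff p y y₁) (M.valDiff p y y')) := by
  rw [M.norm_smul_sub_self (p := p) h, absOfVal_add, absOfVal_sum]
  refine mul_le_mul_of_nonneg_left (Finset.prod_le_prod (fun _ _ => norm_nonneg _) fun y' _ => ?_)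
    (absOfVal_pos p K _).le
  rw [absOfVal_min_valDiff, ← sub_add_sub_cancel x.coord (M.pt y).coord]
  exact (IsUltrametricDist.norm_add_le_max _ _).trans (max_le_max hx le_rfl)

theorem norm_smul_sub_pt_le {σ : G} {y y₁ : Δ} (h : M.valDiff p y y₁ ≤ M.valDiff p y (σ • y))
    {x : DiskPoint L} (hx : ‖x.coord - (M.pt y).coord‖ ≤ absOfVal p K (M.valDiff p y y₁)) :
    ‖((σ : DiskAut K) • x).coord - (M.pt y).coord‖ ≤ absOfVal p K (M.valDiff p y y₁) := by
  rw [← sub_add_sub_cancel _ (M.pt (σ • y)).coord]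
  refine (IsUltrametricDist.norm_add_le_max _ _).trans (max_le ?_ ?_)
  · rwa [M.pt_smul, norm_coord_smul_sub]
  · refine (M.norm_pt_sub_le (σ • y) y).trans ((absOfVal_le_iff p K).mpr ?_)
    rwa [M.valDiff_comm (σ • y)]

theorem exists_smul_ne (M : FixedPointModel G L Δ) {σ : G} (h : σ ≠ 1) : ∃ x : DiskPoint L, (σ : DiskAut K) • x ≠ x := by
  obtain ⟨δ, hδ, hS⟩ := exists_norm_sub_eq (fixedCoords L (M.data σ h)) 0
  obtain ⟨x, hx0, hx⟩ := exists_diskPoint_near K (⟨0, by simp⟩ : DiskPoint L) hδ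
  refine ⟨x, fun hfix => ?_⟩
  rw [smul_eq_iff_mem_fixedCoords (M.data σ h) (M.splits σ h)] at hfix
  have := hS _ hfix (sub_ne_zero.mp (norm_pos_iff.mp hx0)) _ hx
  rw [sub_self, norm_zero, norm_sub_rev] at this
  exact hx0.ne this

/-- Compare displacements at a non-fixed `x` and at `τx`: they agree, and `τ` carries fixed points
of `σ` to those of the conjugate, so the nonzero products cancel. -/
theorem gauss_conj (σ τ : G) : M.gauss p (τ * σ * τ⁻¹) = M.gauss p σ := by
  by_cases h : σ = 1
  · rw [h, mul_one, mul_inv_cancel]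
  have h' : τ * σ * τ⁻¹ ≠ 1 := fun h' => h (conj_eq_one_iff.mp h')
  obtain ⟨x, hx⟩ := M.exists_smul_ne h
  have h1 := M.norm_smul_sub_self (p := p) h x
  have h2 := M.norm_smul_sub_self (p := p) h' ((τ : DiskAut K) • x)
  have h3 : ((τ * σ * τ⁻¹ : G) : DiskAut K) • (τ : DiskAut K) • x =
      (τ : DiskAut K) • (σ : DiskAut K) • x := by
    rw [Subgroup.coe_mul, Subgroup.coe_mul, Subgroup.coe_inv, mul_smul, mul_smul, inv_smul_smul]
  have h4 : ∏ y ∈ fix σ, ‖x.coord - (M.pt y).coord‖ =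
      ∏ y ∈ fix (τ * σ * τ⁻¹), ‖((τ : DiskAut K) • x).coord - (M.pt y).coord‖ := by
    refine Finset.prod_bij (fun y _ => τ • y) ?_ ?_ ?_ ?_
    · intro y hy
      rw [mem_fix] at hy ⊢
      rw [mul_smul, mul_smul, inv_smul_smul, hy]
    · exact fun _ _ _ _ h => smul_left_cancel τ h
    · intro y hy
      refine ⟨τ⁻¹ • y, ?_, smul_inv_smul τ y⟩
      rw [mem_fix, mul_smul, mul_smul] at hy
      rw [mem_fix, eq_inv_smul_iff, hy]
    · intro y _
      rw [M.pt_smul, norm_coord_smul_sub]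
  rw [h3, norm_coord_smul_sub, h1, h4] at h2
  have h5 : ‖((σ : DiskAut K) • x).coord - x.coord‖ ≠ 0 := by
    rw [norm_ne_zero_iff, sub_ne_zero]
    exact fun h => hx (DiskPoint.ext h)
  rw [h1, h4] at h5
  exact (absOfVal_injective p K (mul_right_cancel₀ (right_ne_zero_of_mul h5) h2)).symm

/-- The derivative at a point, as a character of the stabilizer. -/
def multiplierHom (y : Δ) : MulAction.stabilizer G y →* L where
  toFun σ := (exists_isMultiplier ((σ : G) : DiskAut K) (M.pt y)).choose
  map_one' := (exists_isMultiplier _ (M.pt y)).choose_spec.eq (isMultiplier_one _)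
  map_mul' _ τ := (exists_isMultiplier _ (M.pt y)).choose_spec.eq
    ((exists_isMultiplier _ (M.pt y)).choose_spec.mul
      (exists_isMultiplier _ (M.pt y)).choose_spec ((M.smul_pt_eq_iff _ _).mpr τ.2))

theorem isMultiplier_multiplierHom {y : Δ} (σ : MulAction.stabilizer G y) :
    IsMultiplier ((σ : G) : DiskAut K) (M.pt y) (M.multiplierHom y σ) :=
  (exists_isMultiplier _ (M.pt y)).choose_spec

theorem multiplierHom_injective (y : Δ) : Function.Injective (M.multiplierHom y) := by
  rw [injective_iff_map_eq_one]
  intro σ hσ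
  by_contra h
  have h' : (σ : G) ≠ 1 := fun h' => h (Subtype.ext h')
  exact (M.isMultiplier_multiplierHom σ).ne_one (M.data _ h') (M.splits _ h') (isOfFinOrder_coe _)
    ((M.smul_pt_eq_iff _ _).mpr σ.2) hσ

theorem orderOf_multiplierHom {y : Δ} (σ : MulAction.stabilizer G y) :
    orderOf (M.multiplierHom y σ) = orderOf (σ : G) := by
  rw [orderOf_injective _ (M.multiplierHom_injective y), Subgroup.orderOf_coe]

open Classical in
theorem norm_multiplierHom_sub_one {y : Δ} (σ : MulAction.stabilizer G y) (h : (σ : G) ≠ 1) :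
    ‖M.multiplierHom y σ - 1‖ = absOfVal p K (M.gauss p (σ : G) +
      ∑ y' ∈ (fix (σ : G)).erase y, M.valDiff p y y') := by
  have h1 : (fixedCoords L (M.data _ h)).erase (M.pt y).coord =
      ((fix (σ : G)).erase y).map M.coordEmbedding := by
    rw [Finset.map_erase, M.fixedCoords_eq_map h]
    rfl
  rw [norm_multiplier_sub_one (M.data _ h) (M.splits _ h) (isOfFinOrder_coe _)
    ((M.smul_pt_eq_iff _ _).mpr σ.2) (M.isMultiplier_multiplierHom σ), h1, Finset.prod_map,
    M.norm_c_eq (p := p) h, absOfVal_add, absOfVal_sum]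
  congr 1
  refine Finset.prod_congr rfl fun y' hy' => ?_
  exact M.norm_pt_sub (Finset.ne_of_mem_erase hy').symm

open Classical in
variable (p) in
/-- The valuations of displacements and of differences of fixed points. -/
def datum : FixedPointDatum p G Δ where
  w := M.valDiff p
  wTop := (M.exists_top p).choose
  w_self := M.valDiff_self
  w_lt _ _ h := M.valDiff_lt h
  w_pos := M.valDiff_pos
  w_comm := M.valDiff_comm
  min_w_le := M.min_valDiff_le
  w_smul := M.valDiff_smul
  v := M.gauss p
  v_nonneg σ h := by
    rw [← absOfVal_le_iff p K, ← M.norm_c_eq h, absOfVal_zero]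
    exact norm_displacementData_le_one _
  v_conj := M.gauss_conj
  min_v_le σ τ hσ hτ hστ := by
    rw [← absOfVal_le_iff p K, absOfVal_min, ← M.norm_c_eq hσ, ← M.norm_c_eq hτ, ← M.norm_c_eq hστ]
    exact norm_displacementData_mul_le _ _ (M.data _ hστ)
  w_smul_self σ y h := by
    have hσ : σ ≠ 1 := fun h' => h (by rw [h', one_smul])
    refine absOfVal_injective p K ?_
    rw [← M.norm_pt_sub (Ne.symm h), norm_sub_rev, M.pt_smul, M.norm_smul_sub_self (p := p) hσ,
      absOfVal_add, absOfVal_sum]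
    congr 1
    refine Finset.prod_congr rfl fun y' hy' => M.norm_pt_sub ?_
    rintro rfl
    exact h (mem_fix.mp hy')
  min_disp_le σ τ y y₁ hσ hτ hστ h h' := by
    obtain ⟨x, hx, hx'⟩ := M.exists_generic (p := p) y y₁
    rw [← absOfVal_le_iff p K, absOfVal_min, ← M.norm_smul_sub_self_eq hστ hx', Subgroup.coe_mul,
      mul_smul, ← sub_add_sub_cancel _ ((τ : DiskAut K) • x).coord]
    exact (IsUltrametricDist.norm_add_le_max _ _).trans (max_le_max
      (M.norm_smul_sub_self_le hσ (M.norm_smul_sub_pt_le h' hx)) (M.norm_smul_sub_self_le hτ hx))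
  le_disp σ y y₁ hσ h := by
    obtain ⟨x, hx, hx'⟩ := M.exists_generic (p := p) y y₁
    rw [← absOfVal_le_iff p K, ← M.norm_smul_sub_self_eq hσ hx',
      ← sub_sub_sub_cancel_right _ _ (M.pt y).coord]
    exact (norm_sub_le_max_of_ultrametric _ _).trans (max_le (M.norm_smul_sub_pt_le h hx) hx)
  stabilizer_ne_bot y h := by
    obtain ⟨σ, hσ, hσy⟩ := M.exists_smul_eq y
    have : σ ∈ MulAction.stabilizer G y := hσy
    rw [h] at this
    exact hσ (Subgroup.mem_bot.mp this)
  -- A finite group with an injective homomorphism to the multiplicative monoid of a field is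
  -- cyclic.
  isCyclic_stabilizer y := isCyclic_of_injective_ringHom _ (M.multiplierHom_injective y)
  v_add_sum_of_orderOf_eq σ y k hy hk := by
    have hσ : σ ≠ 1 := by
      rintro rfl
      rw [orderOf_one] at hk
      exact (Nat.one_lt_pow k.succ_ne_zero hp.out.one_lt).ne hk
    have h1 := M.norm_multiplierHom_sub_one (p := p) ⟨σ, hy⟩ hσ
    rw [norm_sub_one_of_orderOf_eq p K ((M.orderOf_multiplierHom ⟨σ, hy⟩).trans hk)] at h1
    exact (absOfVal_injective p K h1).symm
  v_add_sum_of_orderOf_ne σ y hy hk := by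
    have hσ : σ ≠ 1 := by
      rintro rfl
      exact hk 0 (by rw [orderOf_one, pow_zero])
    have h1 := M.norm_multiplierHom_sub_one (p := p) ⟨σ, hy⟩ hσ
    have h2 := M.orderOf_multiplierHom ⟨σ, hy⟩
    rw [norm_sub_one_of_orderOf_ne p K (h2 ▸ orderOf_pos σ) (fun k => h2 ▸ hk k),
      ← absOfVal_zero p K] at h1
    exact (absOfVal_injective p K h1).symm

theorem datum_v (σ : G) : (M.datum p).v σ = M.gauss p σ := rfl

end FixedPointModel
end Model

/-! ### The Hurwitz tree of a finite group of automorphisms of the disk -/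

section Main

theorem balanced_congr {G : Type*} [Group G] {f g : G → ℂ} (h : ∀ σ, σ ≠ 1 → f σ = g σ) :
    balanced f = balanced g := by
  classical
  ext σ
  rw [balanced, balanced, finsum_congr fun τ : {τ : G // τ ≠ 1} => h τ τ.2]
  split_ifs with h1
  · rfl
  · exact h σ h1

theorem exists_finiteDimensional_splits.{u} {K : Type u} [Field K] {ι : Type*} [Fintype ι]
    (P : ι → Polynomial K) (hP : ∀ i, (P i).Monic) :
    ∃ (L : Type u) (_ : Field L) (_ : Algebra K L) (_ : FiniteDimensional K L),
      ∀ i, ((P i).map (algebraMap K L)).Splits :=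
  ⟨(∏ i, P i).SplittingField, inferInstance, inferInstance, inferInstance, fun i =>
    (Polynomial.SplittingField.splits (∏ i, P i)).of_dvd
      (Polynomial.map_ne_zero (Polynomial.monic_prod_of_monic _ _ fun i _ => hP i).ne_zero)
      (Polynomial.map_dvd _ (Finset.dvd_prod_of_mem P (Finset.mem_univ i)))⟩

variable {K : Type*} [NontriviallyNormedField K] [IsUltrametricDist K]

/-- The points with nontrivial stabilizer in `G`. -/
def ramifiedPoints (G : Subgroup (DiskAut K)) (L : Type*) [NormedField L] [NormedAlgebra K L]
    [IsUltrametricDist L] [CompleteSpace L] : SubMulAction G (DiskPoint L) where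
  carrier := {x | ∃ σ : G, σ ≠ 1 ∧ σ • x = x}
  smul_mem' := by
    rintro τ x ⟨σ, hσ, h⟩
    refine ⟨τ * σ * τ⁻¹, fun h' => hσ (conj_eq_one_iff.mp h'), ?_⟩
    rw [mul_smul, mul_smul, inv_smul_smul, h]

variable (p : ℕ) [hp : Fact p.Prime] [CharZero K]
  [CharP (IsLocalRing.ResidueField (integerRing K)) p]
  [IsDiscreteValuationRing (integerRing K)] [CompleteSpace K]
  [Infinite (IsLocalRing.ResidueField (integerRing K))]

theorem FixedPointModel.exists_hurwitzTree {L : Type*} [NormedField L] [NormedAlgebra K L]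
    [IsUltrametricDist L] [CompleteSpace L] [Algebra.IsAlgebraic K L] {G : Subgroup (DiskAut K)}
    [Finite G] {Δ : Type} [Finite Δ] [Nonempty Δ] [MulAction G Δ] (M : FixedPointModel G L Δ) :
    ∃ T : HurwitzTree G p, T.depth = depthCharacter p G ∧ T.artin = artinCharacter p G := by
  have : CharZero L := charZero_of_injective_algebraMap (algebraMap K L).injective
  have := Fintype.ofFinite G
  have := Fintype.ofFinite Δ
  obtain ⟨T, h1, h2⟩ := (M.datum p).exists_hurwitzTree
  refine ⟨T, h1.trans (balanced_congr fun σ hσ => ?_), h2.trans (balanced_congr fun σ hσ => ?_)⟩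
  · rw [M.datum_v, displacement, (M.data σ hσ).gaussVal_eq p (M.norm_c_eq hσ),
      Complex.ofReal_ratCast]
  · rw [displacement, (M.data σ hσ).zeroCount_eq p (M.norm_c_eq hσ), M.card_fix hσ]

theorem exists_hurwitzTree_of_splits {L : Type*} [NormedField L] [NormedAlgebra K L]
    [IsUltrametricDist L] [CompleteSpace L] [Algebra.IsAlgebraic K L] {G : Subgroup (DiskAut K)}
    [Finite G] (data : ∀ σ : G, σ ≠ 1 → DisplacementData (σ : DiskAut K))
    (splits : ∀ σ h, ((data σ h).P.map (algebraMap K L)).Splits)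
    (hne : ∃ σ h, (data σ h).P.natDegree ≠ 0) :
    ∃ T : HurwitzTree G p, T.depth = depthCharacter p G ∧ T.artin = artinCharacter p G := by
  classical
  have hfin : Finite (ramifiedPoints G L) := by
    have hF : (⋃ σ : {σ : G // σ ≠ 1}, (fixedCoords L (data σ σ.2) : Set L)).Finite :=
      Set.finite_iUnion fun σ => Finset.finite_toSet _
    have := hF.to_subtype
    refine Finite.of_injective (β := ⋃ σ : {σ : G // σ ≠ 1}, (fixedCoords L (data σ σ.2) : Set L))
      (fun x => ⟨(x : DiskPoint L).coord, ?_⟩) fun x y h =>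
        Subtype.ext (DiskPoint.ext (congrArg Subtype.val h))
    obtain ⟨σ, hσ, h⟩ := x.2
    exact Set.mem_iUnion.mpr ⟨⟨σ, hσ⟩, (smul_eq_iff_mem_fixedCoords _ (splits σ hσ)).mp h⟩
  have hnonempty : Nonempty (ramifiedPoints G L) := by
    obtain ⟨σ, hσ, hdeg⟩ := hne
    have hroot := (splits σ hσ).exists_eval_eq_zero (by
      rw [Polynomial.degree_map]
      exact fun h => hdeg (Polynomial.natDegree_eq_of_degree_eq_some h))
    obtain ⟨r, hr⟩ := hroot
    have hmem : r ∈ (data σ hσ).P.aroots L := by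
      rw [Polynomial.mem_aroots]
      exact ⟨(data σ hσ).monic.ne_zero, by rwa [Polynomial.aeval_def, ← Polynomial.eval_map]⟩
    exact ⟨⟨⟨r, (data σ hσ).norm_lt_one_of_mem_aroots hmem⟩, σ, hσ,
      (smul_eq_iff_mem_aroots _ (splits σ hσ)).mpr hmem⟩⟩
  -- The points are relabelled by a `Fin` because the vertices of the tree must live in the lowest
  -- universe.
  let e : Fin (Nat.card (ramifiedPoints G L)) ≃ ramifiedPoints G L :=
    (Finite.equivFin (ramifiedPoints G L)).symm
  let _ : MulAction G (Fin (Nat.card (ramifiedPoints G L))) := e.mulAction G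
  have := e.nonempty
  have hsmul : ∀ (σ : G) i, e (σ • i) = σ • e i := fun σ i => by
    rw [e.smul_def, e.apply_symm_apply]
  let M : FixedPointModel G L (Fin (Nat.card (ramifiedPoints G L))) :=
    { data := data
      splits := splits
      pt := fun i => e i
      pt_injective := Subtype.val_injective.comp e.injective
      pt_smul := fun σ i => by rw [hsmul]; rfl
      exists_pt := fun σ hσ x hx => ⟨e.symm ⟨x, σ, hσ, hx⟩, by rw [e.apply_symm_apply]⟩
      exists_smul_eq := fun i => by
        obtain ⟨σ, hσ, h⟩ := (e i).2
        exact ⟨σ, hσ, e.injective (by rw [hsmul]; exact Subtype.ext h)⟩ }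
  exact M.exists_hurwitzTree p

theorem exists_hurwitzTree_of_finiteDimensional {L : Type*} [Field L] [Algebra K L]
    [FiniteDimensional K L] {G : Subgroup (DiskAut K)} [Finite G]
    (data : ∀ σ : G, σ ≠ 1 → DisplacementData (σ : DiskAut K))
    (splits : ∀ σ h, ((data σ h).P.map (algebraMap K L)).Splits)
    (hne : ∃ σ h, (data σ h).P.natDegree ≠ 0) :
    ∃ T : HurwitzTree G p, T.depth = depthCharacter p G ∧ T.artin = artinCharacter p G := by
  -- The spectral norm extends the absolute value of `K` and makes the finite extension complete and
  -- ultrametric.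
  let _ : NormedField L := spectralNorm.normedField K L
  let _ : NormedAlgebra K L := spectralNorm.normedAlgebra K L
  have : IsUltrametricDist L :=
    IsUltrametricDist.isUltrametricDist_of_isNonarchimedean_norm isNonarchimedean_spectralNorm
  have : CompleteSpace L := spectralNorm.completeSpace K L
  exact exists_hurwitzTree_of_splits p (L := L) data splits hne

theorem exists_hurwitzTree_of_data {G : Subgroup (DiskAut K)} [Finite G]
    (data : ∀ σ : G, σ ≠ 1 → DisplacementData (σ : DiskAut K))
    (hne : ∃ σ h, (data σ h).P.natDegree ≠ 0) :
    ∃ T : HurwitzTree G p, T.depth = depthCharacter p G ∧ T.artin = artinCharacter p G := by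
  classical
  have := Fintype.ofFinite G
  obtain ⟨L, _, _, _, hL⟩ := exists_finiteDimensional_splits
    (fun σ : {σ : G // σ ≠ 1} => (data σ.1 σ.2).P) fun σ => (data σ.1 σ.2).monic
  exact exists_hurwitzTree_of_finiteDimensional p (L := L) data (fun σ h => hL ⟨σ, h⟩) hne

/-- In degree 0 the function `σ(z) - z` is a nonzero constant times a unit, which no algebra
homomorphism to a field can send to 0. It is not needed that geometric points are evaluations. -/
theorem natDegree_ne_zero_of_fixedPoint {σ : DiskAut K} (D : DisplacementData σ)
    {y : GeometricPoint K} (hy : y ∈ fixedPoints σ) : D.P.natDegree ≠ 0 := by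
  intro hdeg
  have h1 : y (σ coordinate - coordinate) = 0 := by
    rw [map_sub, sub_eq_zero]
    exact DFunLike.congr_fun hy coordinate
  rw [D.eq_mul, Polynomial.eq_one_of_monic_natDegree_zero D.monic hdeg, map_one, one_mul,
    map_smul] at h1
  exact smul_ne_zero D.c_ne_zero (D.isUnit.map y).ne_zero h1

end Main
end HurwitzDisk
end

theorem theorem3p9 (p : ℕ) [Fact p.Prime]
    (K : Type*) [NontriviallyNormedField K] [IsUltrametricDist K] [CompleteSpace K] [CharZero K]
    [IsDiscreteValuationRing (HurwitzDisk.integerRing K)]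
    [IsAlgClosed (IsLocalRing.ResidueField (HurwitzDisk.integerRing K))]
    [CharP (IsLocalRing.ResidueField (HurwitzDisk.integerRing K)) p]
    (G : Subgroup (HurwitzDisk.DiskAut K)) [Finite G]
    (hΔ : (HurwitzDisk.allFixedPoints G).Nonempty) :
    ∃ T : HurwitzDisk.HurwitzTree G p,
      T.depth = HurwitzDisk.depthCharacter p G ∧ T.artin = HurwitzDisk.artinCharacter p G := by
  classical
  have : Infinite (IsLocalRing.ResidueField (HurwitzDisk.integerRing K)) := inferInstance
  have := Fintype.ofFinite G
  let data : ∀ σ : G, σ ≠ 1 → HurwitzDisk.DisplacementData (σ : HurwitzDisk.DiskAut K) :=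
    fun σ h => (HurwitzDisk.nonempty_displacementData fun h' => h (Subtype.ext h')).some
  refine HurwitzDisk.exists_hurwitzTree_of_data p data ?_
  obtain ⟨y, hy⟩ := hΔ
  simp only [HurwitzDisk.allFixedPoints, Set.mem_iUnion] at hy
  obtain ⟨σ, ⟨hσG, hσ⟩, hy⟩ := hy
  have hσ' : (⟨σ, hσG⟩ : G) ≠ 1 := fun h => hσ (congrArg Subtype.val h)
  exact ⟨⟨σ, hσG⟩, hσ', HurwitzDisk.natDegree_ne_zero_of_fixedPoint (data _ hσ') hy⟩
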